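/- Let $d\ge 1$, $r>0$, and let $U:\mathbb R^d\to\mathbb R$ be smooth and $1$-periodic ($U(x+k)=U(x)$ for $k\in\mathbb Z^d$), regarded also as a function on the torus $\mathbb T^d=(\mathbb R/\mathbb Z)^d$. A cooling schedule is a non-increasing function $t\mapsto\varepsilon_t\in(0,\infty)$ on $[0,\infty)$. Let $dx$ be the uniform law on $\mathbb T^d$, $dy$ the uniform law on the sphere $\mathbb S^{d-1}$ of $\mathbb R^d$, and $(a)_+=\max(a,0)$. Given a cooling schedule, consider the inhomogeneous Markov process $(X_t,Y_t)$ on $\mathbb T^d\times\mathbb S^{d-1}$ with generator $$L_tf(x,y)=y\cdot\nabla_xf(x,y)+\frac{(y\cdot\nabla U(x))_+}{\varepsilon_t}\bigl(f(x,y^*)-f(x,y)\bigr)+r\Bigl(\int f(x,z)\,dz-f(x,y)\Bigr),$$ $$y^*=y-2\Bigl(y\cdot\frac{\nabla U(x)}{|\nabla U(x)|}\Bigr)\frac{\nabla U(x)}{|\nabla U(x)|},$$ constructed as follows. From time $s$ on and from the state $(x,y)$, the position moves along $x+(u-s)y$ with constant velocity $y$ up to the time $T\wedge S$, where $$T=\inf\Bigl\{u>s:\int_s^u\frac{\bigl(y\cdot\nabla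 U(x+(v-s)y)\bigr)_+}{\varepsilon_v}\,dv\ge E_1\Bigr\},\qquad S=s+\frac{E_2}{r},$$ and $E_1,E_2$ are independent standard exponential variables. At that time the velocity is replaced by an independent uniform point of $\mathbb S^{d-1}$ if $T\wedge S=S$, and otherwise it is reflected to $y^*$ (computed at the current position); then the procedure starts again with fresh independent variables. For a probability measure $\mu$ on $\mathbb T^d\times\mathbb S^{d-1}$ and $0\le s\le t$ let $\mu P_{s,t}$ be the law of $(X_t,Y_t)$ when $(X_s,Y_s)$ has law $\mu$. Let $\nu_t$ be the probability measure on $\mathbb T^d\times\mathbb S^{d-1}$ proportional to $e^{-U(x)/\varepsilon_t}\,dx\,dy$, and let $$\|\mu_1-\mu_2\|_{TV}=\inf_{Z_1\sim\mu_1,\,Z_2\sim\mu_2}\mathbb P(Z_1\ne Z_2).$$ Theorem. There exist $c,\theta>0$, depending only on $d$, $r$ and $U$, such that for every cooling schedule, every probability measure $\mu$ on $\mathbb T^d\times\mathbb S^{d-1}$ and every $t\ge0$, $$\|\mu P_{t,t+\sqrt d}-\nu_t\|_{TV}\le\bigl(1-c\,e^{-\theta/\varepsilon_t}\bigr)\,\|\mu-\nu_t\|_{TV}+\theta\Bigl(\frac1{\varepsilon_{t+\sqrt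 d}}-\frac1{\varepsilon_t}\Bigr).$$ -/

import Mathlib

open MeasureTheory ProbabilityTheory Set
open scoped NNReal ENNReal ContDiff RealInnerProductSpace

namespace VelocityJump

/-- A smooth potential on `ℝ^d` that is `1`-periodic in every coordinate. -/
structure PeriodicPotential (d : ℕ) where
  toFun : EuclideanSpace ℝ (Fin d) → ℝ
  smooth : ContDiff ℝ ∞ toFun
  periodic : ∀ (x : EuclideanSpace ℝ (Fin d)) (k : Fin d → ℤ),
    toFun (x + WithLp.toLp 2 (fun i => (k i : ℝ))) = toFun x

/-- A cooling schedule: a positive non-increasing temperature `t ↦ ε_t`, `t ≥ 0`. -/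
structure CoolingSchedule where
  temp : ℝ≥0 → ℝ
  pos : ∀ t, 0 < temp t
  anti : Antitone temp

/-- The unit sphere `𝕊^{d-1}` of the Euclidean space `ℝ^d`. -/
abbrev Sph (d : ℕ) : Type := Metric.sphere (0 : EuclideanSpace ℝ (Fin d)) 1

/-- The state space `𝕋^d × 𝕊^{d-1}`; a state is a pair (position, velocity). -/
abbrev State (d : ℕ) : Type := UnitAddTorus (Fin d) × Sph d

/-- The uniform probability measure on `𝕊^{d-1}`: the normalised surface measure. -/
noncomputable def unifSph (d : ℕ) : Measure (Sph d) :=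
  ((volume : Measure (EuclideanSpace ℝ (Fin d))).toSphere univ)⁻¹ •
    (volume : Measure (EuclideanSpace ℝ (Fin d))).toSphere

instance (d : ℕ) [NeZero d] : IsProbabilityMeasure (unifSph d) := by
  refine ⟨?_⟩
  have h0 : (volume : Measure (EuclideanSpace ℝ (Fin d))).toSphere univ ≠ 0 := by
    rw [Measure.measure_univ_ne_zero]
    exact Measure.toSphere_ne_zero _
  simp only [unifSph, Measure.smul_apply, smul_eq_mul]
  exact ENNReal.inv_mul_cancel h0 (measure_ne_top _ _)

/-- The representative in `[0,1)^d ⊆ ℝ^d` of a point of the torus. -/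
noncomputable def rep {d : ℕ} (x : UnitAddTorus (Fin d)) : EuclideanSpace ℝ (Fin d) :=
  WithLp.toLp 2 (fun i => (AddCircle.measurableEquivIco (1 : ℝ) 0 (x i) : ℝ))

/-- The potential as a function on the torus. -/
noncomputable def pot {d : ℕ} (U : PeriodicPotential d) (x : UnitAddTorus (Fin d)) : ℝ :=
  U.toFun (rep x)

/-- The gradient of the potential as a function on the torus. -/
noncomputable def grad {d : ℕ} (U : PeriodicPotential d) (x : UnitAddTorus (Fin d)) :
    EuclideanSpace ℝ (Fin d) :=
  gradient U.toFun (rep x)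

/-- The position `x + s y` on the torus. -/
noncomputable def move {d : ℕ} (x : UnitAddTorus (Fin d)) (y : Sph d) (s : ℝ) :
    UnitAddTorus (Fin d) :=
  fun i => x i + ((s * (y : EuclideanSpace ℝ (Fin d)) i : ℝ) : UnitAddCircle)

/-- The unit vector `g / |g|` (and `0` when `g = 0`). -/
noncomputable def dir {d : ℕ} (g : EuclideanSpace ℝ (Fin d)) : EuclideanSpace ℝ (Fin d) :=
  ‖g‖⁻¹ • g

theorem norm_reflect {d : ℕ} (g : EuclideanSpace ℝ (Fin d)) (y : Sph d) :
    (y : EuclideanSpace ℝ (Fin d)) - (2 * ⟪(y : EuclideanSpace ℝ (Fin d)), dir g⟫) • dir g ∈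
      Metric.sphere (0 : EuclideanSpace ℝ (Fin d)) 1 := by
  have hy : ‖(y : EuclideanSpace ℝ (Fin d))‖ = 1 := by simp
  rw [mem_sphere_zero_iff_norm]
  by_cases hg : g = 0
  · simp [dir, hg]
  · have hn : ‖dir g‖ = 1 := by
      have : ‖g‖ ≠ 0 := by simpa using hg
      rw [dir, norm_smul, norm_inv, norm_norm, inv_mul_cancel₀ this]
    have h2 : ‖(y : EuclideanSpace ℝ (Fin d)) -
        (2 * ⟪(y : EuclideanSpace ℝ (Fin d)), dir g⟫) • dir g‖ ^ 2 = 1 := by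
      rw [norm_sub_sq_real, norm_smul, real_inner_smul_right, hn, hy, Real.norm_eq_abs, mul_one,
        sq_abs]
      ring
    nlinarith [norm_nonneg ((y : EuclideanSpace ℝ (Fin d)) -
        (2 * ⟪(y : EuclideanSpace ℝ (Fin d)), dir g⟫) • dir g)]

/-- The reflected velocity `y* = y - 2 (y · n) n`, where `n = ∇U(x) / |∇U(x)|`
(`y* = y` where `∇U(x) = 0`; the rate of reflection vanishes there). -/
noncomputable def reflectVel {d : ℕ} (U : PeriodicPotential d) (x : UnitAddTorus (Fin d))
    (y : Sph d) : Sph d :=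
  ⟨_, norm_reflect (grad U x) y⟩

/-- The rate `(y · ∇U(x))₊ / ε_u` of reflection at time `u` in the state `(x, y)`
(only times `u ≥ 0` matter). -/
noncomputable def rate {d : ℕ} (U : PeriodicPotential d) (ε : CoolingSchedule) (u : ℝ)
    (z : State d) : ℝ :=
  max ⟪(z.2 : EuclideanSpace ℝ (Fin d)), grad U z.1⟫ 0 / ε.temp u.toNNReal

/-- The randomness used for one jump: the exponential variables of the reflection clock and of the
refreshment clock, and the new velocity in case of a refreshment. -/
abbrev Mark (d : ℕ) : Type := ℝ × ℝ × Sph d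

/-- One mark: two independent standard exponential variables and an independent uniform velocity. -/
noncomputable def markLaw (d : ℕ) : Measure (Mark d) :=
  (expMeasure 1).prod ((expMeasure 1).prod (unifSph d))

instance (d : ℕ) [NeZero d] : IsProbabilityMeasure (markLaw d) := by
  have : IsProbabilityMeasure (expMeasure 1) := isProbabilityMeasure_expMeasure one_pos
  unfold markLaw
  infer_instance

/-- An i.i.d. sequence of marks. -/
noncomputable def noise (d : ℕ) [NeZero d] : Measure (ℕ → Mark d) :=
  Measure.infinitePi (fun _ => markLaw d)

instance (d : ℕ) [NeZero d] : IsProbabilityMeasure (noise d) := by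
  unfold noise
  infer_instance

/-- The time of ringing of the refreshment clock started at time `s`. -/
noncomputable def refreshTime {d : ℕ} (r s : ℝ) (w : Mark d) : ℝ := s + w.2.1 / r

/-- The next jump time `T ∧ S` after time `s`, from the state `z`: here `S` is the refreshment time
and `T = inf {u > s, ∫_s^u (y · ∇U(x + (v - s) y))₊ / ε_v dv ≥ E}`. -/
noncomputable def jumpTime {d : ℕ} (U : PeriodicPotential d) (ε : CoolingSchedule) (r : ℝ)
    (p : ℝ × State d) (w : Mark d) : ℝ :=
  sInf (insert (refreshTime r p.1 w)
    {u : ℝ | p.1 < u ∧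
      w.1 ≤ ∫ v in p.1..u, rate U ε v (move p.2.1 p.2.2 (v - p.1), p.2.2)})

/-- From the time of a jump and the state just after it, to the next ones: the position moves in
straight line up to the jump time `T ∧ S`; then the velocity is refreshed if `T ∧ S = S`, and
reflected otherwise. -/
noncomputable def step {d : ℕ} (U : PeriodicPotential d) (ε : CoolingSchedule) (r : ℝ)
    (p : ℝ × State d) (w : Mark d) : ℝ × State d :=
  open scoped Classical in
  (jumpTime U ε r p w,
    (move p.2.1 p.2.2 (jumpTime U ε r p w - p.1),
      if jumpTime U ε r p w = refreshTime r p.1 w then w.2.2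
      else reflectVel U (move p.2.1 p.2.2 (jumpTime U ε r p w - p.1)) p.2.2))

/-- The time of the `n`-th jump and the state just after it, for the process started at time `s` in
the state `z` (for `n = 0`: the initial time and state). -/
noncomputable def chain {d : ℕ} (U : PeriodicPotential d) (ε : CoolingSchedule) (r s : ℝ)
    (z : State d) (ξ : ℕ → Mark d) : ℕ → ℝ × State d
  | 0 => (s, z)
  | n + 1 => step U ε r (chain U ε r s z ξ n) (ξ n)

/-- The number of jumps up to time `t`. -/
noncomputable def jumpCount {d : ℕ} (U : PeriodicPotential d) (ε : CoolingSchedule) (r s t : ℝ)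
    (z : State d) (ξ : ℕ → Mark d) : ℕ :=
  sInf {n : ℕ | t < (chain U ε r s z ξ (n + 1)).1}

/-- The state at time `t ≥ s` of the velocity jump process started at time `s` in the state `z`. -/
noncomputable def process {d : ℕ} (U : PeriodicPotential d) (ε : CoolingSchedule) (r s t : ℝ)
    (z : State d) (ξ : ℕ → Mark d) : State d :=
  let p := chain U ε r s z ξ (jumpCount U ε r s t z ξ)
  (move p.2.1 p.2.2 (t - p.1), p.2.2)

section Measurability

variable {d : ℕ}

theorem measurable_rep : Measurable (rep : UnitAddTorus (Fin d) → _) := by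
  unfold rep
  refine (WithLp.measurable_toLp 2 _).comp (measurable_pi_lambda _ fun i => ?_)
  exact measurable_subtype_coe.comp
    ((AddCircle.measurableEquivIco (1 : ℝ) 0).measurable.comp (measurable_pi_apply i))

theorem measurable_grad (U : PeriodicPotential d) : Measurable (grad U) := by
  have h : Continuous (gradient U.toFun) :=
    (InnerProductSpace.toDual ℝ _).symm.continuous.comp
      (U.smooth.continuous_fderiv (by simp))
  exact h.measurable.comp measurable_rep

theorem measurable_move :
    Measurable (fun q : (UnitAddTorus (Fin d) × Sph d) × ℝ => move q.1.1 q.1.2 q.2) := by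
  unfold move
  refine measurable_pi_lambda _ fun i => ?_
  refine Measurable.add ((measurable_pi_apply i).comp (by fun_prop)) ?_
  have h : Measurable (fun q : (UnitAddTorus (Fin d) × Sph d) × ℝ =>
      q.2 * (q.1.2 : EuclideanSpace ℝ (Fin d)) i) := by
    fun_prop
  exact (AddCircle.measurable_mk').comp h

theorem measurable_reflectVel (U : PeriodicPotential d) :
    Measurable (fun z : State d => reflectVel U z.1 z.2) := by
  unfold reflectVel dir
  have hg : Measurable (fun z : State d => grad U z.1) := (measurable_grad U).comp measurable_fst
  refine Measurable.subtype_mk ?_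
  fun_prop

theorem measurable_rate (U : PeriodicPotential d) (ε : CoolingSchedule) :
    Measurable (fun q : ℝ × State d => rate U ε q.1 q.2) := by
  have hg : Measurable (fun q : ℝ × State d => grad U q.2.1) :=
    (measurable_grad U).comp (by fun_prop)
  have he : Measurable ε.temp := ε.anti.measurable
  unfold rate
  fun_prop

theorem rate_nonneg (U : PeriodicPotential d) (ε : CoolingSchedule) (u : ℝ) (z : State d) :
    0 ≤ rate U ε u z :=
  div_nonneg (le_max_right _ _) (ε.pos _).le

theorem exists_norm_grad_le (U : PeriodicPotential d) : ∃ G : ℝ, ∀ x, ‖grad U x‖ ≤ G := by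
  have hc : Continuous (gradient U.toFun) :=
    (InnerProductSpace.toDual ℝ _).symm.continuous.comp
      (U.smooth.continuous_fderiv (by simp))
  have hK : IsCompact ((WithLp.toLp 2 : (Fin d → ℝ) → EuclideanSpace ℝ (Fin d)) ''
      (Set.pi univ fun _ => Icc (0 : ℝ) 1)) :=
    (isCompact_univ_pi fun _ => isCompact_Icc).image (PiLp.continuous_toLp 2 _)
  obtain ⟨G, hG⟩ := hK.exists_bound_of_continuousOn hc.continuousOn
  refine ⟨G, fun x => hG _ ⟨_, ?_, rfl⟩⟩
  intro i _
  have h := (AddCircle.measurableEquivIco (1 : ℝ) 0 (x i)).2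
  exact ⟨h.1, h.2.le.trans_eq (zero_add 1)⟩

theorem measurable_path :
    Measurable (fun q : (ℝ × State d) × ℝ =>
      (q.2, ((move q.1.2.1 q.1.2.2 (q.2 - q.1.1), q.1.2.2) : State d))) := by
  have h1 : Measurable (fun q : (ℝ × State d) × ℝ => (q.1.2, q.2 - q.1.1)) :=
    measurable_fst.snd.prodMk (measurable_snd.sub measurable_fst.fst)
  have h2 := (measurable_move (d := d)).comp h1
  exact measurable_snd.prodMk (h2.prodMk measurable_fst.snd.snd)

theorem measurable_ratePath (U : PeriodicPotential d) (ε : CoolingSchedule) :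
    Measurable (fun q : (ℝ × State d) × ℝ =>
      rate U ε q.2 (move q.1.2.1 q.1.2.2 (q.2 - q.1.1), q.1.2.2)) := by
  have h := (measurable_rate (d := d) U ε).comp measurable_path
  simpa only [Function.comp_def] using h

theorem intervalIntegrable_rate (U : PeriodicPotential d) (ε : CoolingSchedule)
    (p : ℝ × State d) (a b : ℝ) :
    IntervalIntegrable (fun v => rate U ε v (move p.2.1 p.2.2 (v - p.1), p.2.2)) volume a b := by
  obtain ⟨G, hG⟩ := exists_norm_grad_le U
  have hm : Measurable (fun v => rate U ε v (move p.2.1 p.2.2 (v - p.1), p.2.2)) := by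
    have h := (measurable_ratePath (d := d) U ε).comp
      (measurable_prodMk_left (x := p) (β := ℝ))
    simpa only [Function.comp_def] using h
  have hG0 : 0 ≤ G := (norm_nonneg _).trans (hG p.2.1)
  refine (intervalIntegrable_const (c := G / ε.temp (max a b).toNNReal)).mono_fun
    hm.aestronglyMeasurable ?_
  filter_upwards [ae_restrict_mem measurableSet_uIoc] with v hv
  have hv' : v ≤ max a b := hv.2
  have h1 : ⟪(p.2.2 : EuclideanSpace ℝ (Fin d)), grad U (move p.2.1 p.2.2 (v - p.1))⟫ ≤ G := by
    refine (real_inner_le_norm _ _).trans ?_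
    have : ‖(p.2.2 : EuclideanSpace ℝ (Fin d))‖ = 1 := by simp
    rw [this, one_mul]
    exact hG _
  rw [Real.norm_of_nonneg (rate_nonneg _ _ _ _),
    Real.norm_of_nonneg (div_nonneg hG0 (ε.pos _).le)]
  exact div_le_div₀ hG0 (max_le h1 hG0) (ε.pos _) (ε.anti (Real.toNNReal_le_toNNReal hv'))

theorem measurable_integral_rate (U : PeriodicPotential d) (ε : CoolingSchedule) (b : ℝ) :
    Measurable (fun p : ℝ × State d =>
      ∫ v in p.1..b, rate U ε v (move p.2.1 p.2.2 (v - p.1), p.2.2)) := by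
  have h : ∀ p : ℝ × State d,
      ∫ v in p.1..b, rate U ε v (move p.2.1 p.2.2 (v - p.1), p.2.2) =
      (∫ v, {q : (ℝ × State d) × ℝ | q.1.1 < q.2 ∧ q.2 ≤ b}.indicator (fun q =>
        rate U ε q.2 (move q.1.2.1 q.1.2.2 (q.2 - q.1.1), q.1.2.2)) (p, v)) -
      ∫ v, {q : (ℝ × State d) × ℝ | b < q.2 ∧ q.2 ≤ q.1.1}.indicator (fun q =>
        rate U ε q.2 (move q.1.2.1 q.1.2.2 (q.2 - q.1.1), q.1.2.2)) (p, v) := by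
    intro p
    rw [intervalIntegral, ← integral_indicator measurableSet_Ioc,
      ← integral_indicator measurableSet_Ioc]
    rfl
  simp_rw [h]
  have hm := measurable_ratePath (d := d) U ε
  refine Measurable.sub ?_ ?_
  · refine (StronglyMeasurable.integral_prod_right' (ν := volume) ?_).measurable
    refine (hm.indicator ?_).stronglyMeasurable
    exact (measurableSet_lt measurable_fst.fst measurable_snd).inter
      (measurableSet_le measurable_snd measurable_const)
  · refine (StronglyMeasurable.integral_prod_right' (ν := volume) ?_).measurable
    refine (hm.indicator ?_).stronglyMeasurable
    exact (measurableSet_lt measurable_const measurable_snd).inter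
      (measurableSet_le measurable_snd measurable_fst.fst)

theorem measurable_jumpTime (U : PeriodicPotential d) (ε : CoolingSchedule) (r : ℝ) :
    Measurable (fun q : (ℝ × State d) × Mark d => jumpTime U ε r q.1 q.2) := by
  refine measurable_of_Iio fun a => ?_
  have hS : Measurable (fun q : (ℝ × State d) × Mark d => refreshTime r q.1.1 q.2) := by
    unfold refreshTime
    fun_prop
  have h : (fun q : (ℝ × State d) × Mark d => jumpTime U ε r q.1 q.2) ⁻¹' Iio a =
      {q | refreshTime r q.1.1 q.2 < a} ∪ ⋃ (b : ℚ) (_ : (b : ℝ) < a),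
        ({q | q.1.1 < (b : ℝ)} ∩ {q | q.2.1 ≤
          ∫ v in q.1.1..(b : ℝ), rate U ε v (move q.1.2.1 q.1.2.2 (v - q.1.1), q.1.2.2)}) := by
    ext ⟨p, w⟩
    have hb : BddBelow (insert (refreshTime r p.1 w)
        {u : ℝ | p.1 < u ∧
          w.1 ≤ ∫ v in p.1..u, rate U ε v (move p.2.1 p.2.2 (v - p.1), p.2.2)}) :=
      BddBelow.insert _ ⟨p.1, fun u hu => hu.1.le⟩
    simp only [mem_preimage, mem_Iio, jumpTime, csInf_lt_iff hb (insert_nonempty _ _), mem_union,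
      mem_iUnion, mem_inter_iff, mem_ofPred_eq, exists_prop, mem_insert_iff]
    constructor
    · rintro ⟨u, rfl | ⟨hu1, hu2⟩, hua⟩
      · exact Or.inl hua
      · obtain ⟨b, hb1, hb2⟩ := exists_rat_btwn hua
        refine Or.inr ⟨b, hb2, hu1.trans hb1, hu2.trans ?_⟩
        exact intervalIntegral.integral_mono_interval le_rfl hu1.le hb1.le
          (Filter.Eventually.of_forall fun v => rate_nonneg _ _ _ _)
          (intervalIntegrable_rate U ε p _ _)
    · rintro (h | ⟨b, hba, h1, h2⟩)
      · exact ⟨_, Or.inl rfl, h⟩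
      · exact ⟨b, Or.inr ⟨h1, h2⟩, hba⟩
  rw [h]
  refine (measurableSet_lt hS measurable_const).union
    (MeasurableSet.iUnion fun b => MeasurableSet.iUnion fun _ => ?_)
  exact (measurableSet_lt (by fun_prop) measurable_const).inter
    (measurableSet_le (by fun_prop) ((measurable_integral_rate U ε b).comp measurable_fst))

theorem measurable_step (U : PeriodicPotential d) (ε : CoolingSchedule) (r : ℝ) :
    Measurable (fun q : (ℝ × State d) × Mark d => step U ε r q.1 q.2) := by
  have hJ := measurable_jumpTime (d := d) U ε r
  have hS : Measurable (fun q : (ℝ × State d) × Mark d => refreshTime r q.1.1 q.2) := by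
    unfold refreshTime
    fun_prop
  have hX : Measurable (fun q : (ℝ × State d) × Mark d =>
      move q.1.2.1 q.1.2.2 (jumpTime U ε r q.1 q.2 - q.1.1)) :=
    measurable_move.comp
      (f := fun q : (ℝ × State d) × Mark d => (q.1.2, jumpTime U ε r q.1 q.2 - q.1.1))
      (by fun_prop)
  unfold step
  refine hJ.prodMk (hX.prodMk (Measurable.ite (measurableSet_eq_fun hJ hS) (by fun_prop) ?_))
  exact (measurable_reflectVel U).comp
    (f := fun q : (ℝ × State d) × Mark d =>
      (move q.1.2.1 q.1.2.2 (jumpTime U ε r q.1 q.2 - q.1.1), q.1.2.2)) (by fun_prop)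

theorem measurable_chain (U : PeriodicPotential d) (ε : CoolingSchedule) (r s : ℝ) (n : ℕ) :
    Measurable (fun q : State d × (ℕ → Mark d) => chain U ε r s q.1 q.2 n) := by
  induction n with
  | zero => simp only [chain]; fun_prop
  | succ n ih =>
    simp only [chain]
    exact (measurable_step U ε r).comp (ih.prodMk (by fun_prop))

theorem measurable_jumpCount (U : PeriodicPotential d) (ε : CoolingSchedule) (r s t : ℝ) :
    Measurable (fun q : State d × (ℕ → Mark d) => jumpCount U ε r s t q.1 q.2) := by
  have hset : ∀ n, MeasurableSet {q : State d × (ℕ → Mark d) |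
      t < (chain U ε r s q.1 q.2 (n + 1)).1} := fun n =>
    measurableSet_lt measurable_const (measurable_chain U ε r s (n + 1)).fst
  refine measurable_of_Iio fun m => ?_
  have h : (fun q : State d × (ℕ → Mark d) => jumpCount U ε r s t q.1 q.2) ⁻¹' Iio m =
      (⋃ (n : ℕ) (_ : n < m), {q | t < (chain U ε r s q.1 q.2 (n + 1)).1}) ∪
      ((⋃ n : ℕ, {q | t < (chain U ε r s q.1 q.2 (n + 1)).1})ᶜ ∩ {_q | 0 < m}) := by
    ext q
    simp only [mem_preimage, mem_Iio, jumpCount, mem_union, mem_iUnion, mem_ofPred_eq, exists_prop,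
      mem_inter_iff, mem_compl_iff]
    by_cases hne : ∃ n, t < (chain U ε r s q.1 q.2 (n + 1)).1
    · have h1 : t < (chain U ε r s q.1 q.2
          (sInf {n : ℕ | t < (chain U ε r s q.1 q.2 (n + 1)).1} + 1)).1 := Nat.sInf_mem hne
      constructor
      · exact fun h => Or.inl ⟨_, h, h1⟩
      · rintro (⟨n, hn, h⟩ | ⟨h, -⟩)
        · exact (Nat.sInf_le h).trans_lt hn
        · exact absurd hne h
    · have h0 : {n : ℕ | t < (chain U ε r s q.1 q.2 (n + 1)).1} = ∅ := by
        ext n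
        simpa using fun h => hne ⟨n, h⟩
      rw [h0, Nat.sInf_empty]
      constructor
      · exact fun h => Or.inr ⟨hne, h⟩
      · rintro (⟨n, hn, -⟩ | ⟨-, h⟩)
        · exact (Nat.zero_le n).trans_lt hn
        · exact h
  rw [h]
  exact (MeasurableSet.iUnion fun n => MeasurableSet.iUnion fun _ => hset n).union
    ((MeasurableSet.iUnion hset).compl.inter (MeasurableSet.const _))

theorem measurable_process (U : PeriodicPotential d) (ε : CoolingSchedule) (r s t : ℝ) :
    Measurable (fun q : State d × (ℕ → Mark d) => process U ε r s t q.1 q.2) := by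
  have h : Measurable (fun q : ℕ × (State d × (ℕ → Mark d)) =>
      chain U ε r s q.2.1 q.2.2 q.1) :=
    measurable_from_prod_countable_right fun n => measurable_chain U ε r s n
  have hp : Measurable (fun q : State d × (ℕ → Mark d) =>
      chain U ε r s q.1 q.2 (jumpCount U ε r s t q.1 q.2)) :=
    h.comp ((measurable_jumpCount U ε r s t).prodMk measurable_id)
  exact ((measurable_path (d := d)).comp (hp.prodMk (measurable_const (a := t)))).snd

end Measurability

/-- The law `μ P_{s,t}` at time `t` of the velocity jump process whose law at time `s` is `μ`. -/
noncomputable def lawAt {d : ℕ} [NeZero d] (U : PeriodicPotential d) (ε : CoolingSchedule) (r : ℝ)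
    (μ : Measure (State d)) (s t : ℝ≥0) : Measure (State d) :=
  (μ.prod (noise d)).map (fun q => process U ε r s t q.1 q.2)

instance {d : ℕ} [NeZero d] (U : PeriodicPotential d) (ε : CoolingSchedule) (r : ℝ)
    (μ : Measure (State d)) [IsProbabilityMeasure μ] (s t : ℝ≥0) :
    IsProbabilityMeasure (lawAt U ε r μ s t) :=
  Measure.isProbabilityMeasure_map (measurable_process U ε r s t).aemeasurable

/-- The probability measure `ν_t` on `𝕋^d × 𝕊^{d-1}` proportional to `e^{-U(x)/ε_t} dx × dy`. -/
noncomputable def gibbs {d : ℕ} (U : PeriodicPotential d) (ε : CoolingSchedule) (t : ℝ≥0) :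
    Measure (State d) :=
  ((volume : Measure (UnitAddTorus (Fin d))).prod (unifSph d)).tilted
    (fun z => -(pot U z.1 / ε.temp t))

/-- The total variation distance `inf ℙ(Z₁ ≠ Z₂)`, over the couplings `π` of `μ₁` and `μ₂`. -/
noncomputable def tvDist {E : Type*} [MeasurableSpace E] (μ₁ μ₂ : Measure E) : ℝ :=
  sInf {a : ℝ | ∃ π : Measure (E × E), π.map Prod.fst = μ₁ ∧ π.map Prod.snd = μ₂ ∧
    a = π.real {q | q.1 ≠ q.2}}

end VelocityJump

/-! Write t' = t + √d and let G bound |∇U|. The process with the temperature frozen at ε_t leaves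
ν_t invariant and satisfies a Doeblin condition: from every state, its law at time t' is at least k
= c e^{-θ/ε_t} times the uniform law. So two laws that agree up to mass a agree up to mass (1 - k) a
after the frozen dynamics. The true dynamics is compared with the frozen one path by path. As ε
decreases, reflection rates can only grow, and a path density loses only through its no-jump
factors, by at most e^{-δ} with δ = G √d (1/ε_{t'} - 1/ε_t). If α ≤ μ and α ≤ ν_t is the common part
given by a coupling with P(Z₁ ≠ Z₂) = a, then e^{-δ} times (α moved by the frozen dynamics + a k ·
uniform) lies below both the true law at t' and ν_t. A coupling built on this common part disagrees
with probability at most 1 - e^{-δ} (1 - (1 - k) a) ≤ (1 - k) a + δ (`tvDist_lawAt_le`).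

Everything rests on expanding the law in the number of jumps: the expectation of f is the sum over n
of κ^n applied to the no-jump term, where κ = `jumpStep` is the kernel of the chain of jump times
and states. In general only "≥" is needed (`tsum_le_lintegral_process`). At constant temperature
equality follows, because the series has total mass one and the bound applies to both f and 1 - f
(`lintegral_process_const`). The comparison of the two dynamics is made term by term
(`lintegral_process_ge`).

Invariance (`lintegral_process_gibbs`) is proved by time reversal, without differentiating a
semigroup. Along a straight line, e^{-U/e} at the start times the forward survival equals e^{-U/e}
at the end times the survival under the rate (-y·∇U)₊/e, and reflections exchange the two rates
while preserving the uniform law on the sphere. The resulting conservation laws telescope in the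
number of jumps.

The Doeblin condition (`lintegral_process_const_ge`) uses paths with two refreshments and no
reflection. After the first refreshment the displacement is w y + (σ - w) b, with y uniform and b
the final velocity. For fixed b, the map v ↦ v + (σ - |v|) b is 2-Lipschitz and its image of the
ball of radius σ contains that ball, so Lebesgue measure there is at most 2^d times its image
measure. A ball of radius √d/2 covers the torus, and a first refreshment during the first half of
[t, t + √d] leaves σ ≥ √d/2. -/

namespace VelocityJump

/-! ### Lifting to ℝ^d, straight motion and integration on the torus -/

section Torus

variable {d : ℕ}

/-- The projection `ℝ^d → 𝕋^d`. -/
noncomputable def proj (v : EuclideanSpace ℝ (Fin d)) : UnitAddTorus (Fin d) :=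
  fun i => ((v i : ℝ) : UnitAddCircle)

theorem proj_add (v w : EuclideanSpace ℝ (Fin d)) : proj (v + w) = proj v + proj w := by
  funext i
  simp [proj]

theorem measurable_proj : Measurable (proj : EuclideanSpace ℝ (Fin d) → _) := by
  unfold proj
  refine measurable_pi_lambda _ fun i => ?_
  exact AddCircle.measurable_mk'.comp (by fun_prop)

theorem proj_rep (x : UnitAddTorus (Fin d)) : proj (rep x) = x := by
  funext i
  exact (AddCircle.measurableEquivIco (1 : ℝ) 0).symm_apply_apply (x i)

theorem exists_rep_proj (v : EuclideanSpace ℝ (Fin d)) :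
    ∃ k : Fin d → ℤ, rep (proj v) = v + WithLp.toLp 2 (fun i => (k i : ℝ)) := by
  have h : ∀ i, ∃ n : ℤ, rep (proj v) i = v i + n := fun i => by
    have h1 : ((rep (proj v) i : ℝ) : UnitAddCircle) = ((v i : ℝ) : UnitAddCircle) :=
      congrFun (proj_rep (proj v)) i
    obtain ⟨n, hn⟩ := AddCircle.coe_eq_zero_iff (1 : ℝ) |>.1
      (by rw [AddCircle.coe_sub, h1, sub_self] :
        ((rep (proj v) i - v i : ℝ) : UnitAddCircle) = 0)
    refine ⟨n, ?_⟩
    rw [zsmul_one] at hn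
    linarith
  choose k hk using h
  refine ⟨k, ?_⟩
  ext i
  simp [hk]

theorem pot_proj (U : PeriodicPotential d) (v : EuclideanSpace ℝ (Fin d)) :
    pot U (proj v) = U.toFun v := by
  obtain ⟨k, hk⟩ := exists_rep_proj v
  rw [pot, hk, U.periodic]

theorem grad_proj (U : PeriodicPotential d) (v : EuclideanSpace ℝ (Fin d)) :
    grad U (proj v) = gradient U.toFun v := by
  obtain ⟨k, hk⟩ := exists_rep_proj v
  have h : (fun x => U.toFun (x + WithLp.toLp 2 (fun i => (k i : ℝ)))) = U.toFun := by
    funext x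
    exact U.periodic x k
  rw [grad, hk, gradient, gradient, ← fderiv_comp_add_right, h]

theorem move_proj (v : EuclideanSpace ℝ (Fin d)) (y : Sph d) (s : ℝ) :
    move (proj v) y s = proj (v + s • (y : EuclideanSpace ℝ (Fin d))) := by
  funext i
  simp [move, proj]

theorem move_eq_add (x : UnitAddTorus (Fin d)) (y : Sph d) (s : ℝ) :
    move x y s = x + proj (s • (y : EuclideanSpace ℝ (Fin d))) := by
  funext i
  simp [move, proj]

theorem move_eq_proj (x : UnitAddTorus (Fin d)) (y : Sph d) (s : ℝ) :
    move x y s = proj (rep x + s • (y : EuclideanSpace ℝ (Fin d))) := by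
  rw [← move_proj, proj_rep]

theorem move_move (x : UnitAddTorus (Fin d)) (y : Sph d) (s t : ℝ) :
    move (move x y s) y t = move x y (s + t) := by
  rw [move_eq_add, move_eq_add, move_eq_add, add_smul, proj_add, add_assoc]

theorem move_zero (x : UnitAddTorus (Fin d)) (y : Sph d) : move x y 0 = x := by
  funext i
  simp [move]

theorem continuous_gradient (U : PeriodicPotential d) : Continuous (gradient U.toFun) :=
  (InnerProductSpace.toDual ℝ _).symm.continuous.comp (U.smooth.continuous_fderiv (by simp))

theorem continuous_grad_move (U : PeriodicPotential d) (x : UnitAddTorus (Fin d)) (y : Sph d) :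
    Continuous (fun s => grad U (move x y s)) := by
  simp only [move_eq_proj, grad_proj]
  exact (continuous_gradient U).comp (by fun_prop)

theorem measurable_pot (U : PeriodicPotential d) : Measurable (pot U) :=
  U.smooth.continuous.measurable.comp measurable_rep

theorem exists_abs_pot_le (U : PeriodicPotential d) : ∃ M : ℝ, ∀ x, |pot U x| ≤ M := by
  have hK : IsCompact ((WithLp.toLp 2 : (Fin d → ℝ) → EuclideanSpace ℝ (Fin d)) ''
      (Set.pi univ fun _ => Icc (0 : ℝ) 1)) :=
    (isCompact_univ_pi fun _ => isCompact_Icc).image (PiLp.continuous_toLp 2 _)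
  obtain ⟨M, hM⟩ := hK.exists_bound_of_continuousOn U.smooth.continuous.continuousOn
  refine ⟨M, fun x => hM _ ⟨_, ?_, rfl⟩⟩
  intro i _
  have h := (AddCircle.measurableEquivIco (1 : ℝ) 0 (x i)).2
  exact ⟨h.1, h.2.le.trans_eq (zero_add 1)⟩

theorem hasDerivAt_pot_move (U : PeriodicPotential d) (x : UnitAddTorus (Fin d)) (y : Sph d)
    (s : ℝ) :
    HasDerivAt (fun s => pot U (move x y s))
      ⟪(y : EuclideanSpace ℝ (Fin d)), grad U (move x y s)⟫ s := by
  simp only [move_eq_proj, grad_proj, pot_proj]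
  have h1 : HasGradientAt U.toFun (gradient U.toFun (rep x + s • (y : EuclideanSpace ℝ (Fin d))))
      (rep x + s • (y : EuclideanSpace ℝ (Fin d))) :=
    ((U.smooth.differentiable (by simp)) _).hasGradientAt
  have h2 : HasDerivAt (fun s : ℝ => rep x + s • (y : EuclideanSpace ℝ (Fin d)))
      (y : EuclideanSpace ℝ (Fin d)) s := by
    simpa using ((hasDerivAt_id s).smul_const (y : EuclideanSpace ℝ (Fin d))).const_add (rep x)
  have h3 := h1.hasFDerivAt.comp_hasDerivAt s h2
  rw [real_inner_comm]
  exact h3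

theorem measurePreserving_add_right_torus (a : UnitAddTorus (Fin d)) :
    MeasurePreserving (fun x : UnitAddTorus (Fin d) => x + a) volume volume :=
  measurePreserving_pi _ _ fun i => measurePreserving_add_right volume (a i)

instance : IsProbabilityMeasure (volume : Measure (UnitAddTorus (Fin d))) := by
  have : IsProbabilityMeasure (volume : Measure UnitAddCircle) := ⟨UnitAddCircle.measure_univ⟩
  rw [volume_pi]
  infer_instance

/-- The cell is centred at the origin and then translated by x, so that it fits into the ball of
radius √d/2 reached by the displacement from x. -/
theorem lintegral_torus_eq {f : UnitAddTorus (Fin d) → ℝ≥0∞} (hf : Measurable f)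
    (x : UnitAddTorus (Fin d)) :
    ∫⁻ w, f w = ∫⁻ v in {v : EuclideanSpace ℝ (Fin d) |
      ∀ i, v i ∈ Ioc (-(1 / 2) : ℝ) (-(1 / 2) + 1)}, f (x + proj v) := by
  have h1 := measurePreserving_pi
    (fun _ : Fin d => (volume : Measure ℝ).restrict (Ioc (-(1 / 2) : ℝ) (-(1 / 2) + 1)))
    (fun _ => (volume : Measure UnitAddCircle))
    (fun i => UnitAddCircle.measurePreserving_mk (-(1 / 2) : ℝ))
  rw [← Measure.restrict_pi_pi] at h1
  have h2 := (PiLp.volume_preserving_ofLp (Fin d)).restrict_preimage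
    (MeasurableSet.univ_pi fun _ => measurableSet_Ioc (a := (-(1 / 2) : ℝ)) (b := -(1 / 2) + 1))
  have h3 := (h1.comp h2).lintegral_comp (hf.comp (measurable_const_add x))
  rw [← (measurePreserving_add_right_torus x).lintegral_comp hf]
  simp only [add_comm _ x]
  refine h3.symm.trans ?_
  congr 2
  ext v
  simp

end Torus

/-! ### Law of the first passage time of an integrated rate -/

section FirstPassage

variable {ℓ : ℝ → ℝ} {s S : ℝ}

theorem integral_mono_of_nonneg (h0 : ∀ v, 0 ≤ ℓ v) (hi : ∀ a b, IntervalIntegrable ℓ volume a b)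
    {a b : ℝ} (ha : s ≤ a) (hab : a ≤ b) : ∫ v in s..a, ℓ v ≤ ∫ v in s..b, ℓ v :=
  intervalIntegral.integral_mono_interval le_rfl ha hab
    (Filter.Eventually.of_forall h0) (hi _ _)

theorem firstPassage_mem (hi : ∀ a b, IntervalIntegrable ℓ volume a b)
    (hS : s < S) {e : ℝ} (he0 : 0 < e) (he : e ≤ ∫ v in s..S, ℓ v) :
    sInf {u | s < u ∧ e ≤ ∫ v in s..u, ℓ v} ∈ {u | s < u ∧ e ≤ ∫ v in s..u, ℓ v} := by
  have hc : Continuous (fun u => ∫ v in s..u, ℓ v) := intervalIntegral.continuous_primitive hi s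
  -- Since e > 0 and the integral vanishes at u = s, the strict inequality is automatic and the set
  -- is closed.
  have heq : {u | s < u ∧ e ≤ ∫ v in s..u, ℓ v} = Ici s ∩ {u | e ≤ ∫ v in s..u, ℓ v} := by
    ext u
    simp only [mem_ofPred_eq, mem_inter_iff, mem_Ici]
    refine ⟨fun h => ⟨h.1.le, h.2⟩, fun h => ⟨lt_of_le_of_ne h.1 ?_, h.2⟩⟩
    rintro rfl
    have := h.2
    rw [intervalIntegral.integral_same] at this
    exact absurd he0 (not_lt.2 this)
  have hcl : IsClosed {u | s < u ∧ e ≤ ∫ v in s..u, ℓ v} := by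
    rw [heq]
    exact isClosed_Ici.inter (isClosed_le continuous_const hc)
  exact hcl.csInf_mem ⟨S, hS, he⟩ ⟨s, fun u hu => hu.1.le⟩

theorem firstPassage_le {e u : ℝ} (hu : s < u) (he : e ≤ ∫ v in s..u, ℓ v) :
    sInf {u | s < u ∧ e ≤ ∫ v in s..u, ℓ v} ≤ u :=
  csInf_le ⟨s, fun _ h => h.1.le⟩ ⟨hu, he⟩

theorem integral_firstPassage (h0 : ∀ v, 0 ≤ ℓ v) (hi : ∀ a b, IntervalIntegrable ℓ volume a b)
    (hS : s < S) {e : ℝ} (he0 : 0 < e) (he : e ≤ ∫ v in s..S, ℓ v) :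
    ∫ v in s..sInf {u | s < u ∧ e ≤ ∫ v in s..u, ℓ v}, ℓ v = e := by
  have hT := firstPassage_mem hi hS he0 he
  refine le_antisymm ?_ hT.2
  have hc : Continuous (fun u => ∫ v in s..u, ℓ v) := intervalIntegral.continuous_primitive hi s
  obtain ⟨u, hu, hue⟩ := intermediate_value_Icc hS.le hc.continuousOn
    (show e ∈ Icc (∫ v in s..s, ℓ v) (∫ v in s..S, ℓ v) by simpa using ⟨he0.le, he⟩)
  have hue : ∫ v in s..u, ℓ v = e := hue
  have hsu : s < u := by
    refine lt_of_le_of_ne hu.1 ?_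
    rintro rfl
    simp at hue
    exact he0.ne hue
  exact (integral_mono_of_nonneg h0 hi hT.1.le (firstPassage_le hsu hue.ge)).trans hue.le

/-- The first passage time is the generalised inverse of u ↦ ∫_s^u ℓ: it is at most u exactly when e
≤ ∫_s^u ℓ. Comparing the masses of half-lines suffices, so ℓ may vanish or jump, as the reflection
rate does, and no differentiable change of variables is required. -/
theorem map_firstPassage (h0 : ∀ v, 0 ≤ ℓ v) (hi : ∀ a b, IntervalIntegrable ℓ volume a b)
    (hS : s < S) :
    AEMeasurable (fun e => sInf {u | s < u ∧ e ≤ ∫ v in s..u, ℓ v})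
      (volume.restrict (Ioo 0 (∫ v in s..S, ℓ v))) ∧
    (volume.restrict (Ioo 0 (∫ v in s..S, ℓ v))).map
      (fun e => sInf {u | s < u ∧ e ≤ ∫ v in s..u, ℓ v}) =
    (volume.restrict (Ioc s S)).withDensity (fun u => ENNReal.ofReal (ℓ u)) := by
  have hmon : MonotoneOn (fun e => sInf {u | s < u ∧ e ≤ ∫ v in s..u, ℓ v})
      (Ioo 0 (∫ v in s..S, ℓ v)) := fun a _ b hb hab =>
    csInf_le_csInf ⟨s, fun _ h => h.1.le⟩ ⟨S, hS, hb.2.le⟩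
      (fun u hu => ⟨hu.1, hab.trans hu.2⟩)
  have hae := aemeasurable_restrict_of_monotoneOn (μ := volume) measurableSet_Ioo hmon
  have hmass : ∀ b, s ≤ b → ∫⁻ u in Ioc s b, ENNReal.ofReal (ℓ u) =
      ENNReal.ofReal (∫ v in s..b, ℓ v) := fun b hb => by
    rw [intervalIntegral.integral_of_le hb, ofReal_integral_eq_lintegral_ofReal]
    · exact (intervalIntegrable_iff_integrableOn_Ioc_of_le hb).1 (hi s b)
    · exact Filter.Eventually.of_forall h0
  refine ⟨hae, ?_⟩
  have : IsFiniteMeasure ((volume.restrict (Ioo 0 (∫ v in s..S, ℓ v))).map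
      (fun e => sInf {u | s < u ∧ e ≤ ∫ v in s..u, ℓ v})) := inferInstance
  refine Measure.ext_of_Iic _ _ fun u => ?_
  rw [Measure.map_apply_of_aemeasurable hae measurableSet_Iic,
    withDensity_apply _ measurableSet_Iic, Measure.restrict_restrict measurableSet_Iic,
    Measure.restrict_apply' measurableSet_Ioo]
  rcases le_or_gt u s with hu | hu
  · have h1 : (fun e => sInf {u | s < u ∧ e ≤ ∫ v in s..u, ℓ v}) ⁻¹' Iic u ∩
        Ioo 0 (∫ v in s..S, ℓ v) = ∅ := by
      ext e
      simp only [mem_inter_iff, mem_preimage, mem_Iic, mem_empty_iff_false, iff_false, not_and]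
      intro h he
      exact absurd (firstPassage_mem hi hS he.1 he.2.le).1 (not_lt.2 (h.trans hu))
    have h2 : Iic u ∩ Ioc s S = ∅ := by
      ext v
      simp only [mem_inter_iff, mem_Iic, mem_Ioc, mem_empty_iff_false, iff_false, not_and]
      intro h h'
      exact absurd (h'.trans_le h) (not_lt.2 hu)
    simp [h1, h2]
  · have h2 : Iic u ∩ Ioc s S = Ioc s (min u S) := by
      ext v
      simp only [mem_inter_iff, mem_Iic, mem_Ioc, le_min_iff]
      tauto
    have h1 : (fun e => sInf {u | s < u ∧ e ≤ ∫ v in s..u, ℓ v}) ⁻¹' Iic u ∩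
        Ioo 0 (∫ v in s..S, ℓ v) = Iic (∫ v in s..u, ℓ v) ∩ Ioo 0 (∫ v in s..S, ℓ v) := by
      ext e
      simp only [mem_inter_iff, mem_preimage, mem_Iic, and_congr_left_iff]
      intro he
      have hT := firstPassage_mem hi hS he.1 he.2.le
      exact ⟨fun h => hT.2.trans (integral_mono_of_nonneg h0 hi hT.1.le h),
        fun h => firstPassage_le hu h⟩
    rw [h1, h2, hmass _ (le_min hu.le hS.le)]
    rcases le_or_gt S u with h | h
    · rw [min_eq_right h, inter_eq_right.2, Real.volume_Ioo, sub_zero]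
      exact fun e he => he.2.le.trans (integral_mono_of_nonneg h0 hi hS.le h)
    · rw [min_eq_left h.le]
      have h3 := integral_mono_of_nonneg h0 hi hu.le h.le
      refine le_antisymm ((measure_mono (t := Ioc 0 (∫ v in s..u, ℓ v))
        fun e he => ⟨he.2.1, he.1⟩).trans_eq (by rw [Real.volume_Ioc, sub_zero])) ?_
      rw [← sub_zero (∫ v in s..u, ℓ v), ← Real.volume_Ioo, sub_zero]
      exact measure_mono fun e he => ⟨he.2.le, he.1, he.2.trans_le h3⟩

theorem lintegral_exp_firstPassage (h0 : ∀ v, 0 ≤ ℓ v)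
    (hi : ∀ a b, IntervalIntegrable ℓ volume a b) (hm : Measurable ℓ)
    (hS : s < S) {φ : ℝ → ℝ≥0∞} (hφ : Measurable φ) :
    ∫⁻ e in Ioo 0 (∫ v in s..S, ℓ v), ENNReal.ofReal (Real.exp (-e)) *
      φ (sInf {u | s < u ∧ e ≤ ∫ v in s..u, ℓ v}) =
    ∫⁻ u in Ioc s S, ENNReal.ofReal (ℓ u) *
      (ENNReal.ofReal (Real.exp (-∫ v in s..u, ℓ v)) * φ u) := by
  obtain ⟨hae, hmap⟩ := map_firstPassage h0 hi hS
  have hc : Continuous (fun u => ∫ v in s..u, ℓ v) := intervalIntegral.continuous_primitive hi s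
  have hψ : Measurable (fun u => ENNReal.ofReal (Real.exp (-∫ v in s..u, ℓ v)) * φ u) :=
    (Real.continuous_exp.comp hc.neg).measurable.ennreal_ofReal.mul hφ
  have h1 := lintegral_map' (hψ.aemeasurable (μ := (volume.restrict
    (Ioo 0 (∫ v in s..S, ℓ v))).map (fun e => sInf {u | s < u ∧ e ≤ ∫ v in s..u, ℓ v}))) hae
  rw [hmap, lintegral_withDensity_eq_lintegral_mul _ hm.ennreal_ofReal hψ] at h1
  refine Eq.trans ?_ h1.symm
  refine setLIntegral_congr_fun measurableSet_Ioo fun e he => ?_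
  rw [integral_firstPassage h0 hi hS he.1 he.2.le]

end FirstPassage

/-! ### Integrals against exponential laws -/

section Exponential

theorem lintegral_expMeasure_one (φ : ℝ → ℝ≥0∞) :
    ∫⁻ e, φ e ∂(expMeasure 1) = ∫⁻ e in Ioi 0, ENNReal.ofReal (Real.exp (-e)) * φ e := by
  have h : expMeasure 1 = (volume.restrict (Ioi 0)).withDensity
      (fun e => ENNReal.ofReal (Real.exp (-e))) := by
    have h1 : expMeasure 1 = volume.withDensity (exponentialPDF 1) := rfl
    rw [h1, ← withDensity_indicator measurableSet_Ioi]
    refine withDensity_congr_ae ?_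
    have : ∀ᵐ x : ℝ, x ≠ 0 := by simp [ae_iff]
    filter_upwards [this] with x hx
    rcases lt_or_gt_of_ne hx with h | h
    · rw [exponentialPDF_of_neg h, indicator_of_notMem (by simpa using h.le)]
    · rw [exponentialPDF_of_nonneg h.le, indicator_of_mem (by simpa using h)]
      simp
  rw [h, lintegral_withDensity_eq_lintegral_mul_non_measurable]
  · rfl
  · fun_prop
  · simp

theorem lintegral_exp_neg_Ioi (a : ℝ) :
    ∫⁻ e in Ioi a, ENNReal.ofReal (Real.exp (-e)) = ENNReal.ofReal (Real.exp (-a)) := by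
  rw [← ofReal_integral_eq_lintegral_ofReal, integral_exp_neg_Ioi]
  · exact integrableOn_exp_neg_Ioi a
  · exact Filter.Eventually.of_forall fun _ => (Real.exp_pos _).le

theorem lintegral_exp_scale {r : ℝ} (hr : 0 < r) (s : ℝ) (φ : ℝ → ℝ≥0∞) :
    ∫⁻ e in Ioi 0, ENNReal.ofReal (Real.exp (-e)) * φ (s + e / r) =
      ∫⁻ u in Ioi s, ENNReal.ofReal (Real.exp (-(r * (u - s)))) * (ENNReal.ofReal r * φ u) := by
  have himg : (fun u => r * (u - s)) '' Ioi s = Ioi 0 := by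
    ext e
    simp only [mem_image, mem_Ioi]
    constructor
    · rintro ⟨u, hu, rfl⟩
      exact mul_pos hr (sub_pos.2 hu)
    · intro he
      refine ⟨s + e / r, by linarith [div_pos he hr], ?_⟩
      field_simp
      ring
  rw [← himg, lintegral_image_eq_lintegral_abs_deriv_mul (f' := fun _ => r) measurableSet_Ioi]
  · refine lintegral_congr fun u => ?_
    have : s + r * (u - s) / r = u := by field_simp; ring
    rw [this, abs_of_pos hr]
    ring
  · intro u _
    simpa using (((hasDerivAt_id u).sub_const s).const_mul r).hasDerivWithinAt
  · intro a _ b _ h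
    have := mul_left_cancel₀ hr.ne' h
    linarith

end Exponential

/-! ### Kernels of the jump chain and their measurability -/

section Operators

variable {d : ℕ}

/-- The state at time `u` of a particle in uniform motion that is at time `p.1` in the state
`p.2`. -/
noncomputable def flow (p : ℝ × State d) (u : ℝ) : State d := (move p.2.1 p.2.2 (u - p.1), p.2.2)

/-- The reflection rate, integrated along the uniform motion. -/
noncomputable def cumRate (U : PeriodicPotential d) (ε : CoolingSchedule) (p : ℝ × State d)
    (u : ℝ) : ℝ :=
  ∫ v in p.1..u, rate U ε v (flow p v)

/-- The probability that no jump occurs between the times `p.1` and `u`. -/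
noncomputable def survival (U : PeriodicPotential d) (ε : CoolingSchedule) (r : ℝ)
    (p : ℝ × State d) (u : ℝ) : ℝ≥0∞ :=
  ENNReal.ofReal (Real.exp (-(cumRate U ε p u + r * (u - p.1))))

/-- The jump part of the generator at time `u`, without the loss terms. -/
noncomputable def jumpOp (U : PeriodicPotential d) (ε : CoolingSchedule) (r : ℝ)
    (g : ℝ × State d → ℝ≥0∞) (u : ℝ) (z : State d) : ℝ≥0∞ :=
  ENNReal.ofReal (rate U ε u z) * g (u, (z.1, reflectVel U z.1 z.2)) +
    ENNReal.ofReal r * ∫⁻ y, g (u, (z.1, y)) ∂unifSph d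

/-- The transition operator of the chain of the jump times and of the states after the jumps. -/
noncomputable def jumpStep (U : PeriodicPotential d) (ε : CoolingSchedule) (r : ℝ)
    (g : ℝ × State d → ℝ≥0∞) (p : ℝ × State d) : ℝ≥0∞ :=
  ∫⁻ u in Ioi p.1, survival U ε r p u * jumpOp U ε r g u (flow p u)

/-- The contribution to the expectation of `f` at time `t` of the paths without jump. -/
noncomputable def noJump (U : PeriodicPotential d) (ε : CoolingSchedule) (r t : ℝ)
    (f : State d → ℝ≥0∞) (p : ℝ × State d) : ℝ≥0∞ :=
  (Iic t).indicator (fun _ => survival U ε r p t * f (flow p t)) p.1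

variable (U : PeriodicPotential d) (ε : CoolingSchedule) (r : ℝ)

theorem measurable_flow : Measurable (fun q : (ℝ × State d) × ℝ => flow q.1 q.2) :=
  measurable_path.snd

theorem continuous_cumRate (p : ℝ × State d) : Continuous (cumRate U ε p) :=
  intervalIntegral.continuous_primitive (fun a b => intervalIntegrable_rate U ε p a b) p.1

theorem measurable_cumRate : Measurable (fun q : (ℝ × State d) × ℝ => cumRate U ε q.1 q.2) := by
  have h := measurable_uncurry_of_continuous_of_measurable
    (u := fun (b : ℝ) (p : ℝ × State d) => cumRate U ε p b)
    (fun p => continuous_cumRate U ε p) (fun b => measurable_integral_rate U ε b)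
  exact h.comp measurable_swap

theorem cumRate_nonneg (p : ℝ × State d) {u : ℝ} (hu : p.1 ≤ u) : 0 ≤ cumRate U ε p u :=
  intervalIntegral.integral_nonneg hu fun _ _ => rate_nonneg _ _ _ _

theorem measurable_survival :
    Measurable (fun q : (ℝ × State d) × ℝ => survival U ε r q.1 q.2) := by
  have h := measurable_cumRate U ε
  unfold survival
  fun_prop

variable {U ε r}

theorem measurable_jumpOp [NeZero d] {g : ℝ × State d → ℝ≥0∞} (hg : Measurable g) :
    Measurable (fun q : ℝ × State d => jumpOp U ε r g q.1 q.2) := by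
  unfold jumpOp
  refine Measurable.add ?_ ?_
  · refine (measurable_rate U ε).ennreal_ofReal.mul (hg.comp ?_)
    exact measurable_fst.prodMk (measurable_snd.fst.prodMk
      ((measurable_reflectVel U).comp measurable_snd))
  · refine Measurable.const_mul ?_ _
    refine Measurable.lintegral_prod_right' (f := fun q : (ℝ × State d) × Sph d =>
      g (q.1.1, (q.1.2.1, q.2))) ?_
    exact hg.comp (by fun_prop)

theorem measurable_jumpOp_flow [NeZero d] {g : ℝ × State d → ℝ≥0∞} (hg : Measurable g) :
    Measurable (fun q : (ℝ × State d) × ℝ => jumpOp U ε r g q.2 (flow q.1 q.2)) := by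
  have h := (measurable_jumpOp (U := U) (ε := ε) (r := r) hg).comp
    ((measurable_snd (α := ℝ × State d) (β := ℝ)).prodMk measurable_flow)
  simpa only [Function.comp_def] using h

theorem measurable_flow_left (p : ℝ × State d) : Measurable (flow p) := by
  have h := (measurable_flow (d := d)).comp (measurable_prodMk_left (x := p) (β := ℝ))
  simpa only [Function.comp_def] using h

theorem measurable_rate_flow (p : ℝ × State d) : Measurable (fun u => rate U ε u (flow p u)) := by
  have h := (measurable_rate U ε).comp (measurable_id.prodMk (measurable_flow_left p))
  simpa only [Function.comp_def, id] using h

theorem measurable_comp_reflect {g : ℝ × State d → ℝ≥0∞} (hg : Measurable g) (p : ℝ × State d) :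
    Measurable (fun u => g (u, ((flow p u).1, reflectVel U (flow p u).1 p.2.2))) := by
  have hfl := measurable_flow_left p
  have hR : Measurable (fun u => reflectVel U (flow p u).1 p.2.2) := by
    have h := (measurable_reflectVel U).comp (hfl.fst.prodMk (measurable_const (a := p.2.2)))
    simpa only [Function.comp_def] using h
  have h := hg.comp (measurable_id.prodMk (hfl.fst.prodMk hR))
  simpa only [Function.comp_def, id] using h

theorem measurable_lintegral_refresh [NeZero d] {g : ℝ × State d → ℝ≥0∞} (hg : Measurable g)
    (p : ℝ × State d) : Measurable (fun u => ∫⁻ y, g (u, ((flow p u).1, y)) ∂unifSph d) := by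
  have hfl := measurable_flow_left p
  refine Measurable.lintegral_prod_right' (f := fun q : ℝ × Sph d =>
    g (q.1, ((flow p q.1).1, q.2))) ?_
  have hfl' : Measurable fun q : ℝ × Sph d => (flow p q.1).1 := hfl.fst.comp measurable_fst
  have h := hg.comp ((measurable_fst (α := ℝ) (β := Sph d)).prodMk (hfl'.prodMk measurable_snd))
  simpa only [Function.comp_def] using h

theorem measurable_jumpStep [NeZero d] {g : ℝ × State d → ℝ≥0∞} (hg : Measurable g) :
    Measurable (jumpStep U ε r g) := by
  have h : jumpStep U ε r g = fun p => ∫⁻ u, {q : (ℝ × State d) × ℝ | q.1.1 < q.2}.indicator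
      (fun q => survival U ε r q.1 q.2 * jumpOp U ε r g q.2 (flow q.1 q.2)) (p, u) := by
    funext p
    rw [jumpStep, ← lintegral_indicator measurableSet_Ioi]
    rfl
  rw [h]
  refine Measurable.lintegral_prod_right' (Measurable.indicator ?_ ?_)
  · exact (measurable_survival U ε r).mul (measurable_jumpOp_flow hg)
  · exact measurableSet_lt measurable_fst.fst measurable_snd

theorem measurable_noJump {t : ℝ} {f : State d → ℝ≥0∞} (hf : Measurable f) :
    Measurable (noJump U ε r t f) := by
  have h : noJump U ε r t f = {p : ℝ × State d | p.1 ≤ t}.indicator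
      (fun p => survival U ε r p t * f (flow p t)) := rfl
  rw [h]
  refine Measurable.indicator ?_ (measurableSet_le measurable_fst measurable_const)
  have h1 : Measurable (fun p : ℝ × State d => (p, t)) := by fun_prop
  exact ((measurable_survival U ε r).comp h1).mul (hf.comp (measurable_flow.comp h1))

theorem measurable_jumpStep_iterate [NeZero d] {g : ℝ × State d → ℝ≥0∞} (hg : Measurable g)
    (n : ℕ) : Measurable ((jumpStep U ε r)^[n] g) := by
  induction n with
  | zero => exact hg
  | succ n ih =>
    rw [Function.iterate_succ_apply']
    exact measurable_jumpStep ih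

theorem jumpStep_mono {g g' : ℝ × State d → ℝ≥0∞} (h : g ≤ g') :
    jumpStep U ε r g ≤ jumpStep U ε r g' := by
  intro p
  unfold jumpStep jumpOp
  gcongr <;> exact h _

end Operators

/-! ### One jump: lower bounds by the kernels -/

section StepLaw

variable {d : ℕ} [NeZero d] {U : PeriodicPotential d} {ε : CoolingSchedule} {r : ℝ}

/-- The refreshment clock is integrated last, so that the refreshment time can be fixed first and
the reflection clock treated conditionally on it. -/
theorem lintegral_markLaw {F : Mark d → ℝ≥0∞} (hF : Measurable F) :
    ∫⁻ w, F w ∂markLaw d =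
      ∫⁻ e₂, ∫⁻ e₁, ∫⁻ y, F (e₁, e₂, y) ∂unifSph d ∂expMeasure 1 ∂expMeasure 1 := by
  have : IsProbabilityMeasure (expMeasure 1) := isProbabilityMeasure_expMeasure one_pos
  have h1 : ∀ e₁, ∫⁻ q, F (e₁, q) ∂(expMeasure 1).prod (unifSph d) =
      ∫⁻ e₂, ∫⁻ y, F (e₁, e₂, y) ∂unifSph d ∂expMeasure 1 := fun e₁ =>
    lintegral_prod _ (hF.comp measurable_prodMk_left).aemeasurable
  rw [markLaw, lintegral_prod _ hF.aemeasurable, lintegral_congr h1, lintegral_lintegral_swap]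
  refine Measurable.aemeasurable ?_
  refine Measurable.lintegral_prod_right' (f := fun q : (ℝ × ℝ) × Sph d =>
    F (q.1.1, q.1.2, q.2)) ?_
  exact hF.comp (by fun_prop)

omit [NeZero d] in
-- The strict inequality matters: `step` recognises a refreshment by equality of the jump time with
-- the refreshment time. It holds because the integrated rate reaches `w.1` strictly before
-- exceeding it.
theorem jumpTime_eq_min {p : ℝ × State d} {w : Mark d}
    (h : w.1 ∈ Ioo 0 (cumRate U ε p (refreshTime r p.1 w))) (hs : p.1 < refreshTime r p.1 w) :
    jumpTime U ε r p w = sInf {u | p.1 < u ∧ w.1 ≤ cumRate U ε p u} ∧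
      jumpTime U ε r p w < refreshTime r p.1 w := by
  have hi := intervalIntegrable_rate U ε p
  have hc := continuous_cumRate U ε p
  have h1 : sInf {u | p.1 < u ∧ w.1 ≤ cumRate U ε p u} < refreshTime r p.1 w := by
    obtain ⟨u, hu, hue⟩ := intermediate_value_Icc hs.le hc.continuousOn
      (show w.1 ∈ Icc (cumRate U ε p p.1) (cumRate U ε p (refreshTime r p.1 w)) by
        simpa [cumRate] using ⟨h.1.le, h.2.le⟩)
    have hsu : p.1 < u := by
      refine lt_of_le_of_ne hu.1 ?_
      rintro rfl
      simp [cumRate] at hue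
      exact h.1.ne hue
    have huS : u < refreshTime r p.1 w := by
      refine lt_of_le_of_ne hu.2 ?_
      rintro rfl
      exact h.2.ne hue.symm
    exact (firstPassage_le (ℓ := fun v => rate U ε v (flow p v)) hsu hue.ge).trans_lt huS
  have h2 : jumpTime U ε r p w = min (refreshTime r p.1 w)
      (sInf {u | p.1 < u ∧ w.1 ≤ cumRate U ε p u}) := by
    refine csInf_insert (s := {u | p.1 < u ∧ w.1 ≤ cumRate U ε p u}) ?_ ?_
    · exact ⟨p.1, fun _ h => h.1.le⟩
    · exact ⟨_, hs, h.2.le⟩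
  rw [min_eq_right h1.le] at h2
  exact ⟨h2, h2.trans_lt h1⟩

omit [NeZero d] in
theorem jumpTime_eq_refreshTime {p : ℝ × State d} {w : Mark d}
    (h : cumRate U ε p (refreshTime r p.1 w) < w.1) :
    jumpTime U ε r p w = refreshTime r p.1 w := by
  refine le_antisymm (csInf_le (BddBelow.insert _ ⟨p.1, fun _ h => h.1.le⟩) (Or.inl rfl)) ?_
  refine le_csInf (insert_nonempty _ _) ?_
  rintro u (rfl | ⟨hu, hu'⟩)
  · exact le_rfl
  · by_contra! hlt
    exact absurd (hu'.trans (integral_mono_of_nonneg (fun v => rate_nonneg U ε v (flow p v))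
      (intervalIntegrable_rate U ε p) hu.le hlt.le)) (not_le.2 h)

/-- For a fixed refreshment time S, the clock value e₁ is split at the rate integrated up to S:
above it the velocity is refreshed at S, below it a reflection occurs at the first passage time. The
threshold value itself is dropped, which is harmless for a lower bound. -/
theorem lintegral_step_ge_of_refresh {g : ℝ × State d → ℝ≥0∞} (hg : Measurable g)
    (p : ℝ × State d) {S e₂ : ℝ} (hS : p.1 + e₂ / r = S) (hpS : p.1 < S) :
    ENNReal.ofReal (Real.exp (-cumRate U ε p S)) * ∫⁻ y, g (S, ((flow p S).1, y)) ∂unifSph d +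
      ∫⁻ u in Ioc p.1 S, ENNReal.ofReal (rate U ε u (flow p u)) *
        (ENNReal.ofReal (Real.exp (-cumRate U ε p u)) *
          g (u, ((flow p u).1, reflectVel U (flow p u).1 p.2.2))) ≤
    ∫⁻ e₁, ∫⁻ y, g (step U ε r p (e₁, e₂, y)) ∂unifSph d ∂expMeasure 1 := by
  have hm := measurable_rate_flow (U := U) (ε := ε) p
  have hφ := measurable_comp_reflect (U := U) hg p
  have hΛ : 0 ≤ cumRate U ε p S := cumRate_nonneg U ε p hpS.le
  have h2 : ∫⁻ e in Ioo 0 (cumRate U ε p S), ENNReal.ofReal (Real.exp (-e)) *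
      (∫⁻ y, g (step U ε r p (e, e₂, y)) ∂unifSph d) =
      ∫⁻ u in Ioc p.1 S, ENNReal.ofReal (rate U ε u (flow p u)) *
        (ENNReal.ofReal (Real.exp (-cumRate U ε p u)) *
          g (u, ((flow p u).1, reflectVel U (flow p u).1 p.2.2))) := by
    refine Eq.trans ?_ (lintegral_exp_firstPassage
      (fun v => rate_nonneg U ε v (flow p v)) (intervalIntegrable_rate U ε p) hm hpS hφ)
    refine setLIntegral_congr_fun measurableSet_Ioo fun e he => ?_
    have h (y : Sph d) := jumpTime_eq_min (U := U) (ε := ε) (r := r) (p := p) (w := (e, e₂, y))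
      (by rw [refreshTime]; simpa only [hS] using he) (by rw [refreshTime]; simpa only [hS])
    have h' (y : Sph d) : step U ε r p (e, e₂, y) =
        (fun u => (u, ((flow p u).1, reflectVel U (flow p u).1 p.2.2)))
          (sInf {u | p.1 < u ∧ e ≤ cumRate U ε p u}) := by
      rw [step, if_neg (h y).2.ne, (h y).1]
      rfl
    simp only [h', lintegral_const, measure_univ, mul_one]
    rfl
  have h1 : ∫⁻ e in Ioi (cumRate U ε p S), ENNReal.ofReal (Real.exp (-e)) *
      (∫⁻ y, g (step U ε r p (e, e₂, y)) ∂unifSph d) =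
      ENNReal.ofReal (Real.exp (-cumRate U ε p S)) *
        ∫⁻ y, g (S, ((flow p S).1, y)) ∂unifSph d := by
    rw [← lintegral_exp_neg_Ioi, ← lintegral_mul_const _ (by fun_prop)]
    refine setLIntegral_congr_fun measurableSet_Ioi fun e he => ?_
    have h (y : Sph d) := jumpTime_eq_refreshTime (U := U) (ε := ε) (r := r) (p := p)
      (w := (e, e₂, y)) (by rw [refreshTime]; simpa only [hS, mem_Ioi] using he)
    have h' (y : Sph d) : step U ε r p (e, e₂, y) = (S, ((flow p S).1, y)) := by
      rw [step, if_pos (h y), h y, refreshTime, hS]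
      rfl
    simp only [h']
  rw [lintegral_expMeasure_one, ← h1, ← h2, add_comm,
    ← lintegral_union measurableSet_Ioi]
  · exact lintegral_mono_set (union_subset Ioo_subset_Ioi_self (Ioi_subset_Ioi hΛ))
  · exact Set.disjoint_left.2 fun e he he' => absurd he.2 (not_lt.2 (le_of_lt he'))

theorem jumpStep_le_lintegral_step (hr : 0 < r) {g : ℝ × State d → ℝ≥0∞} (hg : Measurable g)
    (p : ℝ × State d) : jumpStep U ε r g p ≤ ∫⁻ w, g (step U ε r p w) ∂markLaw d := by
  have hm := measurable_rate_flow (U := U) (ε := ε) p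
  have hφ := measurable_comp_reflect (U := U) hg p
  have hI := measurable_lintegral_refresh hg p
  have hc := (continuous_cumRate U ε p).measurable
  set ψ : ℝ → ℝ≥0∞ := fun u => ENNReal.ofReal (rate U ε u (flow p u)) *
    (ENNReal.ofReal (Real.exp (-cumRate U ε p u)) *
      g (u, ((flow p u).1, reflectVel U (flow p u).1 p.2.2))) with hψ
  have hψm : Measurable ψ :=
    hm.ennreal_ofReal.mul ((Real.measurable_exp.comp hc.neg).ennreal_ofReal.mul hφ)
  set A : ℝ → ℝ≥0∞ := fun u => ENNReal.ofReal (Real.exp (-cumRate U ε p u)) *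
    ∫⁻ y, g (u, ((flow p u).1, y)) ∂unifSph d with hA
  have hAm : Measurable A := by fun_prop
  have hB : Measurable (fun a => ∫⁻ u in Ioc p.1 a, ψ u) := by
    have h : (fun a => ∫⁻ u in Ioc p.1 a, ψ u) = fun a => ∫⁻ u,
        {q : ℝ × ℝ | p.1 < q.2 ∧ q.2 ≤ q.1}.indicator (fun q => ψ q.2) (a, u) := by
      funext a
      rw [← lintegral_indicator measurableSet_Ioc]
      rfl
    rw [h]
    refine Measurable.lintegral_prod_right' ((hψm.comp measurable_snd).indicator ?_)
    exact (measurableSet_lt measurable_const measurable_snd).inter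
      (measurableSet_le measurable_snd measurable_fst)
  have hF : Measurable (fun w => g (step U ε r p w)) := by
    have h := hg.comp ((measurable_step U ε r).comp (measurable_prodMk_left (x := p)))
    simpa only [Function.comp_def] using h
  rw [lintegral_markLaw hF, lintegral_expMeasure_one]
  calc jumpStep U ε r g p
      = (∫⁻ u in Ioi p.1, ENNReal.ofReal (Real.exp (-(r * (u - p.1)))) * (ENNReal.ofReal r * A u))
        + ∫⁻ u in Ioi p.1, ENNReal.ofReal (Real.exp (-(r * (u - p.1)))) * ψ u := by
        rw [← lintegral_add_left (by fun_prop)]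
        refine lintegral_congr fun u => ?_
        rw [survival, neg_add, Real.exp_add, ENNReal.ofReal_mul (Real.exp_pos _).le, jumpOp]
        simp only [hψ, hA]
        have : (flow p u).2 = p.2.2 := rfl
        rw [this]
        ring
    _ = (∫⁻ e in Ioi 0, ENNReal.ofReal (Real.exp (-e)) * A (p.1 + e / r)) +
        ∫⁻ e in Ioi 0, ENNReal.ofReal (Real.exp (-e)) * ∫⁻ u in Ioc p.1 (p.1 + e / r), ψ u := by
        rw [lintegral_exp_scale hr p.1 A]
        congr 1
        -- The factor e^{-r(u-s)} is the probability that the refreshment comes after u. Written as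
        -- an integral over the clock value, it lets Tonelli turn the conditional bound into the
        -- kernel.
        have h1 : ∀ u ∈ Ioi p.1, ENNReal.ofReal (Real.exp (-(r * (u - p.1)))) * ψ u =
            ∫⁻ e, {q : ℝ × ℝ | r * (q.1 - p.1) < q.2}.indicator
              (fun q => ENNReal.ofReal (Real.exp (-q.2)) * ψ q.1) (u, e) := fun u _ => by
          rw [← lintegral_exp_neg_Ioi, ← lintegral_mul_const _ (by fun_prop),
            ← lintegral_indicator measurableSet_Ioi]
          rfl
        rw [setLIntegral_congr_fun measurableSet_Ioi h1, lintegral_lintegral_swap,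
          ← lintegral_indicator measurableSet_Ioi]
        · refine lintegral_congr fun e => ?_
          by_cases he : 0 < e
          · rw [indicator_of_mem (show e ∈ Ioi 0 from he), ← lintegral_const_mul _ hψm,
              ← setLIntegral_congr (Ioo_ae_eq_Ioc), ← lintegral_indicator measurableSet_Ioo,
              ← lintegral_indicator measurableSet_Ioi]
            refine lintegral_congr fun u => ?_
            simp only [indicator, mem_Ioi, mem_Ioo, mem_ofPred_eq]
            have : u < p.1 + e / r ↔ r * (u - p.1) < e := by
              rw [← lt_div_iff₀' hr, sub_lt_iff_lt_add']
            simp only [this, ite_and]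
          · rw [indicator_of_notMem (show e ∉ Ioi 0 from he)]
            rw [setLIntegral_congr_fun (g := 0) measurableSet_Ioi, Pi.zero_def, lintegral_zero]
            intro u hu
            refine indicator_of_notMem ?_ _
            have := mul_pos hr (sub_pos.2 hu)
            simp only [mem_ofPred_eq]
            linarith
        · refine Measurable.aemeasurable ?_
          refine Measurable.indicator ?_ ?_
          · exact (by fun_prop : Measurable fun q : ℝ × ℝ =>
              ENNReal.ofReal (Real.exp (-q.2)) * ψ q.1)
          · exact measurableSet_lt (by fun_prop) (by fun_prop)
    _ = ∫⁻ e in Ioi 0, ENNReal.ofReal (Real.exp (-e)) *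
          (A (p.1 + e / r) + ∫⁻ u in Ioc p.1 (p.1 + e / r), ψ u) := by
        rw [← lintegral_add_left (by fun_prop)]
        simp only [mul_add]
    _ ≤ _ := by
        refine setLIntegral_mono' measurableSet_Ioi fun e he => ?_
        gcongr
        exact lintegral_step_ge_of_refresh hg p rfl (by
          have := div_pos he hr
          linarith)

theorem survival_le_measure_jumpTime (hr : 0 < r) (p : ℝ × State d) {t : ℝ} (ht : p.1 ≤ t) :
    survival U ε r p t ≤ markLaw d {w | t < jumpTime U ε r p w} := by
  have hms : MeasurableSet {w : Mark d | t < jumpTime U ε r p w} :=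
    measurableSet_lt measurable_const ((measurable_jumpTime U ε r).comp measurable_prodMk_left)
  have hexp : ∀ a, 0 ≤ a → expMeasure 1 (Ioi a) = ENNReal.ofReal (Real.exp (-a)) := fun a ha => by
    rw [← lintegral_indicator_one measurableSet_Ioi, lintegral_expMeasure_one,
      ← lintegral_exp_neg_Ioi, ← lintegral_indicator measurableSet_Ioi,
      ← lintegral_indicator measurableSet_Ioi]
    refine lintegral_congr fun e => ?_
    simp only [indicator, mem_Ioi]
    split_ifs with h1 h2 h3
    · simp
    · simp
    · exact absurd (ha.trans_lt h3) h1
    · rfl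
  have : IsProbabilityMeasure (expMeasure 1) := isProbabilityMeasure_expMeasure one_pos
  have hsub : Ioi (cumRate U ε p t) ×ˢ (Ioi (r * (t - p.1)) ×ˢ (univ : Set (Sph d))) ⊆
      {w : Mark d | t < jumpTime U ε r p w} := by
    rintro ⟨e₁, e₂, y⟩ ⟨h1, h2, -⟩
    simp only [mem_Ioi] at h1 h2
    have h3 : t < refreshTime r p.1 (e₁, e₂, y) := by
      rw [refreshTime, ← sub_lt_iff_lt_add', lt_div_iff₀' hr]
      exact h2
    -- The infimum defining the jump time has to exceed t strictly; continuity provides a margin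
    -- beyond t during which the reflection clock still does not ring.
    have h4 : ∀ᶠ u in nhdsWithin t (Ioi t), cumRate U ε p u < e₁ :=
      ((continuous_cumRate U ε p).continuousAt.eventually_lt continuousAt_const h1).filter_mono
        nhdsWithin_le_nhds
    obtain ⟨u, hu, hu'⟩ := (h4.and self_mem_nhdsWithin).exists
    refine (lt_min h3 hu').trans_le (le_csInf (insert_nonempty _ _) ?_)
    rintro v (rfl | ⟨hv, hv'⟩)
    · exact min_le_left _ _
    · refine (min_le_right _ _).trans ?_
      by_contra! hlt
      exact absurd (hv'.trans (integral_mono_of_nonneg (fun v => rate_nonneg U ε v (flow p v))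
        (intervalIntegrable_rate U ε p) hv.le hlt.le)) (not_le.2 hu)
  refine le_trans (le_of_eq ?_) (measure_mono hsub)
  rw [markLaw, Measure.prod_prod, Measure.prod_prod, measure_univ, mul_one,
    hexp _ (cumRate_nonneg U ε p ht), hexp _ (mul_nonneg hr.le (sub_nonneg.2 ht)),
    ← ENNReal.ofReal_mul (Real.exp_pos _).le, ← Real.exp_add, ← neg_add]
  rfl

end StepLaw

/-! ### Expansion of the law in the number of jumps: lower bound -/

section ProcessLaw

variable {d : ℕ} {U : PeriodicPotential d} {ε : CoolingSchedule} {r : ℝ}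

theorem le_jumpTime (hr : 0 < r) (p : ℝ × State d) {w : Mark d} (hw : 0 ≤ w.2.1) :
    p.1 ≤ jumpTime U ε r p w := by
  refine le_csInf (insert_nonempty _ _) ?_
  rintro u (rfl | ⟨hu, -⟩)
  · exact le_add_of_nonneg_right (div_nonneg hw hr.le)
  · exact hu.le

theorem chain_time_mono (hr : 0 < r) (s : ℝ) (z : State d) {ξ : ℕ → Mark d}
    (hξ : ∀ n, 0 ≤ (ξ n).2.1) : Monotone (fun n => (chain U ε r s z ξ n).1) :=
  monotone_nat_of_le_succ fun n => le_jumpTime hr _ (hξ n)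

theorem jumpCount_eq (hr : 0 < r) {s t : ℝ} {z : State d} {ξ : ℕ → Mark d}
    (hξ : ∀ n, 0 ≤ (ξ n).2.1) {n : ℕ} (h1 : (chain U ε r s z ξ n).1 ≤ t)
    (h2 : t < (chain U ε r s z ξ (n + 1)).1) : jumpCount U ε r s t z ξ = n := by
  refine le_antisymm (Nat.sInf_le h2) ?_
  by_contra! hlt
  have h3 : t < (chain U ε r s z ξ (jumpCount U ε r s t z ξ + 1)).1 :=
    Nat.sInf_mem (s := {n : ℕ | t < (chain U ε r s z ξ (n + 1)).1}) ⟨n, h2⟩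
  have h4 := chain_time_mono (U := U) (ε := ε) hr s z hξ (Nat.succ_le_of_lt hlt)
  exact absurd (h3.trans_le h4) (not_lt.2 h1)

theorem chain_update (s : ℝ) (z : State d) (ξ : ℕ → Mark d) {m : ℕ} (w : Mark d) {n : ℕ}
    (h : n ≤ m) : chain U ε r s z (Function.update ξ m w) n = chain U ε r s z ξ n := by
  induction n with
  | zero => rfl
  | succ n ih =>
    have hn : n ≠ m := by omega
    simp only [chain, ih (by omega), Function.update_of_ne hn]

variable [NeZero d]

omit [NeZero d] in
theorem measurable_update_mark (n : ℕ) :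
    Measurable (fun q : Mark d × (ℕ → Mark d) => Function.update q.2 n q.1) := by
  refine measurable_pi_lambda _ fun i => ?_
  by_cases h : i = n
  · subst h
    simpa using measurable_fst
  · simp only [Function.update_of_ne h]
    fun_prop

/-- Resampling one mark does not change the law of the sequence. As the chain up to index n does not
see mark n, this gives the Markov property in `lintegral_chain_mark`. -/
theorem map_update_noise (n : ℕ) :
    ((markLaw d).prod (noise d)).map (fun q => Function.update q.2 n q.1) = noise d := by
  have hm := measurable_update_mark (d := d) n
  refine Measure.eq_infinitePi _ fun s t ht => ?_
  rw [Measure.map_apply hm (MeasurableSet.pi s.countable_toSet fun i _ => ht i)]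
  by_cases hn : n ∈ s
  · have : (fun q : Mark d × (ℕ → Mark d) => Function.update q.2 n q.1) ⁻¹' (Set.pi s t) =
        t n ×ˢ Set.pi (s.erase n) t := by
      ext q
      simp only [mem_preimage, Set.mem_pi, mem_prod, Finset.mem_coe, Finset.mem_erase]
      constructor
      · intro h
        refine ⟨by simpa using h n hn, fun i hi => ?_⟩
        simpa [Function.update_of_ne hi.1] using h i hi.2
      · rintro ⟨h1, h2⟩ i hi
        by_cases h : i = n
        · subst h
          simpa using h1
        · simpa [Function.update_of_ne h] using h2 i ⟨h, hi⟩
    rw [this, Measure.prod_prod, noise, Measure.infinitePi_pi _ (fun i _ => ht i),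
      Finset.mul_prod_erase s (fun i => markLaw d (t i)) hn]
  · have : (fun q : Mark d × (ℕ → Mark d) => Function.update q.2 n q.1) ⁻¹' (Set.pi s t) =
        univ ×ˢ Set.pi s t := by
      ext q
      simp only [mem_preimage, Set.mem_pi, mem_prod, Finset.mem_coe, mem_univ, true_and]
      refine forall₂_congr fun i hi => ?_
      have h : i ≠ n := fun h => hn (h ▸ hi)
      rw [Function.update_of_ne h]
    rw [this, Measure.prod_prod, measure_univ, one_mul, noise,
      Measure.infinitePi_pi _ (fun i _ => ht i)]

theorem lintegral_chain_mark {G : (ℝ × State d) × Mark d → ℝ≥0∞} (hG : Measurable G) (s : ℝ)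
    (z : State d) (n : ℕ) :
    ∫⁻ ξ, G (chain U ε r s z ξ n, ξ n) ∂noise d =
      ∫⁻ ξ, ∫⁻ w, G (chain U ε r s z ξ n, w) ∂markLaw d ∂noise d := by
  have hc : Measurable (fun ξ : ℕ → Mark d => chain U ε r s z ξ n) := by
    have h := (measurable_chain U ε r s n).comp (measurable_prodMk_left (x := z))
    simpa only [Function.comp_def] using h
  have hm := measurable_update_mark (d := d) n
  have hG1 : Measurable (fun ξ : ℕ → Mark d => G (chain U ε r s z ξ n, ξ n)) :=
    hG.comp (hc.prodMk (measurable_pi_apply n))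
  conv_lhs => rw [← map_update_noise n]
  rw [lintegral_map hG1 hm]
  refine (lintegral_prod_symm _ (hG1.comp hm).aemeasurable).trans ?_
  simp only [Function.comp_def, chain_update s z _ _ le_rfl, Function.update_self]

theorem iterate_jumpStep_le_lintegral_chain (hr : 0 < r) {g : ℝ × State d → ℝ≥0∞}
    (hg : Measurable g) (s : ℝ) (z : State d) (n : ℕ) :
    (jumpStep U ε r)^[n] g (s, z) ≤ ∫⁻ ξ, g (chain U ε r s z ξ n) ∂noise d := by
  induction n generalizing g with
  | zero => simp [chain]
  | succ n ih =>
    rw [Function.iterate_succ_apply]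
    refine (ih (measurable_jumpStep hg)).trans ?_
    have h := lintegral_chain_mark (U := U) (ε := ε) (r := r) (hg.comp (measurable_step U ε r)) s z n
    refine le_trans ?_ h.ge
    exact lintegral_mono fun ξ => jumpStep_le_lintegral_step hr hg _

omit [NeZero d] in
theorem ae_nonneg_markLaw : ∀ᵐ w ∂markLaw d, 0 ≤ w.2.1 := by
  have : IsProbabilityMeasure (expMeasure 1) := isProbabilityMeasure_expMeasure one_pos
  have h1 : ∀ᵐ e ∂expMeasure 1, 0 ≤ e := by
    rw [ae_iff]
    have h : {e : ℝ | ¬ 0 ≤ e} = Iio 0 := by ext; simp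
    rw [h, ← lintegral_indicator_one measurableSet_Iio, lintegral_expMeasure_one,
      setLIntegral_congr_fun (g := 0) measurableSet_Ioi]
    · simp
    · intro e he
      simp [(le_of_lt he : (0 : ℝ) ≤ e)]
  have h2 : Measure.QuasiMeasurePreserving (fun w : Mark d => w.2.1) (markLaw d)
      (expMeasure 1) := by
    unfold markLaw
    exact Measure.quasiMeasurePreserving_fst.comp Measure.quasiMeasurePreserving_snd
  exact h2.ae h1

theorem ae_nonneg_noise : ∀ᵐ ξ ∂noise d, ∀ n, 0 ≤ (ξ n).2.1 := by
  refine ae_all_iff.2 fun n => ?_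
  exact (measurePreserving_eval_infinitePi (fun _ => markLaw d) n).quasiMeasurePreserving.ae
    ae_nonneg_markLaw

omit [NeZero d] in
theorem measurable_process_left (s t : ℝ) (z : State d) :
    Measurable (fun ξ => process U ε r s t z ξ) := by
  have h := (measurable_process U ε r s t).comp (measurable_prodMk_left (x := z))
  simpa only [Function.comp_def] using h

/-- The n-th term is carried by paths whose n-th jump is before t and whose next one is after t,
hence by the event `jumpCount = n`; these events are disjoint. Paths with infinitely many jumps
before t, for which `jumpCount` takes a default value, can only increase the right side, so
non-explosion is not needed here. -/
theorem tsum_le_lintegral_process (hr : 0 < r) {f : State d → ℝ≥0∞} (hf : Measurable f)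
    (s t : ℝ) (z : State d) :
    ∑' n, (jumpStep U ε r)^[n] (noJump U ε r t f) (s, z) ≤
      ∫⁻ ξ, f (process U ε r s t z ξ) ∂noise d := by
  have hjc : Measurable (fun ξ => jumpCount U ε r s t z ξ) := by
    have h := (measurable_jumpCount U ε r s t).comp (measurable_prodMk_left (x := z))
    simpa only [Function.comp_def] using h
  have hfp : Measurable (fun ξ => f (process U ε r s t z ξ)) :=
    hf.comp (measurable_process_left s t z)
  have key : ∀ n, (jumpStep U ε r)^[n] (noJump U ε r t f) (s, z) ≤
      ∫⁻ ξ, {ξ | jumpCount U ε r s t z ξ = n}.indicator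
        (fun ξ => f (process U ε r s t z ξ)) ξ ∂noise d := fun n => by
    refine (iterate_jumpStep_le_lintegral_chain hr (measurable_noJump hf) s z n).trans ?_
    set G : (ℝ × State d) × Mark d → ℝ≥0∞ :=
      {q | q.1.1 ≤ t ∧ t < jumpTime U ε r q.1 q.2}.indicator (fun q => f (flow q.1 t)) with hG
    have hGm : Measurable G := by
      refine Measurable.indicator ?_ ?_
      · have h := hf.comp (measurable_flow.comp (measurable_fst.prodMk (measurable_const (a := t))
          : Measurable fun q : (ℝ × State d) × Mark d => (q.1, t)))
        simpa only [Function.comp_def] using h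
      · exact (measurableSet_le measurable_fst.fst measurable_const).inter
          (measurableSet_lt measurable_const (measurable_jumpTime U ε r))
    calc ∫⁻ ξ, noJump U ε r t f (chain U ε r s z ξ n) ∂noise d
        ≤ ∫⁻ ξ, ∫⁻ w, G (chain U ε r s z ξ n, w) ∂markLaw d ∂noise d := by
          refine lintegral_mono fun ξ => ?_
          set p := chain U ε r s z ξ n
          simp only [noJump]
          by_cases hp : p.1 ≤ t
          · rw [indicator_of_mem (show p.1 ∈ Iic t from hp)]
            have hms : MeasurableSet {w : Mark d | t < jumpTime U ε r p w} :=
              measurableSet_lt measurable_const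
                ((measurable_jumpTime U ε r).comp measurable_prodMk_left)
            have h1 : ∀ w, G (p, w) = {w : Mark d | t < jumpTime U ε r p w}.indicator
                (fun _ => f (flow p t)) w := fun w => by
              simp only [hG, indicator, mem_ofPred_eq, hp, true_and]
            rw [lintegral_congr h1, lintegral_indicator_const hms, mul_comm]
            gcongr
            exact survival_le_measure_jumpTime hr p hp
          · rw [indicator_of_notMem (show p.1 ∉ Iic t from hp)]
            exact zero_le
      _ = ∫⁻ ξ, G (chain U ε r s z ξ n, ξ n) ∂noise d := (lintegral_chain_mark hGm s z n).symm
      _ ≤ _ := by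
          refine lintegral_mono_ae ?_
          filter_upwards [ae_nonneg_noise (d := d)] with ξ hξ
          by_cases h : (chain U ε r s z ξ n).1 ≤ t ∧ t < (chain U ε r s z ξ (n + 1)).1
          · have hj := jumpCount_eq hr hξ h.1 h.2
            rw [indicator_of_mem (show ξ ∈ {ξ | jumpCount U ε r s t z ξ = n} from hj),
              hG, indicator_of_mem (by exact h)]
            simp only [process, hj]
            exact le_rfl
          · rw [hG, indicator_of_notMem (by exact h)]
            exact zero_le
  refine (ENNReal.tsum_le_tsum key).trans ?_
  refine (lintegral_tsum fun n =>
    (hfp.indicator (hjc (measurableSet_singleton n))).aemeasurable).symm.trans_le ?_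
  refine lintegral_mono fun ξ => ?_
  rw [tsum_eq_single (jumpCount U ε r s t z ξ)]
  · exact (indicator_of_mem (s := (fun ξ => jumpCount U ε r s t z ξ) ⁻¹'
      {jumpCount U ε r s t z ξ}) rfl (fun ξ => f (process U ε r s t z ξ))).le
  · intro n hn
    exact indicator_of_notMem (s := (fun ξ => jumpCount U ε r s t z ξ) ⁻¹' {n})
      (fun h => hn (Eq.symm h)) (fun ξ => f (process U ε r s t z ξ))

end ProcessLaw

/-! ### Constant temperature: non-explosion and the exact expansion -/

section ConstantTemperature

/-- The constant cooling schedule. -/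
def CoolingSchedule.const {e : ℝ} (he : 0 < e) : CoolingSchedule where
  temp := fun _ => e
  pos := fun _ => he
  anti := fun _ _ _ => le_rfl

variable {d : ℕ} {U : PeriodicPotential d} {ε : CoolingSchedule} {r : ℝ}

theorem cumRate_self (p : ℝ × State d) : cumRate U ε p p.1 = 0 := by simp [cumRate]

theorem inner_le_of_norm_grad_le {G : ℝ} (hG : ∀ x, ‖grad U x‖ ≤ G) (z : State d) :
    max ⟪(z.2 : EuclideanSpace ℝ (Fin d)), grad U z.1⟫ 0 ≤ G := by
  refine max_le ?_ ((norm_nonneg _).trans (hG z.1))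
  refine (real_inner_le_norm _ _).trans ?_
  have : ‖(z.2 : EuclideanSpace ℝ (Fin d))‖ = 1 := by simp
  rw [this, one_mul]
  exact hG _

theorem rate_const {e : ℝ} (he : 0 < e) (u : ℝ) (z : State d) :
    rate U (.const he) u z = max ⟪(z.2 : EuclideanSpace ℝ (Fin d)), grad U z.1⟫ 0 / e := rfl

theorem continuous_rate_flow {e : ℝ} (he : 0 < e) (p : ℝ × State d) :
    Continuous (fun u => rate U (.const he) u (flow p u)) := by
  have h : Continuous (fun u => grad U (move p.2.1 p.2.2 (u - p.1))) :=
    (continuous_grad_move U p.2.1 p.2.2).comp (continuous_id.sub continuous_const)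
  simp only [rate_const, flow]
  exact ((continuous_const.inner h).max continuous_const).div_const _

variable [NeZero d]

omit [NeZero d] in
theorem jumpOp_add {g h : ℝ × State d → ℝ≥0∞} (hg : Measurable g) (u : ℝ) (z : State d) :
    jumpOp U ε r (g + h) u z = jumpOp U ε r g u z + jumpOp U ε r h u z := by
  have hm : Measurable (fun y => g (u, (z.1, y))) := hg.comp (by fun_prop)
  simp only [jumpOp, Pi.add_apply]
  rw [lintegral_add_left hm]
  ring

theorem jumpStep_add {g h : ℝ × State d → ℝ≥0∞} (hg : Measurable g) :
    jumpStep U ε r (g + h) = jumpStep U ε r g + jumpStep U ε r h := by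
  funext p
  have h1 : Measurable (fun u => survival U ε r p u * jumpOp U ε r g u (flow p u)) := by
    have := ((measurable_survival U ε r).mul (measurable_jumpOp_flow (U := U) (ε := ε) (r := r)
      hg)).comp (measurable_prodMk_left (x := p))
    simpa only [Function.comp_def, Pi.mul_apply] using this
  simp only [Pi.add_apply, jumpStep, jumpOp_add hg, mul_add]
  rw [lintegral_add_left h1]

theorem iterate_jumpStep_add {g h : ℝ × State d → ℝ≥0∞} (hg : Measurable g) (n : ℕ) :
    (jumpStep U ε r)^[n] (g + h) = (jumpStep U ε r)^[n] g + (jumpStep U ε r)^[n] h := by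
  induction n with
  | zero => rfl
  | succ n ih =>
    simp only [Function.iterate_succ_apply', ih]
    exact jumpStep_add (measurable_jumpStep_iterate hg n)

omit [NeZero d] in
theorem jumpStep_const_mul {c : ℝ≥0∞} (hc : c ≠ ⊤) (g : ℝ × State d → ℝ≥0∞) :
    jumpStep U ε r (fun p => c * g p) = fun p => c * jumpStep U ε r g p := by
  funext p
  simp only [jumpStep]
  rw [← lintegral_const_mul' _ _ hc]
  refine lintegral_congr fun u => ?_
  simp only [jumpOp]
  rw [lintegral_const_mul' _ _ hc]
  ring

omit [NeZero d] in
theorem iterate_jumpStep_mono {g g' : ℝ × State d → ℝ≥0∞} (h : g ≤ g') (n : ℕ) :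
    (jumpStep U ε r)^[n] g ≤ (jumpStep U ε r)^[n] g' :=
  (show Monotone (jumpStep U ε r) from fun _ _ h => jumpStep_mono h).iterate n h

omit [NeZero d] in
theorem iterate_jumpStep_const_mul {c : ℝ≥0∞} (hc : c ≠ ⊤) (g : ℝ × State d → ℝ≥0∞) (n : ℕ) :
    (jumpStep U ε r)^[n] (fun p => c * g p) = fun p => c * (jumpStep U ε r)^[n] g p := by
  induction n with
  | zero => rfl
  | succ n ih => rw [Function.iterate_succ_apply', ih, jumpStep_const_mul hc,
      Function.iterate_succ_apply']

theorem jumpOp_of_time (φ : ℝ → ℝ≥0∞) (hr : 0 < r) (u : ℝ) (z : State d) :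
    jumpOp U ε r (fun p => φ p.1) u z = ENNReal.ofReal (rate U ε u z + r) * φ u := by
  rw [ENNReal.ofReal_add (rate_nonneg _ _ _ _) hr.le]
  simp [jumpOp]
  ring

omit [NeZero d] in
theorem survival_le_one (hr : 0 < r) (p : ℝ × State d) {u : ℝ} (hu : p.1 ≤ u) :
    survival U ε r p u ≤ 1 := by
  refine ENNReal.ofReal_le_one.2 (Real.exp_le_one_iff.2 ?_)
  have := cumRate_nonneg U ε p hu
  have := mul_nonneg hr.le (sub_nonneg.2 hu)
  linarith

/-- Exponential decay in the number of jumps. -/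
theorem iterate_jumpStep_exp_le {e G : ℝ} (he : 0 < e) (hr : 0 < r)
    (hG : ∀ x, ‖grad U x‖ ≤ G) (n : ℕ) (p : ℝ × State d) :
    (jumpStep U (.const he) r)^[n]
        (fun p => ENNReal.ofReal (Real.exp (-(2 * (G / e + r) * p.1)))) p ≤
      2⁻¹ ^ n * ENNReal.ofReal (Real.exp (-(2 * (G / e + r) * p.1))) := by
  have hG0 : 0 ≤ G := (norm_nonneg _).trans (hG 0)
  set L := G / e + r with hL
  have hL0 : 0 < L := by positivity
  -- L bounds the total jump rate and ∫_{u>s} L e^{-2Lu} du = e^{-2Ls}/2: the weight e^{-2L·time} is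
  -- at least halved by each jump.
  have h1 : jumpStep U (.const he) r (fun p => ENNReal.ofReal (Real.exp (-(2 * L * p.1)))) ≤
      fun p => 2⁻¹ * ENNReal.ofReal (Real.exp (-(2 * L * p.1))) := fun p => by
    have h2 := lintegral_exp_scale (show 0 < 2 * L by positivity) p.1 1
    simp only [Pi.one_apply, mul_one, lintegral_exp_neg_Ioi, neg_zero, Real.exp_zero,
      ENNReal.ofReal_one] at h2
    calc jumpStep U (.const he) r (fun p => ENNReal.ofReal (Real.exp (-(2 * L * p.1)))) p
        ≤ ∫⁻ u in Ioi p.1, (2⁻¹ * ENNReal.ofReal (Real.exp (-(2 * L * p.1)))) *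
            (ENNReal.ofReal (Real.exp (-(2 * L * (u - p.1)))) * ENNReal.ofReal (2 * L)) := by
          refine setLIntegral_mono' measurableSet_Ioi fun u hu => ?_
          have h3 := jumpOp_of_time (U := U) (ε := .const he)
            (fun u => ENNReal.ofReal (Real.exp (-(2 * L * u)))) hr u (flow p u)
          rw [h3]
          have h4 : rate U (.const he) u (flow p u) + r ≤ L := by
            rw [rate_const, hL]
            gcongr
            exact inner_le_of_norm_grad_le hG (flow p u)
          have h5 : ENNReal.ofReal (2 * L) = 2 * ENNReal.ofReal L := by
            rw [ENNReal.ofReal_mul zero_le_two, ENNReal.ofReal_ofNat]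
          calc survival U (.const he) r p u * (ENNReal.ofReal (rate U (.const he) u (flow p u) + r)
                * ENNReal.ofReal (Real.exp (-(2 * L * u))))
              ≤ 1 * (ENNReal.ofReal L * ENNReal.ofReal (Real.exp (-(2 * L * u)))) := by
                gcongr
                exact survival_le_one hr p (le_of_lt hu)
            _ = (2⁻¹ * 2) * (ENNReal.ofReal L * ENNReal.ofReal (Real.exp (-(2 * L * u)))) := by
                rw [ENNReal.inv_mul_cancel two_ne_zero ENNReal.ofNat_ne_top]
            _ = _ := by
                rw [h5]
                have : Real.exp (-(2 * L * u)) = Real.exp (-(2 * L * p.1)) *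
                    Real.exp (-(2 * L * (u - p.1))) := by
                  rw [← Real.exp_add]
                  ring_nf
                rw [this, ENNReal.ofReal_mul (Real.exp_pos _).le]
                ring
      _ = 2⁻¹ * ENNReal.ofReal (Real.exp (-(2 * L * p.1))) := by
          rw [lintegral_const_mul _ (by fun_prop), ← h2, mul_one]
  induction n generalizing p with
  | zero => simp
  | succ n ih =>
    rw [Function.iterate_succ_apply]
    refine (iterate_jumpStep_mono h1 n p).trans ?_
    rw [iterate_jumpStep_const_mul (by simp), pow_succ', mul_assoc]
    exact mul_le_mul' le_rfl (ih p)

omit [NeZero d] in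
theorem hasDerivAt_integral_of_continuous {a : ℝ → ℝ} (ha : Continuous a) (s u : ℝ) :
    HasDerivAt (fun u => ∫ v in s..u, a v) (a u) u :=
  intervalIntegral.integral_hasDerivAt_right (ha.intervalIntegrable _ _)
    ha.aestronglyMeasurable.stronglyMeasurableAtFilter ha.continuousAt

/-- A clock of rate a either survives up to t or rings before: -e^{-A} is a primitive of a e^{-A}.
-/
theorem ofReal_exp_neg_add_lintegral {a A : ℝ → ℝ} (ha : Continuous a) (h0 : ∀ u, 0 ≤ a u)
    {s t : ℝ} (hst : s ≤ t) (hA : ∀ u, HasDerivAt A (a u) u) (hAs : A s = 0) :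
    ENNReal.ofReal (Real.exp (-A t)) +
      ∫⁻ u in Ioc s t, ENNReal.ofReal (a u) * ENNReal.ofReal (Real.exp (-A u)) = 1 := by
  have hAc : Continuous A := continuous_iff_continuousAt.2 fun u => (hA u).continuousAt
  have hc : Continuous (fun u => a u * Real.exp (-A u)) := by fun_prop
  have h1 : ∫ u in s..t, a u * Real.exp (-A u) = 1 - Real.exp (-A t) := by
    rw [intervalIntegral.integral_eq_sub_of_hasDerivAt
      (f := fun u => -Real.exp (-A u)) (f' := fun u => a u * Real.exp (-A u))]
    · simp [hAs]
      ring
    · intro u _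
      have h : HasDerivAt (fun u => -Real.exp (-A u)) (-(Real.exp (-A u) * -a u)) u :=
        ((hA u).neg.exp).neg
      rwa [show -(Real.exp (-A u) * -a u) = a u * Real.exp (-A u) by ring] at h
    · exact hc.intervalIntegrable _ _
  have h2 : ∀ u, ENNReal.ofReal (a u) * ENNReal.ofReal (Real.exp (-A u)) =
      ENNReal.ofReal (a u * Real.exp (-A u)) := fun u => (ENNReal.ofReal_mul (h0 u)).symm
  have h3 : 0 ≤ ∫ u in s..t, a u * Real.exp (-A u) :=
    intervalIntegral.integral_nonneg hst fun u _ => mul_nonneg (h0 u) (Real.exp_pos _).le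
  simp only [h2]
  rw [← ofReal_integral_eq_lintegral_ofReal, ← intervalIntegral.integral_of_le hst,
    ← ENNReal.ofReal_add (Real.exp_pos _).le h3, h1]
  · simp
  · exact (intervalIntegrable_iff_integrableOn_Ioc_of_le hst).1 (hc.intervalIntegrable _ _)
  · exact Filter.Eventually.of_forall fun u => mul_nonneg (h0 u) (Real.exp_pos _).le

theorem noJump_one_add_jumpStep {e : ℝ} (he : 0 < e) (hr : 0 < r) (t : ℝ) :
    noJump U (.const he) r t 1 +
        jumpStep U (.const he) r (fun p : ℝ × State d => (Iic t).indicator 1 p.1) =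
      fun p => (Iic t).indicator 1 p.1 := by
  funext p
  have h1 := fun u => jumpOp_of_time (U := U) (ε := .const he) ((Iic t).indicator 1) hr u (flow p u)
  simp only [Pi.add_apply, jumpStep, h1, noJump]
  by_cases hp : p.1 ≤ t
  · rw [indicator_of_mem (show p.1 ∈ Iic t from hp), indicator_of_mem (show p.1 ∈ Iic t from hp)]
    have h2 := ofReal_exp_neg_add_lintegral (s := p.1) (t := t)
      (a := fun u => rate U (.const he) u (flow p u) + r)
      (A := fun u => cumRate U (.const he) p u + r * (u - p.1))
      ((continuous_rate_flow he p).add continuous_const)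
      (fun u => add_nonneg (rate_nonneg _ _ _ _) hr.le) hp
      (fun u => (hasDerivAt_integral_of_continuous (continuous_rate_flow he p) p.1 u).add
        (by simpa using ((hasDerivAt_id u).sub_const p.1).const_mul r))
      (by simp [cumRate_self])
    refine Eq.trans ?_ h2
    simp only [Pi.one_apply, mul_one]
    refine congrArg₂ (· + ·) rfl ?_
    rw [← Ioi_inter_Iic, inter_comm, ← Measure.restrict_restrict measurableSet_Iic,
      ← lintegral_indicator measurableSet_Iic]
    refine lintegral_congr fun u => ?_
    simp only [indicator, mem_Iic, Pi.one_apply]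
    split_ifs
    · rw [mul_one, mul_comm]
      rfl
    · simp
  · rw [indicator_of_notMem (show p.1 ∉ Iic t from hp),
      indicator_of_notMem (show p.1 ∉ Iic t from hp), zero_add]
    rw [setLIntegral_congr_fun (g := 0) measurableSet_Ioi]
    · simp
    · intro u hu
      have : u ∉ Iic t := fun h => hp ((le_of_lt hu).trans h)
      simp [indicator_of_notMem this]

/-- Iterating `noJump_one_add_jumpStep` telescopes. The remainder κ^N χ is the mass of chains whose
N-th jump is before t, and it tends to 0 by the geometric decay of the exponential weight: there is
no explosion. -/
theorem tsum_iterate_noJump_one {e : ℝ} (he : 0 < e) (hr : 0 < r) {t : ℝ} {p : ℝ × State d}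
    (hp : p.1 ≤ t) :
    ∑' n, (jumpStep U (.const he) r)^[n] (noJump U (.const he) r t 1) p = 1 := by
  obtain ⟨G, hG⟩ := exists_norm_grad_le U
  set κ := jumpStep U (.const he) r
  set χ : ℝ × State d → ℝ≥0∞ := fun p => (Iic t).indicator 1 p.1 with hχ
  have h1 : ∀ N, ∑ n ∈ Finset.range N, κ^[n] (noJump U (.const he) r t 1) p + κ^[N] χ p = 1 := by
    intro N
    induction N with
    | zero => simp [hχ, hp]
    | succ N ih =>
      rw [← ih, Finset.sum_range_succ, add_assoc]
      congr 1
      have h2 := iterate_jumpStep_add (U := U) (ε := .const he) (r := r) (h := κ χ)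
        (measurable_noJump (U := U) (ε := .const he) (r := r) (t := t)
        (measurable_one (α := ℝ≥0∞))) N
      rw [noJump_one_add_jumpStep he hr t] at h2
      rw [h2, Function.iterate_succ_apply]
      rfl
  have h3 : Filter.Tendsto (fun N => κ^[N] χ p) Filter.atTop (nhds 0) := by
    set L := 2 * (G / e + r)
    have hG0 : 0 ≤ G := (norm_nonneg _).trans (hG 0)
    have hL0 : 0 < L := by positivity
    have h4 : χ ≤ fun p => ENNReal.ofReal (Real.exp (L * t)) *
        ENNReal.ofReal (Real.exp (-(L * p.1))) := fun q => by
      simp only [hχ, indicator, mem_Iic]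
      split_ifs with h
      · rw [← ENNReal.ofReal_mul (Real.exp_pos _).le, ← Real.exp_add, Pi.one_apply,
          ENNReal.one_le_ofReal, Real.one_le_exp_iff]
        have := mul_le_mul_of_nonneg_left h hL0.le
        linarith
      · exact zero_le
    have h5 : ∀ N, κ^[N] χ p ≤ 2⁻¹ ^ N * (ENNReal.ofReal (Real.exp (L * t)) *
        ENNReal.ofReal (Real.exp (-(L * p.1)))) := fun N => by
      refine (iterate_jumpStep_mono h4 N p).trans ?_
      rw [iterate_jumpStep_const_mul ENNReal.ofReal_ne_top, mul_left_comm]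
      exact mul_le_mul' le_rfl (iterate_jumpStep_exp_le he hr hG N p)
    refine tendsto_of_tendsto_of_tendsto_of_le_of_le tendsto_const_nhds ?_ (fun _ => zero_le) h5
    have h6 : Filter.Tendsto (fun N : ℕ => (2⁻¹ : ℝ≥0∞) ^ N) Filter.atTop (nhds 0) :=
      ENNReal.tendsto_pow_atTop_nhds_zero_of_lt_one (by simp)
    have h7 := ENNReal.Tendsto.mul_const (b := ENNReal.ofReal (Real.exp (L * t)) *
        ENNReal.ofReal (Real.exp (-(L * p.1)))) h6
        (Or.inr (ENNReal.mul_ne_top ENNReal.ofReal_ne_top ENNReal.ofReal_ne_top))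
    simpa using h7
  have h8 := (ENNReal.tendsto_nat_tsum fun n => κ^[n] (noJump U (.const he) r t 1) p).add h3
  simp only [h1, add_zero] at h8
  exact (tendsto_nhds_unique h8 tendsto_const_nhds)

/-- The expansion of the law of the process in the number of jumps. -/
theorem lintegral_process_const {e : ℝ} (he : 0 < e) (hr : 0 < r) {f : State d → ℝ≥0∞}
    (hf : Measurable f) (hf1 : f ≤ 1) {s t : ℝ} (hst : s ≤ t) (z : State d) :
    ∫⁻ ξ, f (process U (.const he) r s t z ξ) ∂noise d =
      ∑' n, (jumpStep U (.const he) r)^[n] (noJump U (.const he) r t f) (s, z) := by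
  have hf' : Measurable (1 - f) := measurable_one.sub hf
  -- The lower bounds for f and for 1 - f add up to 1 on both sides, so neither can be strict.
  have h1 := tsum_le_lintegral_process (U := U) (ε := .const he) hr hf s t z
  have h2 := tsum_le_lintegral_process (U := U) (ε := .const he) hr hf' s t z
  have hsum : f + (1 - f) = 1 := add_tsub_cancel_of_le hf1
  have h3 : ∫⁻ ξ, f (process U (.const he) r s t z ξ) ∂noise d +
      ∫⁻ ξ, (1 - f) (process U (.const he) r s t z ξ) ∂noise d = 1 := by
    refine (lintegral_add_left (hf.comp (measurable_process_left s t z)) _).symm.trans ?_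
    simp only [Function.comp_def]
    have : ∀ ξ, f (process U (.const he) r s t z ξ) + (1 - f) (process U (.const he) r s t z ξ) =
        1 := fun ξ => congrFun hsum _
    rw [lintegral_congr this, lintegral_one, measure_univ]
  have h4 : noJump U (.const he) r t f + noJump U (.const he) r t (1 - f) =
      noJump U (.const he) r t 1 := by
    funext p
    simp only [noJump, Pi.add_apply, indicator]
    split_ifs
    · rw [← mul_add]
      exact congrArg _ (congrFun hsum _)
    · simp
  have h5 := tsum_iterate_noJump_one (U := U) he hr (p := (s, z)) hst
  rw [← h4] at h5
  simp only [iterate_jumpStep_add (measurable_noJump hf), Pi.add_apply, ENNReal.tsum_add] at h5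
  refine le_antisymm ?_ h1
  have h6 : ∑' n, (jumpStep U (.const he) r)^[n] (noJump U (.const he) r t (1 - f)) (s, z) ≠ ⊤ :=
    ne_top_of_le_ne_top ENNReal.one_ne_top (h5 ▸ le_add_self)
  refine (ENNReal.add_le_add_iff_right h6).1 ?_
  rw [h5, ← h3]
  gcongr

end ConstantTemperature

/-! ### Comparison with the process frozen at the initial temperature -/

section Comparison

variable {d : ℕ} [NeZero d] {U : PeriodicPotential d} {ε : CoolingSchedule} {r : ℝ}

omit [NeZero d] in
theorem intervalIntegrable_rate_flow (ε : CoolingSchedule) (p : ℝ × State d) (a b : ℝ) :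
    IntervalIntegrable (fun v => rate U ε v (flow p v)) volume a b :=
  intervalIntegrable_rate U ε p a b

omit [NeZero d] in
theorem rate_const_le {t₀ : ℝ≥0} {u : ℝ} (hu : (t₀ : ℝ) ≤ u) (z : State d) :
    rate U (.const (ε.pos t₀)) u z ≤ rate U ε u z := by
  rw [rate_const, rate]
  exact div_le_div_of_nonneg_left (le_max_right _ _) (ε.pos _)
    (ε.anti (NNReal.le_toNNReal_of_coe_le hu))

omit [NeZero d] in
theorem rate_le_add {G : ℝ} (hG : ∀ x, ‖grad U x‖ ≤ G) {t₀ t₁ : ℝ≥0} {u : ℝ}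
    (hu : u ≤ t₁) (hu0 : (t₀ : ℝ) ≤ u) (z : State d) :
    rate U ε u z ≤ rate U (.const (ε.pos t₀)) u z +
      G * (1 / ε.temp t₁ - 1 / ε.temp t₀) := by
  have h1 := inner_le_of_norm_grad_le hG z
  have h2 : 1 / ε.temp u.toNNReal ≤ 1 / ε.temp t₁ :=
    one_div_le_one_div_of_le (ε.pos _) (ε.anti (Real.toNNReal_le_iff_le_coe.2 hu))
  have h3 : 1 / ε.temp t₀ ≤ 1 / ε.temp u.toNNReal :=
    one_div_le_one_div_of_le (ε.pos _) (ε.anti (NNReal.le_toNNReal_of_coe_le hu0))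
  rw [rate_const, rate]
  have h4 : (0 : ℝ) ≤ max ⟪(z.2 : EuclideanSpace ℝ (Fin d)), grad U z.1⟫ 0 := le_max_right _ _
  rw [div_eq_mul_one_div, div_eq_mul_one_div _ (ε.temp t₀)]
  have h5 := mul_le_mul h1 (sub_le_sub_right h2 (1 / ε.temp t₀)) (sub_nonneg.2 h3)
    (h4.trans h1)
  linarith

omit [NeZero d] in
theorem survival_const_le {G : ℝ} (hG : ∀ x, ‖grad U x‖ ≤ G) {t₀ t₁ : ℝ≥0} {p : ℝ × State d}
    (hp : (t₀ : ℝ) ≤ p.1) {u : ℝ} (hu : u ≤ t₁) (hpu : p.1 ≤ u) :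
    ENNReal.ofReal (Real.exp (-(G * (1 / ε.temp t₁ - 1 / ε.temp t₀) * (u - p.1)))) *
      survival U (.const (ε.pos t₀)) r p u ≤ survival U ε r p u := by
  rw [survival, survival, ← ENNReal.ofReal_mul (Real.exp_pos _).le, ← Real.exp_add]
  refine ENNReal.ofReal_le_ofReal (Real.exp_le_exp.2 ?_)
  have h1 : cumRate U ε p u ≤ cumRate U (.const (ε.pos t₀)) p u +
      G * (1 / ε.temp t₁ - 1 / ε.temp t₀) * (u - p.1) := by
    have h2 : G * (1 / ε.temp t₁ - 1 / ε.temp t₀) * (u - p.1) =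
        ∫ _ in p.1..u, G * (1 / ε.temp t₁ - 1 / ε.temp t₀) := by
      rw [intervalIntegral.integral_const, smul_eq_mul, mul_comm]
    rw [h2, cumRate, cumRate, ← intervalIntegral.integral_add
      (intervalIntegrable_rate_flow _ p _ _) intervalIntegrable_const]
    refine intervalIntegral.integral_mono_on hpu (intervalIntegrable_rate_flow _ p _ _)
      ((intervalIntegrable_rate_flow _ p _ _).add intervalIntegrable_const) fun v hv => ?_
    exact rate_le_add hG (hv.2.trans hu) (hp.trans hv.1) _
  linarith

/-- Before t₁ the true reflection rate dominates the frozen one and exceeds it by at most D = G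
(1/ε_{t₁} - 1/ε_{t₀}), so only survival costs something. The weight e^{-D(t₁-p.1)} splits at the
jump time u into the loss of survival up to u and the weight needed at u, so the total loss does not
depend on the number of jumps. The vanishing of g after t₁ excludes times where the rates are not
controlled. -/
theorem jumpStep_comparison {G : ℝ} (hG : ∀ x, ‖grad U x‖ ≤ G) {t₀ t₁ : ℝ≥0}
    {g g' : ℝ × State d → ℝ≥0∞} (hg0 : ∀ p : ℝ × State d, (t₁ : ℝ) < p.1 → g p = 0)
    (hg : ∀ p : ℝ × State d, (t₀ : ℝ) ≤ p.1 → p.1 ≤ t₁ →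
      ENNReal.ofReal (Real.exp (-(G * (1 / ε.temp t₁ - 1 / ε.temp t₀) * (t₁ - p.1)))) * g p ≤ g' p) :
    (∀ p : ℝ × State d, (t₁ : ℝ) < p.1 → jumpStep U (.const (ε.pos t₀)) r g p = 0) ∧
    ∀ p : ℝ × State d, (t₀ : ℝ) ≤ p.1 → p.1 ≤ t₁ →
      ENNReal.ofReal (Real.exp (-(G * (1 / ε.temp t₁ - 1 / ε.temp t₀) * (t₁ - p.1)))) *
        jumpStep U (.const (ε.pos t₀)) r g p ≤ jumpStep U ε r g' p := by
  have h0 : ∀ u, (t₁ : ℝ) < u → ∀ z, jumpOp U (.const (ε.pos t₀)) r g u z = 0 := fun u hu z => by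
    simp [jumpOp, hg0 (u, _) hu]
  constructor
  · intro p hp
    rw [jumpStep, setLIntegral_congr_fun (g := 0) measurableSet_Ioi]
    · simp
    · intro u hu
      simp [h0 u (hp.trans hu)]
  · intro p hp hp1
    rw [jumpStep, jumpStep, ← lintegral_const_mul' _ _ ENNReal.ofReal_ne_top]
    refine setLIntegral_mono' measurableSet_Ioi fun u hu => ?_
    rcases lt_or_ge (t₁ : ℝ) u with hut | hut
    · simp [h0 u hut]
    · have hu0 : (t₀ : ℝ) ≤ u := hp.trans (le_of_lt hu)
      set D := G * (1 / ε.temp t₁ - 1 / ε.temp t₀) with hD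
      have hsplit : Real.exp (-(D * (t₁ - p.1))) =
          Real.exp (-(D * (u - p.1))) * Real.exp (-(D * (t₁ - u))) := by
        rw [← Real.exp_add]
        ring_nf
      rw [hsplit, ENNReal.ofReal_mul (Real.exp_pos _).le]
      calc _ = (ENNReal.ofReal (Real.exp (-(D * (u - p.1)))) *
              survival U (.const (ε.pos t₀)) r p u) * (ENNReal.ofReal (Real.exp (-(D * (t₁ - u)))) *
              jumpOp U (.const (ε.pos t₀)) r g u (flow p u)) := by ring
        _ ≤ survival U ε r p u * jumpOp U ε r g' u (flow p u) := by
          refine mul_le_mul' (survival_const_le hG hp hut (le_of_lt hu)) ?_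
          simp only [jumpOp]
          rw [mul_add, mul_left_comm, mul_left_comm _ (ENNReal.ofReal r),
            ← lintegral_const_mul' _ _ ENNReal.ofReal_ne_top]
          gcongr
          · exact rate_const_le hu0 _
          · exact hg _ hu0 hut
          · exact hg _ hu0 hut

theorem iterate_jumpStep_comparison {G : ℝ} (hG : ∀ x, ‖grad U x‖ ≤ G) {t₀ t₁ : ℝ≥0}
    (f : State d → ℝ≥0∞) (n : ℕ) :
    (∀ p : ℝ × State d, (t₁ : ℝ) < p.1 → (jumpStep U (.const (ε.pos t₀)) r)^[n]
      (noJump U (.const (ε.pos t₀)) r t₁ f) p = 0) ∧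
    ∀ p : ℝ × State d, (t₀ : ℝ) ≤ p.1 → p.1 ≤ t₁ →
      ENNReal.ofReal (Real.exp (-(G * (1 / ε.temp t₁ - 1 / ε.temp t₀) * (t₁ - p.1)))) *
        (jumpStep U (.const (ε.pos t₀)) r)^[n] (noJump U (.const (ε.pos t₀)) r t₁ f) p ≤
      (jumpStep U ε r)^[n] (noJump U ε r t₁ f) p := by
  induction n with
  | zero =>
    constructor
    · intro p hp
      exact indicator_of_notMem (s := Iic (t₁ : ℝ)) (not_le.2 hp)
        (fun _ => survival U (.const (ε.pos t₀)) r p t₁ * f (flow p t₁))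
    · intro p hp hp1
      simp only [Function.iterate_zero, id, noJump]
      rw [indicator_of_mem (show p.1 ∈ Iic (t₁ : ℝ) from hp1),
        indicator_of_mem (show p.1 ∈ Iic (t₁ : ℝ) from hp1), ← mul_assoc]
      gcongr
      exact survival_const_le hG hp le_rfl hp1
  | succ n ih =>
    simp only [Function.iterate_succ_apply']
    exact jumpStep_comparison hG ih.1 ih.2

theorem lintegral_process_ge {G : ℝ} (hG : ∀ x, ‖grad U x‖ ≤ G) (hr : 0 < r) {t₀ t₁ : ℝ≥0}
    (ht : t₀ ≤ t₁) {f : State d → ℝ≥0∞} (hf : Measurable f) (hf1 : f ≤ 1) (z : State d) :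
    ENNReal.ofReal (Real.exp (-(G * (1 / ε.temp t₁ - 1 / ε.temp t₀) * (t₁ - t₀)))) *
      ∫⁻ ξ, f (process U (.const (ε.pos t₀)) r t₀ t₁ z ξ) ∂noise d ≤
    ∫⁻ ξ, f (process U ε r t₀ t₁ z ξ) ∂noise d := by
  rw [lintegral_process_const _ hr hf hf1 (NNReal.coe_le_coe.2 ht), ← ENNReal.tsum_mul_left]
  refine (ENNReal.tsum_le_tsum fun n => ?_).trans (tsum_le_lintegral_process hr hf _ _ _)
  exact (iterate_jumpStep_comparison hG f n).2 (t₀, z) le_rfl (NNReal.coe_le_coe.2 ht)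

end Comparison

/-! ### Reflections and the uniform law on the sphere -/

section SphereInvariance

variable {d : ℕ}

open scoped Pointwise in
-- The surface measure of a set is defined through the volume of the cone (0,1)·s over it, and a
-- linear isometry maps cones to cones and preserves volume.
theorem measurePreserving_unifSph
    (A : EuclideanSpace ℝ (Fin d) ≃ₗᵢ[ℝ] EuclideanSpace ℝ (Fin d)) {T : Sph d → Sph d}
    (hT : Measurable T) (hTA : ∀ y, (T y : EuclideanSpace ℝ (Fin d)) = A y) :
    MeasurePreserving T (unifSph d) (unifSph d) := by
  have h : MeasurePreserving T (volume : Measure (EuclideanSpace ℝ (Fin d))).toSphere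
      (volume : Measure (EuclideanSpace ℝ (Fin d))).toSphere := by
    refine ⟨hT, Measure.ext fun s hs => ?_⟩
    rw [Measure.map_apply hT hs, Measure.toSphere_apply' _ (hT hs), Measure.toSphere_apply' _ hs]
    congr 1
    have : Ioo (0 : ℝ) 1 • ((↑) '' (T ⁻¹' s) : Set (EuclideanSpace ℝ (Fin d))) =
        A ⁻¹' (Ioo (0 : ℝ) 1 • ((↑) '' s : Set (EuclideanSpace ℝ (Fin d)))) := by
      ext v
      simp only [mem_smul, mem_image, mem_preimage, exists_exists_and_eq_and]
      constructor
      · rintro ⟨a, ha, y, hy, rfl⟩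
        exact ⟨a, ha, T y, hy, by rw [hTA, map_smul]⟩
      · rintro ⟨a, ha, y, hy, h⟩
        have hv : v = a • A.symm y := by
          rw [← map_smul, h, A.symm_apply_apply]
        have hn : A.symm (y : EuclideanSpace ℝ (Fin d)) ∈
            Metric.sphere (0 : EuclideanSpace ℝ (Fin d)) 1 := by
          simp
        refine ⟨a, ha, ⟨_, hn⟩, ?_, hv.symm⟩
        have : T ⟨_, hn⟩ = y := Subtype.ext (by rw [hTA, A.apply_symm_apply])
        rwa [this]
    rw [this]
    exact A.measurePreserving.measure_preimage_equiv (f := A.toMeasurableEquiv) _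
  refine ⟨hT, ?_⟩
  rw [unifSph, Measure.map_smul, h.map_eq]

/-- `reflectVel` is the reflection in the hyperplane orthogonal to the gradient. The formula stays
valid where the gradient vanishes: both maps are then the identity. -/
theorem measurePreserving_reflectVel (U : PeriodicPotential d) (x : UnitAddTorus (Fin d)) :
    MeasurePreserving (reflectVel U x) (unifSph d) (unifSph d) := by
  have hm : Measurable (reflectVel U x) := by
    have h := (measurable_reflectVel U).comp (measurable_prodMk_left (x := x))
    simpa only [Function.comp_def] using h
  refine measurePreserving_unifSph (Submodule.span ℝ {grad U x})ᗮ.reflection hm fun y => ?_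
  rw [Submodule.reflection_orthogonal_apply, Submodule.reflection_singleton_apply]
  simp only [reflectVel, dir, real_inner_smul_right, smul_smul, two_smul, neg_sub, ← add_smul]
  congr 2
  rw [real_inner_comm]
  simp only [RCLike.ofReal_real_eq_id, id]
  ring

theorem inner_reflectVel (U : PeriodicPotential d) (x : UnitAddTorus (Fin d)) (y : Sph d) :
    ⟪(reflectVel U x y : EuclideanSpace ℝ (Fin d)), grad U x⟫ =
      -⟪(y : EuclideanSpace ℝ (Fin d)), grad U x⟫ := by
  simp only [reflectVel, dir, inner_sub_left, real_inner_smul_left, real_inner_smul_right,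
    real_inner_self_eq_norm_sq]
  by_cases h : grad U x = 0
  · simp [h]
  · have : ‖grad U x‖ ≠ 0 := by simpa using h
    field_simp
    ring

end SphereInvariance

/-! ### Time reversal under the Gibbs measure -/

section Invariance

variable {d : ℕ} {U : PeriodicPotential d} {r e : ℝ}

/-- The reflection rate of the time-reversed process. -/
noncomputable def backRate (U : PeriodicPotential d) (e : ℝ) (z : State d) : ℝ :=
  max (-⟪(z.2 : EuclideanSpace ℝ (Fin d)), grad U z.1⟫) 0 / e

/-- The probability that the time-reversed process does not jump during a time `τ`. -/
noncomputable def backSurvival (U : PeriodicPotential d) (e r : ℝ) (z : State d) (τ : ℝ) : ℝ≥0∞ :=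
  ENNReal.ofReal (Real.exp (-((∫ v in 0..τ, backRate U e (move z.1 z.2 (-v), z.2)) + r * τ)))

theorem backRate_nonneg (he : 0 < e) (z : State d) : 0 ≤ backRate U e z :=
  div_nonneg (le_max_right _ _) he.le

theorem measurable_backRate : Measurable (backRate (d := d) U e) := by
  have hg : Measurable (fun z : State d => grad U z.1) := (measurable_grad U).comp measurable_fst
  unfold backRate
  fun_prop

theorem continuous_backRate_move (z : State d) :
    Continuous (fun v => backRate U e (move z.1 z.2 (-v), z.2)) := by
  have h : Continuous (fun u => grad U (move z.1 z.2 (-u))) :=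
    (continuous_grad_move U z.1 z.2).comp continuous_neg
  have h2 : Continuous (fun v => ⟪(z.2 : EuclideanSpace ℝ (Fin d)), grad U (move z.1 z.2 (-v))⟫) :=
    continuous_const.inner h
  simp only [backRate]
  exact (h2.neg.max continuous_const).div_const _

/-- Run backwards from time u, the process either reaches s without a jump or meets its first jump
at some time v in (s, u), the last jump in forward time. -/
theorem backSurvival_add_lintegral (he : 0 < e) (hr : 0 < r) (z : State d) {s u : ℝ}
    (hsu : s ≤ u) :
    backSurvival U e r z (u - s) + ∫⁻ v in Ioo s u,
      ENNReal.ofReal (backRate U e (move z.1 z.2 (-(u - v)), z.2) + r) *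
        backSurvival U e r z (u - v) = 1 := by
  have hc := continuous_backRate_move (U := U) (e := e) z
  have h := ofReal_exp_neg_add_lintegral (s := 0) (t := u - s)
    (a := fun v => backRate U e (move z.1 z.2 (-v), z.2) + r)
    (A := fun τ => (∫ v in 0..τ, backRate U e (move z.1 z.2 (-v), z.2)) + r * τ)
    (hc.add continuous_const) (fun v => add_nonneg (backRate_nonneg he _) hr.le)
    (sub_nonneg.2 hsu)
    (fun τ => (hasDerivAt_integral_of_continuous hc 0 τ).add
      (by simpa using (hasDerivAt_id τ).const_mul r))
    (by simp)
  refine Eq.trans ?_ h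
  refine congrArg₂ (· + ·) rfl ?_
  rw [← setLIntegral_congr Ioo_ae_eq_Ioc, ← lintegral_indicator measurableSet_Ioo,
    ← lintegral_indicator measurableSet_Ioo]
  refine Eq.trans ?_ (lintegral_sub_left_eq_self _ u)
  refine lintegral_congr fun v => ?_
  have : u - v ∈ Ioo 0 (u - s) ↔ v ∈ Ioo s u := by
    simp only [mem_Ioo]
    constructor <;> rintro ⟨h1, h2⟩ <;> constructor <;> linarith
  simp only [indicator, this]
  rfl

/-- With a = y·∇U, the derivative of U along the line, a₊ - (-a)₊ = a, and the integral of a is the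
increment of U. After exponentiation, Gibbs weight at the start times forward survival equals Gibbs
weight at the end times backward survival. -/
theorem cumRate_move_back (he : 0 < e) (z : State d) (s u : ℝ) :
    pot U (move z.1 z.2 (-(u - s))) / e +
        cumRate U (.const he) (s, (move z.1 z.2 (-(u - s)), z.2)) u =
      pot U z.1 / e + ∫ v in 0..(u - s), backRate U e (move z.1 z.2 (-v), z.2) := by
  set a : ℝ → ℝ := fun v => ⟪(z.2 : EuclideanSpace ℝ (Fin d)), grad U (move z.1 z.2 (-v))⟫ with ha
  have hac : Continuous a := continuous_const.inner
    ((continuous_grad_move U z.1 z.2).comp continuous_neg)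
  have h1 : cumRate U (.const he) (s, (move z.1 z.2 (-(u - s)), z.2)) u =
      ∫ v in 0..(u - s), max (a v) 0 / e := by
    have h2 := intervalIntegral.integral_comp_sub_left (a := s) (b := u)
      (fun v => max (a v) 0 / e) u
    rw [sub_self] at h2
    rw [← h2, cumRate]
    refine intervalIntegral.integral_congr fun v _ => ?_
    simp only [rate_const, flow, move_move, ha]
    congr 5
    ring
  have h3 : pot U (move z.1 z.2 (-(u - s))) - pot U z.1 = ∫ v in 0..(u - s), -a v := by
    rw [intervalIntegral.integral_eq_sub_of_hasDerivAt
      (f := fun v => pot U (move z.1 z.2 (-v)))]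
    · simp [move_zero]
    · intro v _
      have h := (hasDerivAt_pot_move U z.1 z.2 (-v)).scomp v (hasDerivAt_neg v)
      rw [neg_one_smul] at h
      exact h
    · exact hac.neg.intervalIntegrable _ _
  have h4 : ∫ v in 0..(u - s), backRate U e (move z.1 z.2 (-v), z.2) =
      (∫ v in 0..(u - s), max (a v) 0 / e) + (∫ v in 0..(u - s), -a v) / e := by
    have hmax : Continuous (fun v => max (a v) 0 / e) := (hac.max continuous_const).div_const e
    have hneg : Continuous (fun v => -a v / e) := hac.neg.div_const e
    rw [← intervalIntegral.integral_div, ← intervalIntegral.integral_add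
      (hmax.intervalIntegrable _ _) (hneg.intervalIntegrable _ _)]
    refine intervalIntegral.integral_congr fun v _ => ?_
    simp only [backRate]
    change max (-a v) 0 / e = max (a v) 0 / e + -a v / e
    rw [← add_div]
    congr 1
    rcases le_total (a v) 0 with h | h
    · rw [max_eq_right h, max_eq_left (by linarith)]
      ring
    · rw [max_eq_left h, max_eq_right (by linarith)]
      ring
  rw [h1, h4, ← h3]
  ring

variable [NeZero d]

/-- The Gibbs measure at temperature `e`. -/
noncomputable def gibbsTemp (U : PeriodicPotential d) (e : ℝ) : Measure (State d) :=
  ((volume : Measure (UnitAddTorus (Fin d))).prod (unifSph d)).tilted (fun z => -(pot U z.1 / e))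

theorem isProbabilityMeasure_gibbsTemp (he : 0 < e) :
    IsProbabilityMeasure (gibbsTemp U e) := by
  obtain ⟨M, hM⟩ := exists_abs_pot_le U
  refine isProbabilityMeasure_tilted ?_
  have hm : Measurable (fun z : State d => Real.exp (-(pot U z.1 / e))) := by
    have h : Measurable (fun z : State d => pot U z.1) := (measurable_pot U).comp measurable_fst
    fun_prop
  refine Integrable.of_bound hm.aestronglyMeasurable (Real.exp (M / e))
    (Filter.Eventually.of_forall fun z => ?_)
  rw [Real.norm_of_nonneg (Real.exp_pos _).le, Real.exp_le_exp, ← neg_div]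
  gcongr
  exact (neg_le_abs _).trans (hM _)

/-- The density of the Gibbs measure. -/
noncomputable def gibbsDensity (U : PeriodicPotential d) (e : ℝ) (x : UnitAddTorus (Fin d)) :
    ℝ≥0∞ :=
  ENNReal.ofReal (Real.exp (-(pot U x / e)) / ∫ z, Real.exp (-(pot U z.1 / e))
    ∂((volume : Measure (UnitAddTorus (Fin d))).prod (unifSph d)))

omit [NeZero d] in
theorem measurable_gibbsDensity : Measurable (gibbsDensity (d := d) U e) := by
  have := (measurable_pot U)
  unfold gibbsDensity
  fun_prop

theorem lintegral_gibbsTemp {f : State d → ℝ≥0∞} (hf : Measurable f) :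
    ∫⁻ z, f z ∂gibbsTemp U e = ∫⁻ x, ∫⁻ y, gibbsDensity U e x * f (x, y) ∂unifSph d := by
  rw [gibbsTemp, lintegral_tilted]
  exact lintegral_prod _ (((measurable_gibbsDensity.comp measurable_fst).mul hf).aemeasurable)

theorem lintegral_gibbsTemp_symm {f : State d → ℝ≥0∞} (hf : Measurable f) :
    ∫⁻ z, f z ∂gibbsTemp U e = ∫⁻ y, ∫⁻ x, gibbsDensity U e x * f (x, y) ∂volume ∂unifSph d := by
  rw [gibbsTemp, lintegral_tilted]
  exact lintegral_prod_symm _ (((measurable_gibbsDensity.comp measurable_fst).mul hf).aemeasurable)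

/-- At a fixed position, the reflection preserves the uniform law and changes the sign of y·∇U, so
the forward rate becomes the backward one; the refreshment term is averaged over the same law. The
Gibbs density depends on the position only and plays no role. -/
theorem lintegral_jumpOp_gibbs (he : 0 < e) (hr : 0 < r) {g : ℝ × State d → ℝ≥0∞}
    (hg : Measurable g) (u : ℝ) :
    ∫⁻ z, jumpOp U (.const he) r g u z ∂gibbsTemp U e =
      ∫⁻ z, ENNReal.ofReal (backRate U e z + r) * g (u, z) ∂gibbsTemp U e := by
  have hgu : Measurable (fun z => g (u, z)) := hg.comp measurable_prodMk_left
  have hb := measurable_backRate (U := U) (e := e)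
  have hJ : Measurable (fun z => jumpOp U (.const he) r g u z) := by
    have h := (measurable_jumpOp (U := U) (ε := .const he) (r := r) hg).comp
      (measurable_prodMk_left (x := u))
    simpa only [Function.comp_def] using h
  rw [lintegral_gibbsTemp hJ, lintegral_gibbsTemp (by fun_prop)]
  refine lintegral_congr fun x => ?_
  have hgx : Measurable (fun y => g (u, (x, y))) := hgu.comp measurable_prodMk_left
  have hbx : Measurable (fun y => backRate U e (x, y)) := hb.comp measurable_prodMk_left
  have hJx : Measurable (fun y => jumpOp U (.const he) r g u (x, y)) :=
    hJ.comp (measurable_prodMk_left (x := x))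
  rw [lintegral_const_mul _ hJx, lintegral_const_mul _ (by fun_prop)]
  congr 1
  simp only [jumpOp, ENNReal.ofReal_add (backRate_nonneg he _) hr.le, add_mul]
  rw [lintegral_add_right _ measurable_const, lintegral_add_left (by fun_prop), lintegral_const,
    measure_univ, mul_one, lintegral_const_mul _ hgx,
    ← (measurePreserving_reflectVel U x).lintegral_comp (by fun_prop : Measurable fun y =>
      ENNReal.ofReal (backRate U e (x, y)) * g (u, (x, y)))]
  congr 2
  funext y
  rw [backRate, inner_reflectVel, neg_neg]
  rfl

omit [NeZero d] in
theorem measurable_survival_left (ε : CoolingSchedule) (s u : ℝ) :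
    Measurable (fun z : State d => survival U ε r (s, z) u) := by
  have h := (measurable_survival (d := d) U ε r).comp
    (by fun_prop : Measurable fun z : State d => ((s, z), u))
  simpa only [Function.comp_def] using h

omit [NeZero d] in
theorem measurable_flow_state (s u : ℝ) : Measurable (fun z : State d => flow (s, z) u) := by
  have h := (measurable_flow (d := d)).comp (by fun_prop : Measurable fun z : State d => ((s, z), u))
  simpa only [Function.comp_def] using h

omit [NeZero d] in
theorem measurable_back : Measurable (fun q : State d × ℝ =>
    ((move q.1.1 q.1.2 (-q.2), q.1.2) : State d)) := by
  have h := (measurable_move (d := d)).comp (measurable_fst.prodMk measurable_snd.neg :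
    Measurable fun q : State d × ℝ => (q.1, -q.2))
  exact h.prodMk measurable_fst.snd

omit [NeZero d] in
theorem measurable_backSurvival :
    Measurable (fun q : State d × ℝ => backSurvival U e r q.1 q.2) := by
  have hb : Measurable (fun q : State d × ℝ => backRate U e (move q.1.1 q.1.2 (-q.2), q.1.2)) :=
    measurable_backRate.comp measurable_back
  have h1 : ∀ τ : ℝ, Measurable (fun z : State d =>
      ∫ v in 0..τ, backRate U e (move z.1 z.2 (-v), z.2)) := fun τ => by
    simp only [intervalIntegral]
    exact hb.stronglyMeasurable.integral_prod_right'.measurable.sub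
      hb.stronglyMeasurable.integral_prod_right'.measurable
  have h2 := measurable_uncurry_of_continuous_of_measurable
    (u := fun (τ : ℝ) (z : State d) => ∫ v in 0..τ, backRate U e (move z.1 z.2 (-v), z.2))
    (fun z => intervalIntegral.continuous_primitive
      (fun a b => (continuous_backRate_move z).intervalIntegrable a b) 0) h1
  have h3 : Measurable (fun q : State d × ℝ =>
      ∫ v in 0..q.2, backRate U e (move q.1.1 q.1.2 (-v), q.1.2)) := h2.comp measurable_swap
  unfold backSurvival
  fun_prop

/-- For each velocity, the position is translated back by (u - s) y, which preserves the uniform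
law; `cumRate_move_back` then exchanges the weights. -/
theorem lintegral_survival_gibbs (he : 0 < e) {s u : ℝ} {Φ f : State d → ℝ≥0∞}
    (hΦ : Measurable Φ) (hf : Measurable f) :
    ∫⁻ z, Φ z * (survival U (.const he) r (s, z) u * f (flow (s, z) u)) ∂gibbsTemp U e =
      ∫⁻ z, Φ (move z.1 z.2 (-(u - s)), z.2) * backSurvival U e r z (u - s) * f z
        ∂gibbsTemp U e := by
  have hfl : Measurable (fun z : State d => f (flow (s, z) u)) := hf.comp (measurable_flow_state s u)
  have hs := measurable_survival_left (U := U) (r := r) (.const he) s u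
  have hbk : Measurable (fun z : State d => Φ (move z.1 z.2 (-(u - s)), z.2)) := by
    have h := hΦ.comp (measurable_back.comp (measurable_prodMk_right (y := u - s)))
    simpa only [Function.comp_def] using h
  have hbs : Measurable (fun z : State d => backSurvival U e r z (u - s)) := by
    have h := (measurable_backSurvival (U := U) (e := e) (r := r)).comp
      (measurable_prodMk_right (y := u - s))
    simpa only [Function.comp_def] using h
  have hF := hΦ.mul (hs.mul hfl)
  rw [lintegral_gibbsTemp_symm (by exact hF),
    lintegral_gibbsTemp_symm (by exact (hbk.mul hbs).mul hf)]
  refine lintegral_congr fun y => ?_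
  have hFy : Measurable (fun x => gibbsDensity U e x * (Φ (x, y) *
      (survival U (.const he) r (s, (x, y)) u * f (flow (s, (x, y)) u)))) :=
    measurable_gibbsDensity.mul (hF.comp (measurable_prodMk_right (y := y)))
  have hmp := measurePreserving_add_right_torus
    (proj ((-(u - s)) • (y : EuclideanSpace ℝ (Fin d))))
  rw [← hmp.lintegral_comp hFy]
  refine lintegral_congr fun x => ?_
  rw [← move_eq_add]
  have hb := cumRate_move_back (U := U) he (x, y) s u
  simp only at hb
  have h1 : flow (s, (move x y (-(u - s)), y)) u = (x, y) := by
    simp [flow, move_move, move_zero]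
  have h2 : gibbsDensity U e (move x y (-(u - s))) *
      survival U (.const he) r (s, (move x y (-(u - s)), y)) u =
      gibbsDensity U e x * backSurvival U e r (x, y) (u - s) := by
    have h0 : 0 ≤ ∫ z, Real.exp (-(pot U z.1 / e))
        ∂((volume : Measure (UnitAddTorus (Fin d))).prod (unifSph d)) :=
      integral_nonneg fun _ => (Real.exp_pos _).le
    simp only [gibbsDensity, survival, backSurvival]
    rw [← ENNReal.ofReal_mul (div_nonneg (Real.exp_pos _).le h0),
      ← ENNReal.ofReal_mul (div_nonneg (Real.exp_pos _).le h0), div_mul_eq_mul_div,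
      div_mul_eq_mul_div, ← Real.exp_add, ← Real.exp_add]
    congr 3
    linarith
  rw [h1]
  calc _ = (gibbsDensity U e (move x y (-(u - s))) *
        survival U (.const he) r (s, (move x y (-(u - s)), y)) u) *
        Φ (move x y (-(u - s)), y) * f (x, y) := by ring
    _ = _ := by rw [h2]; ring

/-- In the stationary regime the state at time u is classified by the last jump after s, if any;
jumps occur with intensity (`backRate` + r) dν dv, read off just after the jump. Carried to time u,
the weights sum to one by `backSurvival_add_lintegral`. -/
theorem lintegral_survival_add (he : 0 < e) (hr : 0 < r) {f : State d → ℝ≥0∞}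
    (hf : Measurable f) {s u : ℝ} (hsu : s ≤ u) :
    ∫⁻ z, survival U (.const he) r (s, z) u * f (flow (s, z) u) ∂gibbsTemp U e +
      ∫⁻ v in Ioo s u, ∫⁻ z, ENNReal.ofReal (backRate U e z + r) *
        (survival U (.const he) r (v, z) u * f (flow (v, z) u)) ∂gibbsTemp U e =
    ∫⁻ z, f z ∂gibbsTemp U e := by
  have := isProbabilityMeasure_gibbsTemp (U := U) he
  have hbr : Measurable (fun z : State d => ENNReal.ofReal (backRate U e z + r)) :=
    (measurable_backRate.add_const r).ennreal_ofReal
  have h1 := lintegral_survival_gibbs (U := U) (r := r) he (s := s) (u := u)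
    (Φ := fun _ => 1) measurable_const hf
  simp only [one_mul] at h1
  have hm : Measurable (fun q : State d × ℝ =>
      ENNReal.ofReal (backRate U e (move q.1.1 q.1.2 (-(u - q.2)), q.1.2) + r) *
        backSurvival U e r q.1 (u - q.2)) := by
    have hq : Measurable (fun q : State d × ℝ => (q.1, u - q.2)) := by fun_prop
    have h2 := (hbr.comp (measurable_back.comp hq)).mul
      ((measurable_backSurvival (U := U) (e := e) (r := r)).comp hq)
    exact h2
  have hmf : Measurable (fun q : State d × ℝ =>
      ENNReal.ofReal (backRate U e (move q.1.1 q.1.2 (-(u - q.2)), q.1.2) + r) *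
        backSurvival U e r q.1 (u - q.2) * f q.1) := hm.mul (hf.comp measurable_fst)
  simp only [lintegral_survival_gibbs he hbr hf]
  have h3 := lintegral_lintegral_swap (μ := volume.restrict (Ioo s u)) (ν := gibbsTemp U e)
    (f := fun v z => ENNReal.ofReal (backRate U e (move z.1 z.2 (-(u - v)), z.2) + r) *
        backSurvival U e r z (u - v) * f z) (hmf.comp measurable_swap).aemeasurable
  rw [h1, h3]
  have hbs : Measurable (fun z : State d => backSurvival U e r z (u - s)) := by
    have h := (measurable_backSurvival (U := U) (e := e) (r := r)).comp
      (measurable_prodMk_right (y := u - s))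
    simpa only [Function.comp_def] using h
  rw [← lintegral_add_left (by exact hbs.mul hf)]
  refine lintegral_congr fun z => ?_
  have hmz : Measurable (fun v => ENNReal.ofReal (backRate U e (move z.1 z.2 (-(u - v)), z.2) + r) *
      backSurvival U e r z (u - v)) := by
    have h := hm.comp (measurable_prodMk_left (x := z))
    simpa only [Function.comp_def] using h
  rw [lintegral_mul_const _ hmz, ← add_mul,
    backSurvival_add_lintegral he hr z hsu, one_mul]

end Invariance

/-! ### Invariance of the Gibbs measure by telescoping in the number of jumps -/

section Stationarity

variable {d : ℕ} [NeZero d] {U : PeriodicPotential d} {r e : ℝ}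

/-- The integral of `g` against the intensity, after time `s`, of the jumps of the stationary
process. -/
noncomputable def jumpFlux (U : PeriodicPotential d) (e r s : ℝ) (g : ℝ × State d → ℝ≥0∞) :
    ℝ≥0∞ :=
  ∫⁻ v in Ioi s, ∫⁻ z, ENNReal.ofReal (backRate U e z + r) * g (v, z) ∂gibbsTemp U e

omit [NeZero d] in
theorem lintegral_Ioi_swap {ν : Measure (State d)} [SFinite ν] {H : ℝ → State d → ℝ → ℝ≥0∞}
    (hH : Measurable (fun q : (ℝ × State d) × ℝ => H q.1.1 q.1.2 q.2)) (s : ℝ) :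
    ∫⁻ v in Ioi s, ∫⁻ z, ∫⁻ u in Ioi v, H v z u ∂volume ∂ν =
      ∫⁻ u in Ioi s, ∫⁻ v in Ioo s u, ∫⁻ z, H v z u ∂ν := by
  have hI : Measurable (fun q : ℝ × ℝ => ∫⁻ z, H q.1 z q.2 ∂ν) := by
    refine Measurable.lintegral_prod_right' (f := fun q : (ℝ × ℝ) × State d =>
      H q.1.1 q.2 q.1.2) ?_
    have h := hH.comp (by fun_prop : Measurable fun q : (ℝ × ℝ) × State d => ((q.1.1, q.2), q.1.2))
    simpa only [Function.comp_def] using h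
  have h1 : ∀ v, ∫⁻ z, ∫⁻ u in Ioi v, H v z u ∂volume ∂ν = ∫⁻ u in Ioi v, ∫⁻ z, H v z u ∂ν := fun v => by
    refine lintegral_lintegral_swap (f := fun z u => H v z u) ?_
    have h := hH.comp (by fun_prop : Measurable fun q : State d × ℝ => ((v, q.1), q.2))
    exact h.aemeasurable
  simp only [h1]
  have h2 : ∀ v ∈ Ioi s, ∫⁻ u in Ioi v, ∫⁻ z, H v z u ∂ν = ∫⁻ u in Ioi s,
      {q : ℝ × ℝ | q.1 < q.2}.indicator (fun q => ∫⁻ z, H q.1 z q.2 ∂ν) (v, u) := fun v hv => by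
    rw [← lintegral_indicator measurableSet_Ioi, ← lintegral_indicator measurableSet_Ioi]
    refine lintegral_congr fun u => ?_
    simp only [indicator, mem_Ioi, mem_ofPred_eq]
    by_cases hvu : v < u
    · have : s < u := lt_trans hv hvu
      simp [hvu, this]
    · simp [hvu]
  rw [setLIntegral_congr_fun measurableSet_Ioi h2, lintegral_lintegral_swap]
  · refine lintegral_congr fun u => ?_
    rw [← Ioi_inter_Iio, inter_comm, ← Measure.restrict_restrict measurableSet_Iio,
      ← lintegral_indicator measurableSet_Iio]
    rfl
  · exact (hI.indicator (measurableSet_lt measurable_fst measurable_snd)).aemeasurable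

theorem jumpFlux_eq_jumpOp (he : 0 < e) (hr : 0 < r) {g : ℝ × State d → ℝ≥0∞}
    (hg : Measurable g) (s : ℝ) :
    jumpFlux U e r s g = ∫⁻ u in Ioi s, ∫⁻ z, jumpOp U (.const he) r g u z ∂gibbsTemp U e := by
  simp only [jumpFlux, lintegral_jumpOp_gibbs he hr hg]

/-- A jump after s is either the first one after s or the successor of another jump after s. This is
`lintegral_survival_add` applied to the jump operator at each time u. -/
theorem lintegral_jumpStep_add_jumpFlux (he : 0 < e) (hr : 0 < r) {g : ℝ × State d → ℝ≥0∞}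
    (hg : Measurable g) (s : ℝ) :
    ∫⁻ z, jumpStep U (.const he) r g (s, z) ∂gibbsTemp U e +
      jumpFlux U e r s (jumpStep U (.const he) r g) = jumpFlux U e r s g := by
  have := isProbabilityMeasure_gibbsTemp (U := U) he
  have hbr : Measurable (fun z : State d => ENNReal.ofReal (backRate U e z + r)) :=
    (measurable_backRate.add_const r).ennreal_ofReal
  have hint : Measurable (fun q : (ℝ × State d) × ℝ =>
      survival U (.const he) r q.1 q.2 * jumpOp U (.const he) r g q.2 (flow q.1 q.2)) :=
    (measurable_survival U _ r).mul (measurable_jumpOp_flow hg)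
  have hJ : ∀ u, Measurable (fun z => jumpOp U (.const he) r g u z) := fun u => by
    have h := (measurable_jumpOp (U := U) (ε := .const he) (r := r) hg).comp
      (measurable_prodMk_left (x := u))
    simpa only [Function.comp_def] using h
  have h1 : ∫⁻ z, jumpStep U (.const he) r g (s, z) ∂gibbsTemp U e =
      ∫⁻ u in Ioi s, ∫⁻ z, survival U (.const he) r (s, z) u *
        jumpOp U (.const he) r g u (flow (s, z) u) ∂gibbsTemp U e := by
    refine lintegral_lintegral_swap (μ := gibbsTemp U e) (ν := volume.restrict (Ioi s))
      (f := fun z u => survival U (.const he) r (s, z) u *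
        jumpOp U (.const he) r g u (flow (s, z) u)) ?_
    have h := hint.comp (by fun_prop : Measurable fun q : State d × ℝ => ((s, q.1), q.2))
    exact h.aemeasurable
  have h2 : jumpFlux U e r s (jumpStep U (.const he) r g) =
      ∫⁻ u in Ioi s, ∫⁻ v in Ioo s u, ∫⁻ z, ENNReal.ofReal (backRate U e z + r) *
        (survival U (.const he) r (v, z) u *
          jumpOp U (.const he) r g u (flow (v, z) u)) ∂gibbsTemp U e := by
    rw [← lintegral_Ioi_swap (ν := gibbsTemp U e) (H := fun v z u =>
      ENNReal.ofReal (backRate U e z + r) * (survival U (.const he) r (v, z) u *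
          jumpOp U (.const he) r g u (flow (v, z) u)))
      (by exact (hbr.comp measurable_fst.snd).mul hint)]
    simp only [jumpFlux, jumpStep]
    refine lintegral_congr fun v => lintegral_congr fun z => ?_
    rw [lintegral_const_mul]
    have h := hint.comp (measurable_prodMk_left (x := (v, z)))
    simpa only [Function.comp_def] using h
  have h3 : Measurable (fun u => ∫⁻ z, survival U (.const he) r (s, z) u *
        jumpOp U (.const he) r g u (flow (s, z) u) ∂gibbsTemp U e) := by
    refine Measurable.lintegral_prod_right' (f := fun q : ℝ × State d =>
      survival U (.const he) r (s, q.2) q.1 * jumpOp U (.const he) r g q.1 (flow (s, q.2) q.1)) ?_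
    have h := hint.comp (by fun_prop : Measurable fun q : ℝ × State d => ((s, q.2), q.1))
    simpa only [Function.comp_def] using h
  rw [h1, h2, ← lintegral_add_left h3, jumpFlux_eq_jumpOp he hr hg]
  refine setLIntegral_congr_fun measurableSet_Ioi fun u hu => ?_
  exact lintegral_survival_add he hr (hJ u) (le_of_lt hu)

theorem lintegral_noJump_add_jumpFlux (he : 0 < e) (hr : 0 < r) {f : State d → ℝ≥0∞}
    (hf : Measurable f) {s t : ℝ} (hst : s ≤ t) :
    ∫⁻ z, noJump U (.const he) r t f (s, z) ∂gibbsTemp U e +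
      jumpFlux U e r s (noJump U (.const he) r t f) = ∫⁻ z, f z ∂gibbsTemp U e := by
  rw [← lintegral_survival_add (U := U) he hr hf hst]
  congr 1
  · refine lintegral_congr fun z => ?_
    exact indicator_of_mem (show s ∈ Iic t from hst) (fun _ : ℝ => _)
  · rw [setLIntegral_congr Ioo_ae_eq_Ioc, ← Ioi_inter_Iic, inter_comm,
      ← Measure.restrict_restrict measurableSet_Iic, ← lintegral_indicator measurableSet_Iic,
      jumpFlux]
    refine lintegral_congr fun v => ?_
    simp only [noJump, indicator, mem_Iic]
    split_ifs <;> simp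

theorem tendsto_jumpFlux_iterate (he : 0 < e) (hr : 0 < r) {f : State d → ℝ≥0∞}
    (hf1 : f ≤ 1) (s t : ℝ) :
    Filter.Tendsto (fun N => jumpFlux U e r s
      ((jumpStep U (.const he) r)^[N] (noJump U (.const he) r t f))) Filter.atTop (nhds 0) := by
  have := isProbabilityMeasure_gibbsTemp (U := U) he
  obtain ⟨G, hG⟩ := exists_norm_grad_le U
  have hG0 : 0 ≤ G := (norm_nonneg _).trans (hG 0)
  set L := G / e + r with hL
  have hL0 : 0 < L := by positivity
  have h4 : noJump U (.const he) r t f ≤ fun p => ENNReal.ofReal (Real.exp (2 * L * t)) *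
      ENNReal.ofReal (Real.exp (-(2 * L * p.1))) := fun q => by
    simp only [noJump, indicator, mem_Iic]
    split_ifs with h
    · calc survival U (.const he) r q t * f (flow q t) ≤ 1 * 1 :=
            mul_le_mul' (survival_le_one hr q h) (hf1 _)
        _ ≤ _ := by
            rw [one_mul, ← ENNReal.ofReal_mul (Real.exp_pos _).le, ← Real.exp_add,
              ENNReal.one_le_ofReal, Real.one_le_exp_iff]
            have := mul_le_mul_of_nonneg_left h hL0.le
            linarith
    · exact zero_le
  set C := ENNReal.ofReal (Real.exp (2 * L * t)) * ENNReal.ofReal (Real.exp (-(2 * L * s)))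
  have h5 : ∀ N, jumpFlux U e r s
      ((jumpStep U (.const he) r)^[N] (noJump U (.const he) r t f)) ≤ 2⁻¹ ^ N * C := fun N => by
    have h2 := lintegral_exp_scale (show 0 < 2 * L by positivity) s 1
    simp only [Pi.one_apply, mul_one, lintegral_exp_neg_Ioi, neg_zero, Real.exp_zero,
      ENNReal.ofReal_one] at h2
    calc jumpFlux U e r s ((jumpStep U (.const he) r)^[N] (noJump U (.const he) r t f))
        ≤ ∫⁻ v in Ioi s, (2⁻¹ ^ N * C) * (ENNReal.ofReal (Real.exp (-(2 * L * (v - s)))) *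
            ENNReal.ofReal (2 * L)) := by
          refine setLIntegral_mono' measurableSet_Ioi fun v _ => ?_
          calc ∫⁻ z, ENNReal.ofReal (backRate U e z + r) *
                (jumpStep U (.const he) r)^[N] (noJump U (.const he) r t f) (v, z) ∂gibbsTemp U e
              ≤ ∫⁻ _, ENNReal.ofReal (2 * L) * (2⁻¹ ^ N * (ENNReal.ofReal (Real.exp (2 * L * t)) *
                  ENNReal.ofReal (Real.exp (-(2 * L * v))))) ∂gibbsTemp U e := by
                refine lintegral_mono fun z => mul_le_mul' ?_ ?_
                · refine ENNReal.ofReal_le_ofReal ?_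
                  have h6 : backRate U e z ≤ G / e := by
                    rw [backRate]
                    gcongr
                    refine max_le ?_ hG0
                    rw [← inner_neg_left]
                    refine (real_inner_le_norm _ _).trans ?_
                    rw [norm_neg]
                    have : ‖(z.2 : EuclideanSpace ℝ (Fin d))‖ = 1 := by simp
                    rw [this, one_mul]
                    exact hG _
                  linarith
                · refine (iterate_jumpStep_mono h4 N (v, z)).trans ?_
                  rw [iterate_jumpStep_const_mul ENNReal.ofReal_ne_top, mul_left_comm]
                  exact mul_le_mul' le_rfl (iterate_jumpStep_exp_le he hr hG N (v, z))
            _ = _ := by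
                have : Real.exp (-(2 * L * v)) = Real.exp (-(2 * L * s)) *
                    Real.exp (-(2 * L * (v - s))) := by
                  rw [← Real.exp_add]
                  ring_nf
                rw [lintegral_const, measure_univ, mul_one, this,
                  ENNReal.ofReal_mul (Real.exp_pos (-(2 * L * s))).le]
                ring
      _ = 2⁻¹ ^ N * C := by
          rw [lintegral_const_mul _ (by fun_prop), ← h2, mul_one]
  refine tendsto_of_tendsto_of_tendsto_of_le_of_le tendsto_const_nhds ?_ (fun _ => zero_le) h5
  have h6 : Filter.Tendsto (fun N : ℕ => (2⁻¹ : ℝ≥0∞) ^ N) Filter.atTop (nhds 0) :=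
    ENNReal.tendsto_pow_atTop_nhds_zero_of_lt_one (by simp)
  have h7 := ENNReal.Tendsto.mul_const (b := C) h6
    (Or.inr (ENNReal.mul_ne_top ENNReal.ofReal_ne_top ENNReal.ofReal_ne_top))
  simpa using h7

/-- The Gibbs measure is invariant for the process at constant temperature. -/
theorem lintegral_process_gibbs (he : 0 < e) (hr : 0 < r) {f : State d → ℝ≥0∞}
    (hf : Measurable f) (hf1 : f ≤ 1) {s t : ℝ} (hst : s ≤ t) :
    ∫⁻ z, ∫⁻ ξ, f (process U (.const he) r s t z ξ) ∂noise d ∂gibbsTemp U e =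
      ∫⁻ z, f z ∂gibbsTemp U e := by
  have := isProbabilityMeasure_gibbsTemp (U := U) he
  set κ := jumpStep U (.const he) r
  set h := noJump U (.const he) r t f with hh
  have hm : Measurable h := measurable_noJump hf
  have hmn : ∀ n, Measurable (κ^[n] h) := measurable_jumpStep_iterate hm
  simp only [lintegral_process_const he hr hf hf1 hst]
  have hmz : ∀ n, Measurable (fun z => κ^[n] h (s, z)) := fun n => by
    have h := (hmn n).comp (measurable_prodMk_left (x := s))
    simpa only [Function.comp_def] using h
  refine (lintegral_tsum fun n => (hmz n).aemeasurable).trans ?_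
  -- The flux of κ^N h accounts for all terms of order greater than N; it is dominated by a multiple
  -- of 2^{-N}.
  have h1 : ∀ N, ∑ n ∈ Finset.range (N + 1), ∫⁻ z, κ^[n] h (s, z) ∂gibbsTemp U e +
      jumpFlux U e r s (κ^[N] h) = ∫⁻ z, f z ∂gibbsTemp U e := by
    intro N
    induction N with
    | zero => simpa using lintegral_noJump_add_jumpFlux he hr hf hst
    | succ N ih =>
      rw [← ih, Finset.sum_range_succ _ (N + 1), add_assoc,
        ← lintegral_jumpStep_add_jumpFlux he hr (hmn N)]
      simp only [Function.iterate_succ_apply']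
      rfl
  have h2 := ((ENNReal.tendsto_nat_tsum fun n => ∫⁻ z, κ^[n] h (s, z) ∂gibbsTemp U e).comp
    (Filter.tendsto_add_atTop_nat 1)).add (tendsto_jumpFlux_iterate (U := U) he hr hf1 s t)
  simp only [Function.comp_def] at h2
  rw [add_zero] at h2
  refine tendsto_nhds_unique h2 ?_
  exact tendsto_const_nhds.congr fun N => (h1 N).symm

end Stationarity

/-! ### Two successive moves dominate Lebesgue measure on a ball -/

section Straightening

variable {d : ℕ}

/-- Volume is a multiple of the d-dimensional Hausdorff measure, for which the bound is immediate.
The normalising constant appears on both sides. -/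
theorem volume_image_le_of_lipschitz {K : ℝ≥0}
    {f : EuclideanSpace ℝ (Fin d) → EuclideanSpace ℝ (Fin d)} (hf : LipschitzWith K f)
    (s : Set (EuclideanSpace ℝ (Fin d))) :
    volume (f '' s) ≤ (K : ℝ≥0∞) ^ d * volume s := by
  have h := hf.hausdorffMeasure_image_le (d := (d : ℝ)) (Nat.cast_nonneg _) s
  rw [← EuclideanSpace.euclideanHausdorffMeasure_eq_volume, Measure.euclideanHausdorffMeasure_def,
    Measure.smul_apply, Measure.smul_apply, mul_smul_comm]
  gcongr
  simpa using h

/-- Integration in polar coordinates. -/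
theorem lintegral_polar [NeZero d] {F : EuclideanSpace ℝ (Fin d) → ℝ≥0∞} (hF : Measurable F) :
    ∫⁻ v, F v = ∫⁻ y : Sph d, ∫⁻ w in Ioi (0 : ℝ), ENNReal.ofReal (w ^ (d - 1)) *
      F (w • (y : EuclideanSpace ℝ (Fin d))) ∂volume
      ∂(volume : Measure (EuclideanSpace ℝ (Fin d))).toSphere := by
  have h1 := (volume : Measure (EuclideanSpace ℝ (Fin d))).measurePreserving_homeomorphUnitSphereProd
  rw [finrank_euclideanSpace_fin] at h1
  have hG : Measurable (fun q : Sph d × Ioi (0 : ℝ) =>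
      F ((q.2 : ℝ) • (q.1 : EuclideanSpace ℝ (Fin d)))) := hF.comp (by fun_prop)
  have h2 := h1.lintegral_comp hG
  rw [lintegral_prod _ hG.aemeasurable] at h2
  have h3 : ∀ v : ({0}ᶜ : Set (EuclideanSpace ℝ (Fin d))),
      F (((homeomorphUnitSphereProd _ v).2 : ℝ) •
        ((homeomorphUnitSphereProd _ v).1 : EuclideanSpace ℝ (Fin d))) = F v := fun v => by
    have hv : ‖(v : EuclideanSpace ℝ (Fin d))‖ ≠ 0 := norm_ne_zero_iff.2 v.2
    rw [homeomorphUnitSphereProd_apply_snd_coe, homeomorphUnitSphereProd_apply_fst_coe, smul_smul,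
      mul_inv_cancel₀ hv, one_smul]
  simp only [h3] at h2
  rw [lintegral_subtype_comap (measurableSet_singleton _).compl F, restrict_compl_singleton] at h2
  rw [h2]
  refine lintegral_congr fun y => ?_
  have hFy : Measurable (fun w : ℝ => F (w • (y : EuclideanSpace ℝ (Fin d)))) :=
    hF.comp (by fun_prop)
  rw [Measure.volumeIoiPow]
  refine (lintegral_withDensity_eq_lintegral_mul _ (by fun_prop)
    (hFy.comp measurable_subtype_coe)).trans ?_
  exact lintegral_subtype_comap measurableSet_Ioi
    (fun w => ENNReal.ofReal (w ^ (d - 1)) * F (w • (y : EuclideanSpace ℝ (Fin d))))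

/-- For v = w y this is the endpoint of a move of length w along y followed by one of length σ - w
along b. The Lipschitz bound replaces the Jacobian 1 - y·b: only an upper bound on the expansion is
used, so its degeneracy at y = b does no harm. -/
theorem lipschitzWith_bend (σ : ℝ) (b : Sph d) :
    LipschitzWith 2 (fun v : EuclideanSpace ℝ (Fin d) =>
      v + (σ - ‖v‖) • (b : EuclideanSpace ℝ (Fin d))) := by
  refine LipschitzWith.of_dist_le_mul fun v w => ?_
  have hb : ‖(b : EuclideanSpace ℝ (Fin d))‖ = 1 := by simp
  have h : v + (σ - ‖v‖) • (b : EuclideanSpace ℝ (Fin d)) -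
      (w + (σ - ‖w‖) • (b : EuclideanSpace ℝ (Fin d))) =
      (v - w) + (‖w‖ - ‖v‖) • (b : EuclideanSpace ℝ (Fin d)) := by module
  rw [dist_eq_norm, dist_eq_norm, h]
  refine (norm_add_le _ _).trans ?_
  rw [norm_smul, hb, mul_one, Real.norm_eq_abs, NNReal.coe_ofNat]
  have h2 := abs_norm_sub_norm_le w v
  rw [norm_sub_rev] at h2
  linarith

/-- A point q is reached if some u in [0, σ] satisfies |q - (σ - u) b| = u. The difference u - |q -
(σ - u) b| is at most 0 at u = 0 and equals σ - |q| ≥ 0 at u = σ, so the intermediate value theorem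
applies. Injectivity is not needed. -/
theorem closedBall_subset_image_bend (σ : ℝ) (b : Sph d) :
    Metric.closedBall (0 : EuclideanSpace ℝ (Fin d)) σ ⊆
      (fun v : EuclideanSpace ℝ (Fin d) => v + (σ - ‖v‖) • (b : EuclideanSpace ℝ (Fin d))) ''
        Metric.closedBall 0 σ := by
  intro q hq
  rw [mem_closedBall_zero_iff] at hq
  have hσ : 0 ≤ σ := (norm_nonneg q).trans hq
  have hc : Continuous (fun u : ℝ => u - ‖q - (σ - u) • (b : EuclideanSpace ℝ (Fin d))‖) := by
    fun_prop
  obtain ⟨u, hu, hu0⟩ := intermediate_value_Icc hσ hc.continuousOn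
    (show (0 : ℝ) ∈ Icc _ _ from ⟨by simp, by simpa using hq⟩)
  have hu1 : ‖q - (σ - u) • (b : EuclideanSpace ℝ (Fin d))‖ = u := by
    have : u - ‖q - (σ - u) • (b : EuclideanSpace ℝ (Fin d))‖ = 0 := hu0
    linarith
  refine ⟨q - (σ - u) • (b : EuclideanSpace ℝ (Fin d)), ?_, ?_⟩
  · rw [mem_closedBall_zero_iff, hu1]
    exact hu.2
  · simp only [hu1]
    abel

theorem lintegral_closedBall_le_bend {F : EuclideanSpace ℝ (Fin d) → ℝ≥0∞} (hF : Measurable F)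
    (σ : ℝ) (b : Sph d) :
    ∫⁻ v in Metric.closedBall 0 σ, F v ≤ 2 ^ d * ∫⁻ v in Metric.closedBall 0 σ,
      F (v + (σ - ‖v‖) • (b : EuclideanSpace ℝ (Fin d))) := by
  set Ψ := fun v : EuclideanSpace ℝ (Fin d) => v + (σ - ‖v‖) • (b : EuclideanSpace ℝ (Fin d))
  have hΨ : Measurable Ψ := (lipschitzWith_bend σ b).continuous.measurable
  have h : volume.restrict (Metric.closedBall 0 σ) ≤
      (2 : ℝ≥0∞) ^ d • (volume.restrict (Metric.closedBall 0 σ)).map Ψ := by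
    refine Measure.le_iff.2 fun B hB => ?_
    rw [Measure.smul_apply, Measure.map_apply hΨ hB, Measure.restrict_apply hB,
      Measure.restrict_apply (hΨ hB), smul_eq_mul]
    refine (measure_mono ?_).trans (volume_image_le_of_lipschitz (lipschitzWith_bend σ b) _)
    rintro q ⟨hq, hq'⟩
    obtain ⟨v, hv, rfl⟩ := closedBall_subset_image_bend σ b hq'
    exact ⟨v, ⟨hq, hv⟩, rfl⟩
  refine (lintegral_mono' h le_rfl).trans ?_
  rw [lintegral_smul_measure, lintegral_map hF hΨ, smul_eq_mul]

/-- The constant of comparison between the Lebesgue measure and the law of the position after two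
moves of total length at most `h`. -/
noncomputable def bendConst (d : ℕ) (h : ℝ) : ℝ≥0∞ :=
  2 ^ d * (ENNReal.ofReal (h ^ (d - 1)) *
    (volume : Measure (EuclideanSpace ℝ (Fin d))).toSphere univ)

theorem bendConst_ne_top (d : ℕ) (h : ℝ) : bendConst d h ≠ ⊤ :=
  ENNReal.mul_ne_top (by finiteness) (by finiteness)

/-- In polar coordinates dv has the density w^{d-1} ≤ h^{d-1} with respect to dw dy, the law of a
uniform direction and a length. Only this direction of the inequality is needed, so small w cause no
trouble. -/
theorem lintegral_closedBall_le_refresh [NeZero d] {F : EuclideanSpace ℝ (Fin d) → ℝ≥0∞}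
    (hF : Measurable F) {σ h : ℝ} (hσ : σ ≤ h) (b : Sph d) :
    ∫⁻ v in Metric.closedBall 0 σ, F v ≤ bendConst d h * ∫⁻ y, ∫⁻ w in Ioc 0 σ,
      F (w • (y : EuclideanSpace ℝ (Fin d)) + (σ - w) • (b : EuclideanSpace ℝ (Fin d))) ∂volume
        ∂unifSph d := by
  refine (lintegral_closedBall_le_bend hF σ b).trans ?_
  rw [bendConst, mul_assoc]
  gcongr
  have h0 : (volume : Measure (EuclideanSpace ℝ (Fin d))).toSphere univ ≠ 0 := by
    rw [Measure.measure_univ_ne_zero]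
    exact Measure.toSphere_ne_zero _
  rw [unifSph, lintegral_smul_measure, smul_eq_mul, mul_assoc, ← mul_assoc _ (_⁻¹),
    ENNReal.mul_inv_cancel h0 (measure_ne_top _ _), one_mul,
    ← lintegral_indicator measurableSet_closedBall]
  have hm : Measurable (fun v : EuclideanSpace ℝ (Fin d) =>
      F (v + (σ - ‖v‖) • (b : EuclideanSpace ℝ (Fin d)))) := hF.comp (by fun_prop)
  rw [lintegral_polar (hm.indicator measurableSet_closedBall),
    ← lintegral_const_mul' _ _ ENNReal.ofReal_ne_top]
  refine lintegral_mono fun y => ?_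
  rw [← lintegral_const_mul' _ _ ENNReal.ofReal_ne_top,
    ← lintegral_indicator measurableSet_Ioi, ← lintegral_indicator measurableSet_Ioc]
  refine lintegral_mono fun w => ?_
  by_cases hw : 0 < w
  · have hn : ‖w • (y : EuclideanSpace ℝ (Fin d))‖ = w := by
      rw [norm_smul, Real.norm_of_nonneg hw.le]; simp
    rw [indicator_of_mem (show w ∈ Ioi 0 from hw)]
    by_cases hw' : w ≤ σ
    · rw [indicator_of_mem (show w ∈ Ioc 0 σ from ⟨hw, hw'⟩), indicator_of_mem
        (by rwa [mem_closedBall_zero_iff, hn]), hn]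
      gcongr
      exact hw'.trans hσ
    · rw [indicator_of_notMem (by rwa [mem_closedBall_zero_iff, hn])]
      simp
  · rw [indicator_of_notMem (s := Ioi 0) (by exact hw)]
    exact zero_le

theorem lintegral_torus_le_refresh [NeZero d] {f : UnitAddTorus (Fin d) → ℝ≥0∞}
    (hf : Measurable f) {σ h : ℝ} (hσ : σ ≤ h) (hd : √d / 2 ≤ σ) (x : UnitAddTorus (Fin d))
    (b : Sph d) :
    ∫⁻ w, f w ≤ bendConst d h * ∫⁻ y, ∫⁻ w in Ioc 0 σ,
      f (move (move x y w) b (σ - w)) ∂volume ∂unifSph d := by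
  have hm : Measurable (fun v => f (x + proj v)) :=
    hf.comp ((measurable_const_add x).comp measurable_proj)
  have h1 := lintegral_closedBall_le_refresh hm hσ b
  simp only [move_eq_add, add_assoc, ← proj_add]
  refine le_trans ?_ h1
  rw [lintegral_torus_eq hf x]
  refine lintegral_mono_set fun v hv => ?_
  rw [mem_closedBall_zero_iff]
  refine le_trans ?_ hd
  rw [EuclideanSpace.norm_eq]
  have h2 : ∑ i, ‖v i‖ ^ 2 ≤ d * (1 / 4) := by
    refine (Finset.sum_le_card_nsmul _ _ (1 / 4) fun i _ => ?_).trans (by simp)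
    rw [Real.norm_eq_abs, sq_abs]
    have := hv i
    nlinarith [this.1, this.2]
  refine (Real.sqrt_le_sqrt h2).trans ?_
  rw [Real.sqrt_mul (Nat.cast_nonneg _), show (1 / 4 : ℝ) = (1 / 2) ^ 2 by norm_num,
    Real.sqrt_sq (by norm_num)]
  exact le_of_eq (by ring)

end Straightening

/-! ### The Doeblin condition at constant temperature -/

section Minorization

variable {d : ℕ} [NeZero d] {U : PeriodicPotential d} {r e G : ℝ}

omit [NeZero d] in
theorem survival_const_ge (hG : ∀ x, ‖grad U x‖ ≤ G) (he : 0 < e) (hr : 0 < r) {h : ℝ}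
    (p : ℝ × State d) {u : ℝ} (hu : p.1 ≤ u) (hh : u - p.1 ≤ h) :
    ENNReal.ofReal (Real.exp (-((G / e + r) * h))) ≤ survival U (.const he) r p u := by
  have hG0 : 0 ≤ G := (norm_nonneg _).trans (hG p.2.1)
  have h1 : cumRate U (.const he) p u ≤ G / e * (u - p.1) := by
    have h2 := intervalIntegral.integral_mono_on (μ := volume) hu
      (intervalIntegrable_rate U (.const he) p p.1 u) (intervalIntegrable_const (c := G / e))
      fun v _ => by
        rw [rate_const]
        gcongr
        exact inner_le_of_norm_grad_le hG _
    rw [intervalIntegral.integral_const, smul_eq_mul, mul_comm] at h2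
    exact h2
  unfold survival
  gcongr
  have h3 : (G / e + r) * (u - p.1) ≤ (G / e + r) * h := by gcongr
  linarith

/-- The process at constant temperature forgets its initial state after a time `√d`. -/
theorem lintegral_process_const_ge (hG : ∀ x, ‖grad U x‖ ≤ G) (he : 0 < e) (hr : 0 < r)
    {f : State d → ℝ≥0∞} (hf : Measurable f) (s : ℝ) (z : State d) :
    ENNReal.ofReal (Real.exp (-((G / e + r) * √d))) ^ 3 * (ENNReal.ofReal r ^ 2 *
      ENNReal.ofReal (√d / 2)) * (∫⁻ y, ∫⁻ x, f (x, y) ∂volume ∂unifSph d) ≤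
      bendConst d √d * ∫⁻ ξ, f (process U (.const he) r s (s + √d) z ξ) ∂noise d := by
  set h : ℝ := √d with hh
  have hh0 : 0 ≤ h := Real.sqrt_nonneg _
  set t := s + h with ht
  set S := ENNReal.ofReal (Real.exp (-((G / e + r) * h)))
  set κ := jumpStep U (.const he) r with hκ
  set g := noJump U (.const he) r t f with hg
  set m := ∫⁻ y, ∫⁻ x, f (x, y) ∂volume ∂unifSph d with hm
  have hST : S ≠ ⊤ := ENNReal.ofReal_ne_top
  have h0 : ∀ (u : ℝ) (x : UnitAddTorus (Fin d)) (y : Sph d), s ≤ u → u ≤ t →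
      S * f (move x y (t - u), y) ≤ g (u, (x, y)) := by
    intro u x y hsu hut
    rw [hg, noJump, indicator_of_mem (show u ∈ Iic t from hut)]
    gcongr
    · exact survival_const_ge hG he hr (u, (x, y)) hut (by linarith)
    · rfl
  have hmm : ∀ (x₁ : UnitAddTorus (Fin d)) (u₁ : ℝ), Measurable
      (fun q : (Sph d × ℝ) × Sph d => f (move (move x₁ q.1.1 (q.1.2 - u₁)) q.2 (t - q.1.2), q.2)) := by
    intro x₁ u₁
    have h1 : Measurable (fun q : (Sph d × ℝ) × Sph d => move x₁ q.1.1 (q.1.2 - u₁)) := by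
      have h := (measurable_move (d := d)).comp
        (by fun_prop : Measurable fun q : (Sph d × ℝ) × Sph d => ((x₁, q.1.1), q.1.2 - u₁))
      simpa only [Function.comp_def] using h
    have h2 := (measurable_move (d := d)).comp
      ((h1.prodMk measurable_snd).prodMk (by fun_prop : Measurable fun q : (Sph d × ℝ) × Sph d =>
        t - q.1.2))
    have h3 := hf.comp (h2.prodMk measurable_snd)
    simpa only [Function.comp_def] using h3
  -- Second refreshment, at time u, after which the velocity y is kept until t. Each survival costs
  -- a factor S: one between the refreshments, one after the second.
  have h1 : ∀ (u₁ : ℝ) (x₁ : UnitAddTorus (Fin d)) (y₁ : Sph d), s ≤ u₁ →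
      S ^ 2 * ENNReal.ofReal r * ∫⁻ u in Ioc u₁ t, ∫⁻ y,
        f (move (move x₁ y₁ (u - u₁)) y (t - u), y) ∂unifSph d ≤ κ g (u₁, (x₁, y₁)) := by
    intro u₁ x₁ y₁ hs
    rw [← lintegral_const_mul' _ _ (by finiteness), hκ, jumpStep]
    refine le_trans ?_ (lintegral_mono_set (Ioc_subset_Ioi_self (a := t)))
    refine setLIntegral_mono' measurableSet_Ioc fun u hu => ?_
    have h2 : S ≤ survival U (.const he) r (u₁, (x₁, y₁)) u :=
      survival_const_ge hG he hr (u₁, (x₁, y₁)) hu.1.le (by simp only; linarith [hu.2])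
    rw [sq, mul_assoc, mul_assoc]
    refine mul_le_mul' h2 (le_trans ?_ le_add_self)
    rw [mul_left_comm, ← lintegral_const_mul' _ _ hST]
    gcongr with y
    exact h0 u _ y (hs.trans hu.1.le) hu.2
  -- The first refreshment falls in the first half of the interval, so σ = t - u₁ lies between √d/2
  -- and √d. The straightening is applied for each final velocity y; integrating over y gives the
  -- product measure.
  have h2 : ∀ (u₁ : ℝ) (x₁ : UnitAddTorus (Fin d)), u₁ ∈ Ioc s (s + h / 2) →
      S ^ 2 * ENNReal.ofReal r * m ≤ bendConst d h * ∫⁻ y₁, κ g (u₁, (x₁, y₁)) ∂unifSph d := by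
    intro u₁ x₁ hu
    have h3 : m ≤ bendConst d h * ∫⁻ y₁, ∫⁻ u in Ioc u₁ t, ∫⁻ y,
        f (move (move x₁ y₁ (u - u₁)) y (t - u), y) ∂unifSph d ∂volume ∂unifSph d := by
      have h4 : ∀ y, ∫⁻ x, f (x, y) ≤ bendConst d h * ∫⁻ y₁, ∫⁻ u in Ioc u₁ t,
          f (move (move x₁ y₁ (u - u₁)) y (t - u), y) ∂volume ∂unifSph d := by
        intro y
        have hfy : Measurable (fun x => f (x, y)) := by
          have h := hf.comp (measurable_prodMk_right (y := y))
          simpa only [Function.comp_def] using h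
        refine (lintegral_torus_le_refresh hfy (σ := t - u₁) (h := h) (by linarith [hu.1])
          (by linarith [hu.2]) x₁ y).trans ?_
        refine mul_le_mul_right (lintegral_mono fun y₁ => le_of_eq ?_) _
        have h5 := (measurePreserving_sub_right volume u₁).setLIntegral_comp_preimage_emb
          (MeasurableEquiv.subRight u₁).measurableEmbedding
          (fun w => f (move (move x₁ y₁ w) y (t - u₁ - w), y)) (Ioc 0 (t - u₁))
        rw [preimage_sub_const_Ioc, zero_add, sub_add_cancel] at h5
        rw [← h5]
        refine lintegral_congr fun u => ?_
        rw [show t - u₁ - (u - u₁) = t - u by ring]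
      refine (lintegral_mono h4).trans ?_
      rw [lintegral_const_mul' _ _ (bendConst_ne_top d h)]
      refine mul_le_mul_right (le_of_eq ?_) _
      have hH := hmm x₁ u₁
      have h6 : ∀ y, ∫⁻ y₁, ∫⁻ u in Ioc u₁ t, f (move (move x₁ y₁ (u - u₁)) y (t - u), y)
          ∂volume ∂unifSph d = ∫⁻ q, f (move (move x₁ q.1 (q.2 - u₁)) y (t - q.2), y)
            ∂(unifSph d).prod (volume.restrict (Ioc u₁ t)) := fun y => by
        have h7 := hH.comp (measurable_prodMk_right (y := y))
        exact lintegral_lintegral (f := fun y₁ u =>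
          f (move (move x₁ y₁ (u - u₁)) y (t - u), y)) h7.aemeasurable
      simp only [h6]
      have h8 := lintegral_lintegral_swap (μ := unifSph d)
        (ν := (unifSph d).prod (volume.restrict (Ioc u₁ t)))
        (f := fun y q => f (move (move x₁ q.1 (q.2 - u₁)) y (t - q.2), y))
        (hH.comp measurable_swap).aemeasurable
      rw [h8]
      exact lintegral_prod _ (hH.lintegral_prod_right').aemeasurable
    calc S ^ 2 * ENNReal.ofReal r * m
        ≤ S ^ 2 * ENNReal.ofReal r * (bendConst d h * ∫⁻ y₁, ∫⁻ u in Ioc u₁ t, ∫⁻ y,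
          f (move (move x₁ y₁ (u - u₁)) y (t - u), y) ∂unifSph d ∂volume ∂unifSph d) := by gcongr
      _ = bendConst d h * ∫⁻ y₁, S ^ 2 * ENNReal.ofReal r * ∫⁻ u in Ioc u₁ t, ∫⁻ y,
          f (move (move x₁ y₁ (u - u₁)) y (t - u), y) ∂unifSph d ∂volume ∂unifSph d := by
        rw [lintegral_const_mul' _ _ (by finiteness), mul_left_comm]
      _ ≤ _ := by
        gcongr with y₁
        exact h1 u₁ x₁ y₁ hu.1.le
  have h3 : S * ENNReal.ofReal r * (∫⁻ u in Ioc s (s + h / 2),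
      ∫⁻ y₁, κ g (u, (move z.1 z.2 (u - s), y₁)) ∂unifSph d) ≤ κ (κ g) (s, z) := by
    rw [← lintegral_const_mul' _ _ (by finiteness)]
    nth_rw 2 [hκ]
    rw [jumpStep]
    refine le_trans ?_ (lintegral_mono_set (Ioc_subset_Ioi_self (a := s + h / 2)))
    refine setLIntegral_mono' measurableSet_Ioc fun u hu => ?_
    have h4 : S ≤ survival U (.const he) r (s, z) u :=
      survival_const_ge hG he hr (s, z) hu.1.le (by simp only; linarith [hu.2])
    rw [mul_assoc]
    exact mul_le_mul' h4 le_add_self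
  -- The two-jump term of the expansion alone suffices.
  have h4 : κ (κ g) (s, z) ≤ ∫⁻ ξ, f (process U (.const he) r s t z ξ) ∂noise d :=
    (ENNReal.le_tsum (f := fun n => κ^[n] g (s, z)) 2).trans
      (tsum_le_lintegral_process hr hf s t z)
  refine le_trans ?_ (mul_le_mul_right (h3.trans h4) _)
  calc S ^ 3 * (ENNReal.ofReal r ^ 2 * ENNReal.ofReal (h / 2)) * m
      = S * ENNReal.ofReal r * ∫⁻ _ in Ioc s (s + h / 2), S ^ 2 * ENNReal.ofReal r * m := by
        rw [setLIntegral_const, Real.volume_Ioc, add_sub_cancel_left]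
        ring
    _ ≤ S * ENNReal.ofReal r * ∫⁻ u in Ioc s (s + h / 2), bendConst d h *
        ∫⁻ y₁, κ g (u, (move z.1 z.2 (u - s), y₁)) ∂unifSph d := by
      refine mul_le_mul_right ?_ _
      exact setLIntegral_mono' measurableSet_Ioc fun u hu => h2 u _ hu
    _ = _ := by
      rw [lintegral_const_mul' _ _ (bendConst_ne_top d h), mul_left_comm]

end Minorization

/-! ### Couplings and common lower bounds -/

/-- The total variation distance is at most one minus the mass of a common lower bound. -/
theorem tvDist_le_of_le {E : Type*} [MeasurableSpace E] [MeasurableEq E] {μ₁ μ₂ β : Measure E}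
    [IsProbabilityMeasure μ₁] [IsProbabilityMeasure μ₂] (h₁ : β ≤ μ₁) (h₂ : β ≤ μ₂) :
    tvDist μ₁ μ₂ ≤ 1 - β.real univ := by
  have hβ : IsFiniteMeasure β := isFiniteMeasure_of_le μ₁ h₁
  have hb : β univ ≤ 1 := (h₁ univ).trans_eq measure_univ
  set m := 1 - β univ with hm
  have hmt : m ≠ ⊤ := by finiteness
  have hm₁ : (μ₁ - β) univ = m := by rw [Measure.sub_apply .univ h₁, measure_univ]
  have hm₂ : (μ₂ - β) univ = m := by rw [Measure.sub_apply .univ h₂, measure_univ]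
  have hf₁ : IsFiniteMeasure (μ₁ - β) := ⟨by rw [hm₁]; exact hmt.lt_top⟩
  have hf₂ : IsFiniteMeasure (μ₂ - β) := ⟨by rw [hm₂]; exact hmt.lt_top⟩
  have hδ : Measurable (fun x : E => (x, x)) := measurable_id.prodMk measurable_id
  -- If m = 0 the factor is ⊤ * 0 = 0, but then ρ = 0 as well, so the case β = μ₁ = μ₂ is covered.
  have hs : ∀ ρ : Measure E, ρ univ = m → (m⁻¹ * m) • ρ = ρ := fun ρ hρ => by
    by_cases h0 : m = 0
    · rw [h0, Measure.measure_univ_eq_zero] at hρ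
      rw [hρ, smul_zero]
    · rw [ENNReal.inv_mul_cancel h0 hmt, one_smul]
  -- β is put on the diagonal; the two remainders, both of mass m, are coupled independently.
  set π := β.map (fun x => (x, x)) + m⁻¹ • (μ₁ - β).prod (μ₂ - β) with hπ
  have hfst : π.map Prod.fst = μ₁ := by
    rw [hπ, Measure.map_add _ _ measurable_fst, Measure.map_map measurable_fst hδ,
      Measure.map_smul, Measure.map_fst_prod, hm₂, smul_smul, hs _ hm₁]
    refine Eq.trans ?_ (Measure.sub_add_cancel_of_le h₁)
    rw [add_comm]
    exact congrArg _ Measure.map_id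
  have hsnd : π.map Prod.snd = μ₂ := by
    rw [hπ, Measure.map_add _ _ measurable_snd, Measure.map_map measurable_snd hδ,
      Measure.map_smul, Measure.map_snd_prod, hm₁, smul_smul, hs _ hm₂]
    refine Eq.trans ?_ (Measure.sub_add_cancel_of_le h₂)
    rw [add_comm]
    exact congrArg _ Measure.map_id
  have hD : MeasurableSet {q : E × E | q.1 ≠ q.2} :=
    (measurableSet_eq_fun measurable_fst measurable_snd).compl
  have hle : π {q | q.1 ≠ q.2} ≤ m := by
    rw [hπ, Measure.add_apply, Measure.map_apply hδ hD, Measure.smul_apply, smul_eq_mul]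
    have h0 : (fun x : E => (x, x)) ⁻¹' {q : E × E | q.1 ≠ q.2} = ∅ := by
      ext x; simp
    rw [h0, measure_empty, zero_add]
    have h1 : ((μ₁ - β).prod (μ₂ - β)) {q | q.1 ≠ q.2} ≤ m * m := by
      refine (measure_mono (subset_univ _)).trans_eq ?_
      rw [← univ_prod_univ, Measure.prod_prod, hm₁, hm₂]
    refine (mul_le_mul_right h1 _).trans ?_
    rw [← mul_assoc]
    exact mul_le_of_le_one_left' (ENNReal.inv_mul_le_one _)
  have hbdd : BddBelow {a : ℝ | ∃ π : Measure (E × E), π.map Prod.fst = μ₁ ∧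
      π.map Prod.snd = μ₂ ∧ a = π.real {q | q.1 ≠ q.2}} := by
    refine ⟨0, ?_⟩
    rintro a ⟨π', -, -, rfl⟩
    exact measureReal_nonneg
  refine (csInf_le hbdd ⟨π, hfst, hsnd, rfl⟩).trans ?_
  refine (ENNReal.toReal_mono hmt hle).trans_eq ?_
  rw [hm, ENNReal.toReal_sub_of_le hb ENNReal.one_ne_top, ENNReal.toReal_one]
  rfl

/-- The part of π on the diagonal has the same two marginals. Working with an arbitrary coupling
avoids the existence of an optimal one; the infimum is taken at the very end. -/
theorem exists_common_part {E : Type*} [MeasurableSpace E] [MeasurableEq E] {μ₁ μ₂ : Measure E}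
    [IsProbabilityMeasure μ₁] {π : Measure (E × E)} (h₁ : π.map Prod.fst = μ₁)
    (h₂ : π.map Prod.snd = μ₂) :
    ∃ α : Measure E, α ≤ μ₁ ∧ α ≤ μ₂ ∧ α univ + π {q | q.1 ≠ q.2} = 1 := by
  have hD : MeasurableSet {q : E × E | q.1 = q.2} :=
    measurableSet_eq_fun measurable_fst measurable_snd
  have h : (π.restrict {q | q.1 = q.2}).map Prod.fst = (π.restrict {q | q.1 = q.2}).map Prod.snd :=
    Measure.map_congr (by filter_upwards [ae_restrict_mem hD] with q hq using hq)
  refine ⟨(π.restrict {q | q.1 = q.2}).map Prod.fst, ?_, ?_, ?_⟩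
  · exact (Measure.map_mono Measure.restrict_le_self measurable_fst).trans_eq h₁
  · exact h ▸ (Measure.map_mono Measure.restrict_le_self measurable_snd).trans_eq h₂
  · rw [Measure.map_apply measurable_fst .univ, preimage_univ, Measure.restrict_apply_univ]
    refine (measure_add_measure_compl hD).trans ?_
    rw [← preimage_univ (f := Prod.fst), ← Measure.map_apply measurable_fst .univ, h₁,
      measure_univ]

/-- The common part α is propagated exactly, while on the remaining mass a only the uniform lower
bound is used. -/
theorem lintegral_add_minorant_le {E : Type*} [MeasurableSpace E] {α ρ : Measure E}
    [IsProbabilityMeasure ρ] (h : α ≤ ρ) {Q : E → ℝ≥0∞} {k : ℝ≥0∞} (hQ : ∀ z, k ≤ Q z)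
    {a : ℝ≥0∞} (ha : α univ + a = 1) :
    ∫⁻ z, Q z ∂α + a * k ≤ ∫⁻ z, Q z ∂ρ := by
  have hα : IsFiniteMeasure α := isFiniteMeasure_of_le ρ h
  have h1 : (ρ - α) univ = a := by
    rw [Measure.sub_apply .univ h, measure_univ, ← ha,
      ENNReal.add_sub_cancel_left (measure_ne_top _ _)]
  conv_rhs => rw [← Measure.sub_add_cancel_of_le h]
  rw [lintegral_add_measure, add_comm]
  gcongr
  rw [← h1, mul_comm, ← lintegral_const]
  exact lintegral_mono hQ

/-! ### The contraction estimate for a given coupling -/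

section Contraction

variable {d : ℕ} [NeZero d] {U : PeriodicPotential d} {r : ℝ}

theorem lawAt_apply (U : PeriodicPotential d) (ε : CoolingSchedule) (r : ℝ) (μ : Measure (State d))
    [SFinite μ] (s t : ℝ≥0) {B : Set (State d)} (hB : MeasurableSet B) :
    lawAt U ε r μ s t B =
      ∫⁻ z, ∫⁻ ξ, B.indicator 1 (process U ε r s t z ξ) ∂noise d ∂μ := by
  have hp := measurable_process U ε r s t
  have h1 : Measurable (B.indicator (1 : State d → ℝ≥0∞)) := measurable_one.indicator hB
  rw [lawAt, ← lintegral_indicator_one hB, lintegral_map h1 hp]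
  exact lintegral_prod _ (h1.comp hp).aemeasurable

theorem exists_minorization (hr : 0 < r) {G : ℝ} (hG : ∀ x, ‖grad U x‖ ≤ G) :
    ∃ c, 0 < c ∧ ∀ (e : ℝ) (he : 0 < e) (s : ℝ) (z : State d) {f : State d → ℝ≥0∞},
      Measurable f → ENNReal.ofReal (c * Real.exp (-(3 * (G * √d) + 1) / e)) *
        ∫⁻ w, f w ∂(volume : Measure (UnitAddTorus (Fin d))).prod (unifSph d) ≤
      ∫⁻ ξ, f (process U (.const he) r s (s + √d) z ξ) ∂noise d := by
  have hd : 0 < √(d : ℝ) := Real.sqrt_pos.2 (Nat.cast_pos.2 (NeZero.pos d))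
  set K := max (bendConst d √d).toReal 1 with hK
  have hK0 : 0 < K := lt_of_lt_of_le one_pos (le_max_right _ _)
  have hKb : bendConst d √d ≤ ENNReal.ofReal K := by
    rw [← ENNReal.ofReal_toReal (bendConst_ne_top d √d)]
    exact ENNReal.ofReal_le_ofReal (le_max_left _ _)
  -- The three survival factors contribute e^{-3r√d} to the constant and e^{-3G√d/e} to the
  -- exponential. The extra 1 in the exponent is slack that keeps θ positive when G = 0.
  refine ⟨Real.exp (-(3 * (r * √d))) * (r ^ 2 * (√d / 2)) / K, by positivity,
    fun e he s z f hf => ?_⟩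
  have h1 := (lintegral_process_const_ge hG he hr hf s z).trans (mul_le_mul_left hKb _)
  have h2 : ∫⁻ w, f w ∂(volume : Measure (UnitAddTorus (Fin d))).prod (unifSph d) =
      ∫⁻ y, ∫⁻ x, f (x, y) ∂volume ∂unifSph d := lintegral_prod_symm' f hf
  rw [h2]
  refine (ENNReal.mul_le_mul_iff_right (ENNReal.ofReal_pos.2 hK0).ne' ENNReal.ofReal_ne_top).1 ?_
  refine le_trans ?_ h1
  rw [← mul_assoc, ← ENNReal.ofReal_mul hK0.le, ← ENNReal.ofReal_pow (Real.exp_pos _).le,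
    ← ENNReal.ofReal_pow hr.le, ← ENNReal.ofReal_mul (by positivity),
    ← ENNReal.ofReal_mul (by positivity)]
  refine mul_le_mul' (ENNReal.ofReal_le_ofReal ?_) le_rfl
  rw [← Real.exp_nat_mul]
  have h3 : Real.exp (-(3 * (r * √d))) * Real.exp (-(3 * (G * √d) + 1) / e) ≤
      Real.exp ((3 : ℕ) * -((G / e + r) * √d)) := by
    rw [← Real.exp_add, Real.exp_le_exp]
    have h4 : (3 : ℕ) * -((G / e + r) * √d) - (-(3 * (r * √d)) + -(3 * (G * √d) + 1) / e) =
        1 / e := by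
      push_cast
      field_simp
      ring
    have : 0 ≤ 1 / e := by positivity
    linarith
  calc _ = (Real.exp (-(3 * (r * √d))) * Real.exp (-(3 * (G * √d) + 1) / e)) *
        (r ^ 2 * (√d / 2)) := by field_simp
    _ ≤ _ := by gcongr

/-- β₀ lies below the frozen evolution of both μ and the Gibbs measure. The first loses a factor
e^{-δ} when the true dynamics replaces the frozen one; the second is the Gibbs measure itself, by
invariance. Thus e^{-δ} β₀ is a common lower bound for the two measures to be compared. -/
theorem tvDist_lawAt_le (hr : 0 < r) {G : ℝ} (hG : ∀ x, ‖grad U x‖ ≤ G) {ε : CoolingSchedule}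
    {t t' : ℝ≥0} (ht : t ≤ t') {k : ℝ} (hk0 : 0 ≤ k)
    (hk : ∀ (z : State d) {f : State d → ℝ≥0∞}, Measurable f → ENNReal.ofReal k *
      ∫⁻ w, f w ∂(volume : Measure (UnitAddTorus (Fin d))).prod (unifSph d) ≤
        ∫⁻ ξ, f (process U (.const (ε.pos t)) r t t' z ξ) ∂noise d)
    {μ : Measure (State d)} [IsProbabilityMeasure μ] {π : Measure (State d × State d)}
    (h₁ : π.map Prod.fst = μ) (h₂ : π.map Prod.snd = gibbs U ε t) :
    tvDist (lawAt U ε r μ t t') (gibbs U ε t) ≤ (1 - k) * π.real {q | q.1 ≠ q.2} +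
      G * (1 / ε.temp t' - 1 / ε.temp t) * (t' - t) := by
  have hν : IsProbabilityMeasure (gibbs U ε t) := isProbabilityMeasure_gibbsTemp (ε.pos t)
  obtain ⟨α, hα₁, hα₂, hα⟩ := exists_common_part h₁ h₂
  have hαf : IsFiniteMeasure α := isFiniteMeasure_of_le μ hα₁
  set a := π {q | q.1 ≠ q.2} with ha
  set δ := G * (1 / ε.temp t' - 1 / ε.temp t) * (t' - t) with hδ
  have hδ0 : 0 ≤ δ := by
    have hG0 : 0 ≤ G := (norm_nonneg _).trans (hG 0)
    have h1 : 1 / ε.temp t ≤ 1 / ε.temp t' := one_div_le_one_div_of_le (ε.pos _) (ε.anti ht)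
    exact mul_nonneg (mul_nonneg hG0 (sub_nonneg.2 h1)) (sub_nonneg.2 (NNReal.coe_le_coe.2 ht))
  set m := (volume : Measure (UnitAddTorus (Fin d))).prod (unifSph d) with hm
  set β₀ := lawAt U (.const (ε.pos t)) r α t t' + (a * ENNReal.ofReal k) • m with hβ₀
  have hat : a ≠ ⊤ := (le_add_self.trans_eq hα).trans_lt ENNReal.one_lt_top |>.ne
  have key : ∀ {B : Set (State d)} {ρ : Measure (State d)} [IsProbabilityMeasure ρ],
      MeasurableSet B → α ≤ ρ → β₀ B ≤ ∫⁻ z, ∫⁻ ξ, B.indicator 1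
        (process U (.const (ε.pos t)) r t t' z ξ) ∂noise d ∂ρ := by
    intro B ρ _ hB hρ
    have h1 := lintegral_add_minorant_le hρ
      (fun z => hk z (measurable_one.indicator hB)) hα
    rw [lintegral_indicator_one hB] at h1
    rwa [hβ₀, Measure.add_apply, lawAt_apply _ _ _ _ _ _ hB, Measure.smul_apply, smul_eq_mul,
      mul_assoc]
  set E := ENNReal.ofReal (Real.exp (-δ)) with hE
  have hE1 : E ≤ 1 := by
    rw [hE, ENNReal.ofReal_le_one, Real.exp_le_one_iff]
    linarith
  have hle1 : E • β₀ ≤ lawAt U ε r μ t t' := by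
    refine Measure.le_iff.2 fun B hB => ?_
    rw [Measure.smul_apply, smul_eq_mul, lawAt_apply _ _ _ _ _ _ hB]
    refine (mul_le_mul_right (key hB hα₁) _).trans ?_
    rw [← lintegral_const_mul' _ _ ENNReal.ofReal_ne_top]
    exact lintegral_mono fun z => lintegral_process_ge hG hr ht (measurable_one.indicator hB)
      (indicator_le_self' fun _ _ => zero_le) z
  have hle2 : E • β₀ ≤ gibbs U ε t := by
    refine Measure.le_iff.2 fun B hB => ?_
    rw [Measure.smul_apply, smul_eq_mul]
    refine (mul_le_of_le_one_left' hE1).trans ((key hB hα₂).trans_eq ?_)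
    refine (lintegral_process_gibbs (ε.pos t) hr (measurable_one.indicator hB)
      (indicator_le_self' fun _ _ => zero_le) (NNReal.coe_le_coe.2 ht)).trans ?_
    rw [lintegral_indicator_one hB]
    rfl
  refine (tvDist_le_of_le hle1 hle2).trans ?_
  have hmass : (E • β₀).real univ = Real.exp (-δ) * (1 - (1 - k) * a.toReal) := by
    have h3 : lawAt U (.const (ε.pos t)) r α t t' univ = α univ := by
      rw [lawAt, Measure.map_apply (measurable_process _ _ _ _ _) .univ, preimage_univ,
        ← univ_prod_univ, Measure.prod_prod, measure_univ (μ := noise d), mul_one]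
    have h4 : (α univ).toReal = 1 - a.toReal := by
      have := congrArg ENNReal.toReal hα
      rw [ENNReal.toReal_add (measure_ne_top _ _) hat, ENNReal.toReal_one] at this
      linarith
    rw [Measure.real, Measure.smul_apply, hβ₀, Measure.add_apply, Measure.smul_apply, h3,
      measure_univ (μ := m), smul_eq_mul, smul_eq_mul, mul_one, ENNReal.toReal_mul,
      ENNReal.toReal_add (measure_ne_top _ _) (by finiteness), ENNReal.toReal_mul, h4,
      ENNReal.toReal_ofReal (Real.exp_pos _).le, ENNReal.toReal_ofReal hk0]
    ring
  have hq0 : 0 ≤ Real.exp (-δ) * (1 - (1 - k) * a.toReal) := hmass ▸ measureReal_nonneg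
  have ha1 : a.toReal ≤ 1 := by
    have := ENNReal.toReal_mono ENNReal.one_ne_top (le_add_self.trans_eq hα)
    simpa using this
  have hk1 : k ≤ 1 := by
    obtain ⟨z⟩ := nonempty_of_isProbabilityMeasure μ
    have h5 := hk z (measurable_const (a := 1))
    simpa using h5
  rw [hmass, Measure.real]
  -- With x = (1 - k) a in [0, 1], the bound 1 - e^{-δ} (1 - x) is at most 1 - (1 - δ)(1 - x) = x +
  -- δ (1 - x) ≤ x + δ.
  have h6 : 1 - δ ≤ Real.exp (-δ) := by linarith [Real.add_one_le_exp (-δ)]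
  have h7 : 0 ≤ (1 - k) * a.toReal := mul_nonneg (by linarith) ENNReal.toReal_nonneg
  have h8 : (1 - k) * a.toReal ≤ 1 := by
    nlinarith [ENNReal.toReal_nonneg (a := a)]
  nlinarith [mul_le_mul_of_nonneg_right h6 (sub_nonneg.2 h8), mul_nonneg hδ0 h7]

end Contraction

end VelocityJump

/-! ### The theorem: infimum over all couplings -/

open VelocityJump in
theorem mainTheorem5 (d : ℕ) [NeZero d] (r : ℝ) (hr : 0 < r)
    (U : VelocityJump.PeriodicPotential d) :
    ∃ c θ : ℝ, 0 < c ∧ 0 < θ ∧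
      ∀ (ε : VelocityJump.CoolingSchedule) (μ : Measure (VelocityJump.State d))
        [IsProbabilityMeasure μ] (t : ℝ≥0),
        VelocityJump.tvDist (VelocityJump.lawAt U ε r μ t (t + NNReal.sqrt d))
            (VelocityJump.gibbs U ε t) ≤
          (1 - c * Real.exp (-θ / ε.temp t)) *
              VelocityJump.tvDist μ (VelocityJump.gibbs U ε t) +
            θ * (1 / ε.temp (t + NNReal.sqrt d) - 1 / ε.temp t) := by
  obtain ⟨G, hG⟩ := exists_norm_grad_le U
  have hG0 : 0 ≤ G := (norm_nonneg _).trans (hG 0)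
  obtain ⟨c, hc, h⟩ := exists_minorization hr hG
  refine ⟨c, 3 * (G * √d) + 1, hc, by positivity, fun ε μ _ t => ?_⟩
  have hν : IsProbabilityMeasure (gibbs U ε t) := isProbabilityMeasure_gibbsTemp (ε.pos t)
  set k := c * Real.exp (-(3 * (G * √d) + 1) / ε.temp t) with hk
  have ht : t ≤ t + NNReal.sqrt d := le_self_add
  have htt : ((t + NNReal.sqrt d : ℝ≥0) : ℝ) = t + √d := by simp
  have hkm := fun z f hf => h (ε.temp t) (ε.pos t) t z (f := f) hf
  rw [← htt] at hkm
  have hk1 : k ≤ 1 := by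
    obtain ⟨z⟩ := nonempty_of_isProbabilityMeasure μ
    have h5 := hkm z 1 measurable_one
    rw [← hk] at h5
    simpa using h5
  set δ := G * (1 / ε.temp (t + NNReal.sqrt d) - 1 / ε.temp t) *
    (((t + NNReal.sqrt d : ℝ≥0) : ℝ) - t) with hδ
  have hb : ∀ a ∈ {a : ℝ | ∃ π : Measure (State d × State d), π.map Prod.fst = μ ∧
      π.map Prod.snd = gibbs U ε t ∧ a = π.real {q | q.1 ≠ q.2}},
      tvDist (lawAt U ε r μ t (t + NNReal.sqrt d)) (gibbs U ε t) ≤ (1 - k) * a + δ := by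
    rintro a ⟨π, h₁, h₂, rfl⟩
    exact tvDist_lawAt_le hr hG ht (by positivity) (fun z f hf => hkm z f hf) h₁ h₂
  have hne : {a : ℝ | ∃ π : Measure (State d × State d), π.map Prod.fst = μ ∧
      π.map Prod.snd = gibbs U ε t ∧ a = π.real {q | q.1 ≠ q.2}}.Nonempty :=
    ⟨_, μ.prod (gibbs U ε t), by simp, by simp, rfl⟩
  have hδθ : δ ≤ (3 * (G * √d) + 1) * (1 / ε.temp (t + NNReal.sqrt d) - 1 / ε.temp t) := by
    have h1 : 1 / ε.temp t ≤ 1 / ε.temp (t + NNReal.sqrt d) :=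
      one_div_le_one_div_of_le (ε.pos _) (ε.anti ht)
    rw [hδ, htt, add_sub_cancel_left, mul_right_comm]
    refine mul_le_mul_of_nonneg_right ?_ (sub_nonneg.2 h1)
    have : 0 ≤ G * √d := by positivity
    linarith
  have hfin : tvDist (lawAt U ε r μ t (t + NNReal.sqrt d)) (gibbs U ε t) ≤
      (1 - k) * tvDist μ (gibbs U ε t) + δ := by
    -- Passing to the infimum over couplings divides by 1 - k. If k = 1 the bound no longer depends
    -- on the coupling, and any one will do.
    rcases (sub_nonneg.2 hk1).eq_or_lt with h0 | h0
    · obtain ⟨a, ha⟩ := hne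
      have := hb a ha
      rwa [← h0, zero_mul] at this ⊢
    · rw [← sub_le_iff_le_add, ← div_le_iff₀' h0]
      refine le_csInf hne fun a ha => ?_
      rw [div_le_iff₀' h0, sub_le_iff_le_add]
      exact hb a ha
  linarith
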